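/- \textbf{Proposition (Stability).} Let $p>0$. Put \[ \rho=\begin{cases}\infty&p>2\\ \frac{4}{4-p}&p\le 2\end{cases},\quad q=\begin{cases}\frac{p^2+2p}{2}&p>2\\ 2p+4&p\le2\end{cases},\quad r=\begin{cases}p+2&p>2\\ \frac{4p+8}{p}&p\le2\end{cases},\quad \alpha=\begin{cases}\frac{p^2+2p}{2p+2}&p>2\\ \frac{2p+4}{p+1}&p\le2\end{cases},\quad \beta=\begin{cases}\frac{p+2}{p+1}&p>2\\ \frac{4p+8}{3p+8}&p\le2,\end{cases} \] and, for a time interval $I\subseteq\mathbb R$, $X(I)=L_t^qL_x^r(I\times\mathbb R^2)$ and $Y(I)=L_t^\alpha L_x^\beta(I\times\mathbb R^2)$. Call $a:\mathbb R^2\to\mathbb R$ \emph{admissible} if it is nonnegative and continuous, $a,\nabla a\in L^\infty(\mathbb R^2)$ and, if $p\le 2$, also $a,\nabla a\in L^1(\mathbb R^2)$ (with $\nabla a$ the weak gradient), $x\cdot\nabla a(x)\le0$ for almost every $x$, and the radial limits $\lim_{R\to\infty}a(R\theta)$, $\theta\in\mathbb S^1$, exist and depend continuously on $\theta$. Write $F(v)=a|v|^pv$.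 Solutions of $(i\partial_t+\Delta)v=G$ on $I\times\mathbb R^2$ with datum $v(t_0)$, $t_0\in I$, are understood in the sense of the Duhamel formula \[ v(t)=e^{i(t-t_0)\Delta}v(t_0)-i\int_{t_0}^te^{i(t-s)\Delta}G(s)\,ds\qquad\text{for a.e. } t\in I, \] as an identity of tempered distributions on $\mathbb R^2$ (tested against Schwartz functions, with absolutely convergent pairings). For all $L>0$ and $A\ge0$ there exist $\varepsilon_1>0$ and $C>0$, depending only on $p$, $L$ and $A$, such that the following holds for every admissible $a$ with $\|a\|_{L^\rho(\mathbb R^2)}\le A$. Let $I\subseteq\mathbb R$ be an interval, $t_0\in I$, $u_0\in H^1(\mathbb R^2)$, and let $\tilde u,e:I\times\mathbb R^2\to\mathbb C$ be measurable such that $\tilde u$ is a solution of \[ (i\partial_t+\Delta)\tilde u=F(\tilde u)+e \] on $I\times\mathbb{R}^2$ with datum $\tilde u_0=\tilde u(t_0)$ and $\|\tilde u\|_{X(I)}\le L$. Suppose that \[ \|u_0-\tilde u_0\|_{H^1(\mathbb R^2)}+\|e\|_{Y(I)}<\varepsilon \] for some $\varepsilon\le\varepsilon_1$. Then the global solution $u\in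 C(\mathbb R;H^1(\mathbb R^2))$ of $i\partial_tu+\Delta u=a|u|^pu$ with $u(t_0)=u_0$ satisfies \[ \|u-\tilde u\|_{X(I)}+\|F(u)-F(\tilde u)\|_{Y(I)}\le C\varepsilon . \] -/

import Mathlib

open MeasureTheory Filter Topology
open scoped ENNReal SchwartzMap FourierTransform ContDiff

namespace StabilityNLS

noncomputable section

/-- The plane `ℝ²` with its Euclidean norm. -/
abbrev Plane : Type := EuclideanSpace ℝ (Fin 2)

/-! ### Exponents -/

/-- The exponent `ρ = ρ(p)` of the weight. -/
def rhoExp (p : ℝ) : ℝ≥0∞ := if 2 < p then ⊤ else ENNReal.ofReal (4 / (4 - p))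

/-- The time exponent `q = q(p)` of `X`. -/
def qExp (p : ℝ) : ℝ := if 2 < p then (p ^ 2 + 2 * p) / 2 else 2 * p + 4

/-- The space exponent `r = r(p)` of `X`. -/
def rExp (p : ℝ) : ℝ := if 2 < p then p + 2 else (4 * p + 8) / p

/-- The time exponent `α = α(p)` of `Y`. -/
def alphaExp (p : ℝ) : ℝ :=
  if 2 < p then (p ^ 2 + 2 * p) / (2 * p + 2) else (2 * p + 4) / (p + 1)

/-- The space exponent `β = β(p)` of `Y`. -/
def betaExp (p : ℝ) : ℝ :=
  if 2 < p then (p + 2) / (p + 1) else (4 * p + 8) / (3 * p + 8)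

/-! ### Norms -/

/-- The space-time norm `‖v‖_{L_t^m L_x^k(I × ℝ²)} = ‖ ‖v(t, ·)‖_{L^k(ℝ²)} ‖_{L^m(I)}`. -/
def mixedNorm (m k : ℝ) (I : Set ℝ) (v : ℝ → Plane → ℂ) : ℝ≥0∞ :=
  eLpNorm (fun t => eLpNorm (v t) (ENNReal.ofReal k) volume) (ENNReal.ofReal m)
    (volume.restrict I)

/-- The norm of `X(I) = L_t^q L_x^r(I × ℝ²)`. -/
def normX (p : ℝ) (I : Set ℝ) (v : ℝ → Plane → ℂ) : ℝ≥0∞ := mixedNorm (qExp p) (rExp p) I v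

/-- The norm of `Y(I) = L_t^α L_x^β(I × ℝ²)`. -/
def normY (p : ℝ) (I : Set ℝ) (v : ℝ → Plane → ℂ) : ℝ≥0∞ :=
  mixedNorm (alphaExp p) (betaExp p) I v

open Classical in
/-- The norm of `H¹(ℝ²)`, i.e. `(‖f‖_{L²}² + ‖∇f‖_{L²}²)^{1/2}`, computed through the `L²` Fourier
transform, where `∇` has the symbol `2πiξ`; it is `⊤` when `f` is not in `H¹(ℝ²)`. -/
def normH1 (f : Plane → ℂ) : ℝ≥0∞ :=
  if h : MemLp f 2 volume then
    eLpNorm (fun ξ : Plane => √(1 + (2 * Real.pi * ‖ξ‖) ^ 2) • (𝓕 (h.toLp f) : Lp ℂ 2 volume) ξ)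
      2 volume
  else ⊤

/-! ### The weight and the nonlinearity -/

/-- `g` is the weak (distributional) gradient of the locally integrable function `a`. -/
def IsWeakGradient (a : Plane → ℝ) (g : Plane → Plane) : Prop :=
  ∀ φ : Plane → ℝ, ContDiff ℝ ∞ φ → HasCompactSupport φ →
    ∫ x, a x • gradient φ x = -∫ x, φ x • g x

/-- Admissible weights `a` for the power `p`. Since `a` and `∇a` are in `L^∞`, `a` has a Lipschitz
representative; `a` is this representative, so that its radial limits make sense. -/
structure Admissible (p : ℝ) (a : Plane → ℝ) : Prop where
  continuous : Continuous a
  nonneg : ∀ x, 0 ≤ a x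
  memLp_top : MemLp a ⊤ volume
  memLp_one : p ≤ 2 → MemLp a 1 volume
  exists_gradient : ∃ g : Plane → Plane, IsWeakGradient a g ∧ MemLp g ⊤ volume ∧
    (p ≤ 2 → MemLp g 1 volume) ∧ ∀ᵐ x, inner ℝ x (g x) ≤ 0
  exists_radial_limit : ∃ aInf : Metric.sphere (0 : Plane) 1 → ℝ, Continuous aInf ∧
    ∀ θ : Metric.sphere (0 : Plane) 1,
      Tendsto (fun R : ℝ => a (R • (θ : Plane))) atTop (𝓝 (aInf θ))

/-- The nonlinearity `F(v) = a |v|^p v`. -/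
def nonlin (p : ℝ) (a : Plane → ℝ) (v : ℝ → Plane → ℂ) : ℝ → Plane → ℂ :=
  fun t x => (a x : ℂ) * ((‖v t x‖ ^ p : ℝ) : ℂ) * v t x

/-! ### The Schrödinger equation -/

/-- The symbol of `e^{itΔ}`; in the normalization `∫ e^{-2πi x·ξ} f(x) dx` of the Fourier
transform, `-Δ` has the symbol `(2π|ξ|)²`. -/
def freeSymbol (t : ℝ) (ξ : Plane) : ℂ :=
  Complex.exp (((-(t * (2 * Real.pi * ‖ξ‖) ^ 2) : ℝ) : ℂ) * Complex.I)

theorem hasTemperateGrowth_freeSymbol (t : ℝ) : (freeSymbol t).HasTemperateGrowth := by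
  have h1 : Function.HasTemperateGrowth
      (fun θ : ℝ => Complex.exp ((θ : ℂ) * Complex.I)) := by
    have hd : ∀ n : ℕ, iteratedDeriv n (fun θ : ℝ => Complex.exp ((θ : ℂ) * Complex.I)) =
        fun θ : ℝ => Complex.I ^ n * Complex.exp ((θ : ℂ) * Complex.I) := by
      intro n
      induction n with
      | zero => simp
      | succ n ih =>
        rw [iteratedDeriv_succ, ih]
        funext θ
        have h0 : HasDerivAt (fun θ : ℝ => (θ : ℂ) * Complex.I) Complex.I θ := by
          simpa using (Complex.ofRealCLM.hasDerivAt (x := θ)).mul_const Complex.I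
        have := (h0.cexp.const_mul (Complex.I ^ n)).deriv
        rw [this]
        ring
    refine ⟨(Complex.ofRealCLM.contDiff.mul contDiff_const).cexp, fun n => ⟨0, 1, fun θ => ?_⟩⟩
    rw [norm_iteratedFDeriv_eq_norm_iteratedDeriv, hd]
    simp [Complex.norm_exp_ofReal_mul_I]
  have h2 : Function.HasTemperateGrowth
      (fun ξ : Plane => -(t * (2 * Real.pi * ‖ξ‖) ^ 2)) := by
    have : (fun ξ : Plane => -(t * (2 * Real.pi * ‖ξ‖) ^ 2)) =
        fun ξ : Plane => (-(t * (2 * Real.pi) ^ 2)) * ‖ξ‖ ^ 2 := by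
      funext ξ; ring
    rw [this]
    exact (Function.HasTemperateGrowth.const _).mul
      (Function.hasTemperateGrowth_norm_sq Plane)
  exact h1.comp h2

/-- The free propagator `e^{itΔ}` on Schwartz functions, the Fourier multiplier with the symbol
`freeSymbol t`. -/
def freeProp (t : ℝ) : 𝓢(Plane, ℂ) →L[ℂ] 𝓢(Plane, ℂ) :=
  SchwartzMap.fourierMultiplierCLM ℂ (freeSymbol t)

/-- `v` solves `(i∂ₜ + Δ) v = G` on `I × ℝ²` with datum `v(t₀)` at the time `t₀ ∈ I`, in the sense
of the Duhamel formula
`v(t) = e^{i(t-t₀)Δ} v(t₀) - i ∫_{t₀}^t e^{i(t-s)Δ} G(s) ds` for almost all `t ∈ I`,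
an identity between tempered distributions on `ℝ²`: it is tested against all Schwartz functions
`ψ`, the propagator being moved to `ψ` by `⟨e^{iτΔ} f, ψ⟩ = ⟨f, e^{iτΔ} ψ⟩` for the bilinear
pairing `⟨f, ψ⟩ = ∫ f ψ dx`. All integrals are required to converge absolutely. -/
def IsDuhamelSolution (I : Set ℝ) (t₀ : ℝ) (v G : ℝ → Plane → ℂ) : Prop :=
  ∀ᵐ t ∂(volume.restrict I), ∀ ψ : 𝓢(Plane, ℂ),
    Integrable (fun x => v t x * ψ x) ∧
    Integrable (fun x => v t₀ x * freeProp (t - t₀) ψ x) ∧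
    IntegrableOn (fun z : ℝ × Plane => G z.1 z.2 * freeProp (t - z.1) ψ z.2)
      (Set.uIoc t₀ t ×ˢ Set.univ) ∧
    (∫ x, v t x * ψ x) =
      (∫ x, v t₀ x * freeProp (t - t₀) ψ x) -
        Complex.I * ∫ s in t₀..t, ∫ x, G s x * freeProp (t - s) ψ x

/-- `u ∈ C(ℝ; H¹(ℝ²))` is a global solution of `i∂ₜu + Δu = a|u|^p u` with `u(t₀) = u₀`. -/
structure IsGlobalSolution (p : ℝ) (a : Plane → ℝ) (t₀ : ℝ) (u₀ : Plane → ℂ)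
    (u : ℝ → Plane → ℂ) : Prop where
  measurable : AEStronglyMeasurable (fun z : ℝ × Plane => u z.1 z.2)
  mem_H1 : ∀ t, normH1 (u t) < ⊤
  continuous_H1 : ∀ t, Tendsto (fun s => normH1 (fun x => u s x - u t x)) (𝓝 t) (𝓝 0)
  initial : u t₀ =ᵐ[volume] u₀
  duhamel : IsDuhamelSolution Set.univ t₀ u (nonlin p a u)

/-- `v` is an approximate solution on `I × ℝ²` with error `e`: a solution of
`(i∂ₜ + Δ) v = F(v) + e`, with datum `v(t₀)` at the time `t₀`. -/
structure IsApproxSolution (p : ℝ) (a : Plane → ℝ) (I : Set ℝ) (t₀ : ℝ)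
    (v e : ℝ → Plane → ℂ) : Prop where
  measurable : AEStronglyMeasurable (fun z : ℝ × Plane => v z.1 z.2)
    ((volume.restrict I).prod volume)
  measurable_error : AEStronglyMeasurable (fun z : ℝ × Plane => e z.1 z.2)
    ((volume.restrict I).prod volume)
  duhamel : IsDuhamelSolution I t₀ v (fun t x => nonlin p a v t x + e t x)

end

end StabilityNLS

/-!
Let `w = u - ũ`. Duhamel's formula writes `w` as the free evolution of `u₀ - ũ₀` plus a retarded
integral of `F(u) - F(ũ) - e`. The bound `|t|⁻¹` on the kernel of `e^{itΔ}` and conservation of mass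
interpolate to `e^{itΔ} : L^β → L^r` with norm `≲ |t|^{-(1 - 2/r)}`, since `β` is dual to `r`; this
is done for the heat flow in complex time `l + it`, whose kernel is integrable, and then `l → 0`.
Taking spatial norms leaves one real variable: the slice norm `m(t) = ‖w(t)‖_r` satisfies an
integral inequality with the Riesz kernel `|t - s|^{-(1 - 2/r)}`, and by the
Hardy-Littlewood-Sobolev inequality this kernel maps `L^α` to `L^q` in time.

The free evolution of `H¹` data is bounded in `L^q_t L^r_x` by a `TT*` argument. Its kernel contains
the factor `(1 + c|ξ|²)⁻¹` that `H¹` data contribute; writing this factor as an integral of heat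
flows improves the decay `|t|^{-(1 - 2/r)}` near `t = 0` to the power `|t|^{-2/q}` that
Hardy-Littlewood-Sobolev requires.

Hölder's inequality with `a ∈ L^ρ` bounds the slice norm of `F(u) - F(ũ)` by
`A (p + 1) (n + m)^p m`, where `n(t) = ‖ũ(t)‖_r`. While `‖m‖_q ≤ 1`, the mass of `n + m` is at most
`L + 1`, so the time axis splits into boundedly many windows around `t₀`, on each of which the
nonlinear increment is absorbed (a discrete Gronwall inequality). The resulting bound on `‖m‖_q` is
below `1` for small `ε`, so by continuity in the window the assumption `‖m‖_q ≤ 1` never fails.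
-/

namespace StabilityNLS

noncomputable section

/-! ### Layer cakes and fractional integration -/

section LayerCake

variable {α β : Type*} [MeasurableSpace α] [MeasurableSpace β] {μ : Measure α} {ν : Measure β}

theorem lintegral_mul_setLIntegral_lt [SFinite μ] [SFinite ν] {f w : α → ℝ≥0∞} {φ g : β → ℝ≥0∞}
    (hf : Measurable f) (hw : Measurable w) (hφ : Measurable φ) (hg : Measurable g) :
    ∫⁻ x, w x * ∫⁻ y in {y | φ y < f x}, g y ∂ν ∂μ =
      ∫⁻ y, g y * ∫⁻ x in {x | φ y < f x}, w x ∂μ ∂ν := by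
  have hset : MeasurableSet {z : α × β | φ z.2 < f z.1} :=
    measurableSet_lt (hφ.comp measurable_snd) (hf.comp measurable_fst)
  let F : α × β → ℝ≥0∞ := {z | φ z.2 < f z.1}.indicator fun z => w z.1 * g z.2
  have hF : Measurable F :=
    ((hw.comp measurable_fst).mul (hg.comp measurable_snd)).indicator hset
  have hleft (x : α) : ∫⁻ y, F (x, y) ∂ν = w x * ∫⁻ y in {y | φ y < f x}, g y ∂ν := by
    rw [← lintegral_const_mul _ hg, ← lintegral_indicator (measurableSet_lt hφ measurable_const)]
    rfl
  have hright (y : β) : ∫⁻ x, F (x, y) ∂μ = g y * ∫⁻ x in {x | φ y < f x}, w x ∂μ := by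
    rw [← lintegral_const_mul _ hw, ← lintegral_indicator (measurableSet_lt measurable_const hf)]
    simp only [F, mul_comm (w _)]
    rfl
  simp only [← hleft, ← hright]
  exact lintegral_lintegral_swap hF.aemeasurable

theorem setLIntegral_Ioo_rpow {σ R : ℝ} (hσ : -1 < σ) (hR : 0 ≤ R) :
    ∫⁻ b in Set.Ioo 0 R, ENNReal.ofReal (b ^ σ) = ENNReal.ofReal (R ^ (σ + 1) / (σ + 1)) := by
  have hint : IntegrableOn (fun b : ℝ => b ^ σ) (Set.Ioo 0 R) :=
    (intervalIntegrable_iff_integrableOn_Ioo_of_le hR).1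
      (intervalIntegral.intervalIntegrable_rpow' hσ)
  rw [← ofReal_integral_eq_lintegral_ofReal hint, ← integral_Ioc_eq_integral_Ioo,
    ← intervalIntegral.integral_of_le hR, integral_rpow (Or.inl hσ),
    Real.zero_rpow (by linarith), sub_zero]
  filter_upwards [ae_restrict_mem measurableSet_Ioo] with b hb using Real.rpow_nonneg hb.1.le _

theorem setLIntegral_ofReal_lt_rpow {θ : ℝ} (hθ : 0 < θ) (x : ℝ≥0∞) :
    ∫⁻ a in {a | ENNReal.ofReal a < x}, ENNReal.ofReal (a ^ (θ - 1))
        ∂(volume.restrict (Set.Ioi 0)) = x ^ θ / ENNReal.ofReal θ := by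
  have hfinite (R : ℝ) (hR : 0 ≤ R) :
      ∫⁻ a in Set.Ioo 0 R, ENNReal.ofReal (a ^ (θ - 1)) =
        ENNReal.ofReal R ^ θ / ENNReal.ofReal θ := by
    rw [setLIntegral_Ioo_rpow (by linarith) hR, sub_add_cancel,
      ENNReal.ofReal_div_of_pos hθ, ENNReal.ofReal_rpow_of_nonneg hR hθ.le]
  rw [Measure.restrict_restrict (measurableSet_lt ENNReal.measurable_ofReal measurable_const)]
  rcases eq_or_ne x ⊤ with rfl | hx
  · rw [ENNReal.top_rpow_of_pos hθ, ENNReal.top_div_of_ne_top ENNReal.ofReal_ne_top, eq_top_iff]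
    have hlim : Tendsto (fun n : ℕ => ENNReal.ofReal n ^ θ / ENNReal.ofReal θ) atTop (𝓝 ⊤) := by
      have hnat : Tendsto (fun n : ℕ => ENNReal.ofReal n) atTop (𝓝 ⊤) := by
        simpa using ENNReal.tendsto_nat_nhds_top
      have := (ENNReal.continuous_rpow_const (y := θ)).tendsto ⊤ |>.comp hnat
      rw [ENNReal.top_rpow_of_pos hθ] at this
      simpa [ENNReal.top_div_of_ne_top] using
        ENNReal.Tendsto.div_const this (Or.inl ENNReal.top_ne_zero) (b := ENNReal.ofReal θ)
    refine le_of_tendsto' hlim fun n => ?_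
    rw [← hfinite n n.cast_nonneg]
    exact lintegral_mono_set fun a ha => ⟨ENNReal.ofReal_lt_top, ha.1⟩
  · have hset : {a | ENNReal.ofReal a < x} ∩ Set.Ioi 0 = Set.Ioo 0 x.toReal := by
      ext a
      exact ⟨fun h => ⟨h.2, (ENNReal.ofReal_lt_iff_lt_toReal (le_of_lt h.2) hx).1 h.1⟩,
        fun h => ⟨(ENNReal.ofReal_lt_iff_lt_toReal h.1.le hx).2 h.2, h.1⟩⟩
    rw [hset, hfinite _ ENNReal.toReal_nonneg, ENNReal.ofReal_toReal hx]

theorem lintegral_rpow_eq_lintegral_measure_lt [SFinite μ] {f : α → ℝ≥0∞} (hf : Measurable f)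
    {θ : ℝ} (hθ : 0 < θ) :
    ∫⁻ x, f x ^ θ ∂μ = ENNReal.ofReal θ *
      ∫⁻ a in Set.Ioi 0, ENNReal.ofReal (a ^ (θ - 1)) * μ {x | ENNReal.ofReal a < f x} := by
  have hθ' : ENNReal.ofReal θ ≠ 0 := by simpa using hθ
  have hpow (x : α) : f x ^ θ = ENNReal.ofReal θ *
      ∫⁻ a in {a | ENNReal.ofReal a < f x}, ENNReal.ofReal (a ^ (θ - 1))
        ∂(volume.restrict (Set.Ioi 0)) := by
    rw [setLIntegral_ofReal_lt_rpow hθ, ENNReal.mul_div_cancel hθ' ENNReal.ofReal_ne_top]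
  have hswap := lintegral_mul_setLIntegral_lt (μ := μ) (ν := volume.restrict (Set.Ioi (0 : ℝ)))
    (w := fun _ => 1) (g := fun a => ENNReal.ofReal (a ^ (θ - 1))) hf measurable_const
    ENNReal.measurable_ofReal (by fun_prop)
  simp only [one_mul, setLIntegral_one] at hswap
  simp only [hpow]
  rw [lintegral_const_mul' _ _ ENNReal.ofReal_ne_top, hswap]

end LayerCake

section FractionalIntegration

variable {α β : Type*} [MeasurableSpace α] [MeasurableSpace β] {μ : Measure α} {ν : Measure β}
  {c : ℝ≥0∞} {γ P q : ℝ}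

theorem measure_ofReal_lt_le_rpow_neg (hP : 0 < P) {f : β → ℝ≥0∞} (hf : Measurable f)
    (hfP : ∫⁻ s, f s ^ P ∂ν ≤ 1) {a : ℝ} (ha : 0 < a) :
    ν {s | ENNReal.ofReal a < f s} ≤ ENNReal.ofReal (a ^ (-P)) := by
  have hmarkov := mul_meas_ge_le_lintegral (μ := ν) (hf.pow_const P) (ENNReal.ofReal a ^ P)
  rw [Real.rpow_neg ha.le, ENNReal.ofReal_inv_of_pos (by positivity),
    ← ENNReal.ofReal_rpow_of_pos ha, ENNReal.le_inv_iff_mul_le, mul_comm]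
  refine (mul_le_mul_right (measure_mono fun s hs => ?_) _).trans (hmarkov.trans hfP)
  exact ENNReal.rpow_le_rpow (le_of_lt hs) hP.le

theorem setLIntegral_le_mul_le_of_weak [SFinite ν] {k f : β → ℝ≥0∞} (hk : Measurable k)
    (hkν : ∀ E, MeasurableSet E → ∫⁻ s in E, k s ∂ν ≤ c * ν E ^ (1 - γ)) (hγ : γ ≤ 1)
    (hP : 0 < P) (hPγ : P * (1 - γ) < 1) (hf : Measurable f) (hfP : ∫⁻ s, f s ^ P ∂ν ≤ 1)
    {B : ℝ} (hB : 0 ≤ B) :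
    ∫⁻ s in {s | f s ≤ ENNReal.ofReal B}, k s * f s ∂ν ≤
      c * ENNReal.ofReal (B ^ (1 - P * (1 - γ)) / (1 - P * (1 - γ))) := by
  have hlow : MeasurableSet {s | f s ≤ ENNReal.ofReal B} := measurableSet_le hf measurable_const
  set g : β → ℝ≥0∞ := {s | f s ≤ ENNReal.ofReal B}.indicator f
  have hg : Measurable g := hf.indicator hlow
  have hgf (s : β) : g s ≤ f s := Set.indicator_le_self _ _ _
  have hgB (s : β) : g s ≤ ENNReal.ofReal B := Set.indicator_le (fun _ hs => hs) s
  have hlevel (a : ℝ) (ha : 0 < a) : ∫⁻ s in {s | ENNReal.ofReal a < g s}, k s ∂ν ≤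
      c * (Set.Ioo 0 B).indicator (fun a => ENNReal.ofReal (a ^ (-(P * (1 - γ))))) a := by
    rcases le_or_gt B a with hBa | haB
    · have : {s | ENNReal.ofReal a < g s} = ∅ := Set.eq_empty_of_forall_notMem fun s hs =>
        (hs.trans_le ((hgB s).trans (ENNReal.ofReal_le_ofReal hBa))).false
      simp [this]
    · have hmarkov : ν {s | ENNReal.ofReal a < g s} ≤ ENNReal.ofReal (a ^ (-P)) :=
        (measure_mono fun s hs => lt_of_lt_of_le hs (hgf s)).trans
          (measure_ofReal_lt_le_rpow_neg hP hf hfP ha)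
      rw [Set.indicator_of_mem (Set.mem_Ioo.2 ⟨ha, haB⟩), ← neg_mul, Real.rpow_mul ha.le,
        ← ENNReal.ofReal_rpow_of_pos (by positivity)]
      exact (hkν _ (measurableSet_lt measurable_const hg)).trans (by gcongr)
  calc ∫⁻ s in {s | f s ≤ ENNReal.ofReal B}, k s * f s ∂ν
      = ∫⁻ s, k s * g s ∂ν := by
        rw [← lintegral_indicator hlow]
        exact lintegral_congr fun s => Set.indicator_mul_right _ _ _
    _ = ∫⁻ s, k s * ∫⁻ _ in {a | ENNReal.ofReal a < g s}, 1
          ∂(volume.restrict (Set.Ioi 0)) ∂ν := by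
        refine lintegral_congr fun s => ?_
        simpa using congrArg (k s * ·) (setLIntegral_ofReal_lt_rpow one_pos (g s)).symm
    _ = ∫⁻ a in Set.Ioi 0, ∫⁻ s in {s | ENNReal.ofReal a < g s}, k s ∂ν := by
        simpa using lintegral_mul_setLIntegral_lt hg hk ENNReal.measurable_ofReal
          (measurable_const (a := 1)) (ν := volume.restrict (Set.Ioi (0 : ℝ)))
    _ ≤ ∫⁻ a in Set.Ioi 0,
          c * (Set.Ioo 0 B).indicator (fun a => ENNReal.ofReal (a ^ (-(P * (1 - γ))))) a :=
        setLIntegral_mono' measurableSet_Ioi hlevel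
    _ ≤ c * ∫⁻ a in Set.Ioo 0 B, ENNReal.ofReal (a ^ (-(P * (1 - γ)))) := by
        rw [lintegral_const_mul _ (Measurable.indicator (by fun_prop) measurableSet_Ioo),
          ← lintegral_indicator measurableSet_Ioo]
        gcongr
        exact Measure.restrict_le_self
    _ = c * ENNReal.ofReal (B ^ (1 - P * (1 - γ)) / (1 - P * (1 - γ))) := by
        rw [setLIntegral_Ioo_rpow (by linarith) hB, neg_add_eq_sub]

theorem measure_lt_lintegral_mul_le [SigmaFinite μ] [SFinite ν] {k : α → β → ℝ≥0∞}
    (hk : Measurable (Function.uncurry k))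
    (hkμ : ∀ s E, MeasurableSet E → ∫⁻ t in E, k t s ∂μ ≤ c * μ E ^ (1 - γ)) (hγ : 0 < γ)
    {f : β → ℝ≥0∞} (hf : Measurable f) {l : ℝ≥0∞} (hl : l ≠ 0) (hl' : l ≠ ⊤) :
    μ {t | l < ∫⁻ s, k t s * f s ∂ν} ≤ (c * (∫⁻ s, f s ∂ν) / l) ^ (1 / γ) := by
  have hkf : Measurable fun z : α × β => k z.1 z.2 * f z.2 := hk.mul (hf.comp measurable_snd)
  have hT : Measurable fun t => ∫⁻ s, k t s * f s ∂ν := hkf.lintegral_prod_right'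
  set A := {t | l < ∫⁻ s, k t s * f s ∂ν}
  have hA : MeasurableSet A := measurableSet_lt measurable_const hT
  have hfinite (E : Set α) (hE : MeasurableSet E) (hEA : E ⊆ A) (hEμ : μ E ≠ ⊤) :
      μ E ≤ (c * (∫⁻ s, f s ∂ν) / l) ^ (1 / γ) := by
    rcases eq_or_ne (μ E) 0 with h0 | h0
    · simp [h0]
    have hpair : l * μ E ≤ c * (∫⁻ s, f s ∂ν) * μ E ^ (1 - γ) := calc
      l * μ E = ∫⁻ _ in E, l ∂μ := (setLIntegral_const E l).symm
      _ ≤ ∫⁻ t in E, ∫⁻ s, k t s * f s ∂ν ∂μ := setLIntegral_mono hT fun t ht => (hEA ht).le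
      _ = ∫⁻ s, (∫⁻ t in E, k t s ∂μ) * f s ∂ν := by
        rw [lintegral_lintegral_swap hkf.aemeasurable]
        exact lintegral_congr fun s => lintegral_mul_const _ hk.of_uncurry_right
      _ ≤ ∫⁻ s, c * μ E ^ (1 - γ) * f s ∂ν := by
        gcongr with s
        exact hkμ s E hE
      _ = c * (∫⁻ s, f s ∂ν) * μ E ^ (1 - γ) := by
        rw [lintegral_const_mul _ hf, mul_right_comm]
    rw [one_div, ENNReal.le_rpow_inv_iff hγ, ENNReal.le_div_iff_mul_le (Or.inl hl) (Or.inl hl'),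
      ← ENNReal.mul_le_mul_iff_left (c := μ E ^ (1 - γ)) (by simp [h0, hEμ])
        (ENNReal.rpow_ne_top_of_ne_zero h0 hEμ)]
    calc μ E ^ γ * l * μ E ^ (1 - γ) = l * (μ E ^ γ * μ E ^ (1 - γ)) := by ring
      _ = l * μ E := by rw [← ENNReal.rpow_add _ _ h0 hEμ, add_sub_cancel, ENNReal.rpow_one]
      _ ≤ _ := hpair
  rw [← Measure.iSup_restrict_spanningSets]
  refine iSup_le fun n => ?_
  rw [Measure.restrict_apply hA]
  exact hfinite _ (hA.inter (measurableSet_spanningSets μ n)) Set.inter_subset_left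
    (measure_ne_top_of_subset Set.inter_subset_right (measure_spanningSets_lt_top μ n).ne)

theorem measure_lt_lintegral_mul_superlevel_le [SigmaFinite μ] [SFinite ν] {k : α → β → ℝ≥0∞}
    (hk : Measurable (Function.uncurry k))
    (hkμ : ∀ s E, MeasurableSet E → ∫⁻ t in E, k t s ∂μ ≤ c * μ E ^ (1 - γ))
    (hγ : 0 < γ) (hγ1 : γ ≤ 1) (hP : 1 < P) (hc : c ≠ 0) (hc' : c ≠ ⊤)
    {f : β → ℝ≥0∞} (hf : Measurable f) (hfP : ∫⁻ s, f s ^ P ∂ν ≤ 1) {B : ℝ} (hB : 0 < B)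
    {l : ℝ} (hl : 0 < l) :
    μ {t | c * ENNReal.ofReal l <
        ∫⁻ s in {s | ENNReal.ofReal B < f s}, k t s * f s ∂ν} ≤
      ENNReal.ofReal (B ^ ((1 - P) * (1 / γ - 1)) * l ^ (-(1 / γ))) *
        ∫⁻ s in {s | ENNReal.ofReal B < f s}, f s ∂ν := by
  set D := ∫⁻ s in {s | ENNReal.ofReal B < f s}, f s ∂ν
  have hDB : D ≤ ENNReal.ofReal (B ^ (1 - P)) := by
    have hpow (s : β) (hs : ENNReal.ofReal B < f s) :
        f s ≤ ENNReal.ofReal (B ^ (1 - P)) * f s ^ P := by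
      rcases eq_or_ne (f s) ⊤ with htop | htop
      · rw [htop, ENNReal.top_rpow_of_pos (by linarith), ENNReal.mul_top]
        simpa using Real.rpow_pos_of_pos hB _
      · have hfs : f s ≠ 0 := (pos_of_gt hs).ne'
        calc f s = f s ^ (1 - P) * f s ^ P := by
              rw [← ENNReal.rpow_add _ _ hfs htop, sub_add_cancel, ENNReal.rpow_one]
          _ ≤ ENNReal.ofReal (B ^ (1 - P)) * f s ^ P := by
              rw [← ENNReal.ofReal_rpow_of_pos hB]
              rw [← neg_sub P 1, ENNReal.rpow_neg, ENNReal.rpow_neg]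
              gcongr
    calc D ≤ ∫⁻ s in {s | ENNReal.ofReal B < f s}, ENNReal.ofReal (B ^ (1 - P)) * f s ^ P ∂ν :=
          setLIntegral_mono ((hf.pow_const P).const_mul _) hpow
      _ ≤ ENNReal.ofReal (B ^ (1 - P)) * 1 := by
          rw [lintegral_const_mul _ (hf.pow_const P)]
          gcongr
          exact (setLIntegral_le_lintegral _ _).trans hfP
      _ = _ := mul_one _
  have hcl : c * ENNReal.ofReal l ≠ 0 := mul_ne_zero hc (by simpa using hl)
  have hDγ : D ^ (1 / γ) ≤ D * ENNReal.ofReal (B ^ ((1 - P) * (1 / γ - 1))) := by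
    have hγ' : 0 ≤ 1 / γ - 1 := by rw [sub_nonneg, one_le_div hγ]; exact hγ1
    rw [show 1 / γ = 1 + (1 / γ - 1) by ring, ENNReal.rpow_add_of_nonneg _ _ zero_le_one hγ',
      ENNReal.rpow_one, add_sub_cancel_left, Real.rpow_mul hB.le,
      ← ENNReal.ofReal_rpow_of_nonneg (by positivity) hγ']
    gcongr
  refine (measure_lt_lintegral_mul_le hk hkμ hγ hf hcl
    (ENNReal.mul_ne_top hc' ENNReal.ofReal_ne_top) (ν := ν.restrict _)).trans ?_
  rw [ENNReal.mul_div_mul_left _ _ hc hc', ENNReal.div_rpow_of_nonneg _ _ (by positivity),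
    div_eq_mul_inv, ← ENNReal.rpow_neg, ENNReal.ofReal_rpow_of_pos hl,
    ENNReal.ofReal_mul (by positivity)]
  calc D ^ (1 / γ) * ENNReal.ofReal (l ^ (-(1 / γ)))
      ≤ D * ENNReal.ofReal (B ^ ((1 - P) * (1 / γ - 1))) * ENNReal.ofReal (l ^ (-(1 / γ))) := by
        gcongr
    _ = _ := by ring

theorem measure_lt_lintegral_mul_le_of_weak [SigmaFinite μ] [SFinite ν] {k : α → β → ℝ≥0∞}
    (hk : Measurable (Function.uncurry k))
    (hkν : ∀ t E, MeasurableSet E → ∫⁻ s in E, k t s ∂ν ≤ c * ν E ^ (1 - γ))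
    (hkμ : ∀ s E, MeasurableSet E → ∫⁻ t in E, k t s ∂μ ≤ c * μ E ^ (1 - γ))
    (hγ : 0 < γ) (hγ1 : γ < 1) (hP : 1 < P) (hq : 0 < q) (hPq : 1 / q + 1 = 1 / P + γ)
    (hc : c ≠ 0) (hc' : c ≠ ⊤) {f : β → ℝ≥0∞} (hf : Measurable f) (hfP : ∫⁻ s, f s ^ P ∂ν ≤ 1)
    {l : ℝ} (hl : 0 < l) :
    μ {t | 2 * (c / ENNReal.ofReal (P / q)) * ENNReal.ofReal l < ∫⁻ s, k t s * f s ∂ν} ≤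
      ENNReal.ofReal (l ^ (-(q / P))) *
        ∫⁻ s in {s | ENNReal.ofReal l < f s ^ (P / q)}, f s ∂ν := by
  have hP0 : 0 < P := one_pos.trans hP
  have hκ : 1 - P * (1 - γ) = P / q := by field_simp at hPq ⊢; linarith
  have hκ0 : 0 < P / q := by positivity
  have hκ1 : P / q ≤ 1 := by rw [← hκ]; nlinarith
  set c₁ := c / ENNReal.ofReal (P / q)
  have hc₁ : c₁ ≠ 0 := ENNReal.div_ne_zero.2 ⟨hc, ENNReal.ofReal_ne_top⟩
  have hc₁' : c₁ ≠ ⊤ := ENNReal.div_ne_top hc' (by simpa using hκ0)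
  have hcc₁ : c ≤ c₁ := ENNReal.le_div_iff_mul_le (Or.inl (by simpa using hκ0))
    (Or.inl ENNReal.ofReal_ne_top) |>.2 (mul_le_of_le_one_right' (by simpa using hκ1))
  set B := l ^ (q / P) with hB_def
  have hB : 0 < B := Real.rpow_pos_of_pos hl _
  have hBl : B ^ (P / q) = l := by
    rw [hB_def, ← Real.rpow_mul hl.le, div_mul_div_cancel₀ hP0.ne', div_self hq.ne', Real.rpow_one]
  have hlevel : {s | ENNReal.ofReal l < f s ^ (P / q)} = {s | ENNReal.ofReal B < f s} := by
    ext s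
    rw [Set.mem_ofPred_eq, Set.mem_ofPred_eq, ← hBl, ← ENNReal.ofReal_rpow_of_pos hB,
      ENNReal.rpow_lt_rpow_iff hκ0]
  have hcompl : {s | ENNReal.ofReal B < f s}ᶜ = {s | f s ≤ ENNReal.ofReal B} := by
    ext s; simp
  have hsub : {t | 2 * c₁ * ENNReal.ofReal l < ∫⁻ s, k t s * f s ∂ν} ⊆
      {t | c₁ * ENNReal.ofReal l < ∫⁻ s in {s | ENNReal.ofReal B < f s}, k t s * f s ∂ν} := by
    intro t ht
    have hlow : ∫⁻ s in {s | f s ≤ ENNReal.ofReal B}, k t s * f s ∂ν ≤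
        c₁ * ENNReal.ofReal l := by
      have := setLIntegral_le_mul_le_of_weak hk.of_uncurry_left (hkν t) hγ1.le hP0 (by linarith)
        hf hfP hB.le
      rwa [hκ, hBl, ENNReal.ofReal_div_of_pos hκ0, ← ENNReal.mul_comm_div] at this
    rw [Set.mem_ofPred_eq, two_mul, add_mul,
      ← lintegral_add_compl _ (measurableSet_lt measurable_const hf), hcompl] at ht
    exact lt_of_not_ge fun hle => ht.not_ge (add_le_add hle hlow)
  rw [hlevel]
  refine (measure_mono hsub).trans ((measure_lt_lintegral_mul_superlevel_le hk
    (fun s E hE => (hkμ s E hE).trans (by gcongr)) hγ hγ1.le hP hc₁ hc₁' hf hfP hB hl).trans_eq ?_)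
  congr 2
  rw [hB_def, ← Real.rpow_mul hl.le, ← Real.rpow_add hl]
  congr 1
  field_simp at hPq ⊢
  linear_combination (-1 : ℝ) * hPq

theorem setLIntegral_rpow_mul_setLIntegral_lt_rpow [SFinite ν] {f : β → ℝ≥0∞} (hf : Measurable f)
    {κ θ : ℝ} (hκ : 0 < κ) (hθ : 0 < θ) :
    ∫⁻ l in Set.Ioi 0, ENNReal.ofReal (l ^ (θ - 1)) *
      ∫⁻ s in {s | ENNReal.ofReal l < f s ^ κ}, f s ∂ν =
        (∫⁻ s, f s ^ (κ * θ + 1) ∂ν) / ENNReal.ofReal θ := by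
  have hpow (s : β) : f s * (f s ^ κ) ^ θ = f s ^ (κ * θ + 1) := by
    rw [ENNReal.rpow_add_of_nonneg _ _ (by positivity) zero_le_one, ENNReal.rpow_mul,
      ENNReal.rpow_one, mul_comm]
  rw [← lintegral_mul_setLIntegral_lt (hf.pow_const _) hf ENNReal.measurable_ofReal
    (by fun_prop)]
  simp only [setLIntegral_ofReal_lt_rpow hθ, div_eq_mul_inv, ← mul_assoc, hpow]
  rw [lintegral_mul_const _ (hf.pow_const _)]

/-- The constant of the fractional integration inequality for kernels whose integrals over a set
`E` are at most `c |E|^{1-γ}`. -/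
def fractionalConst (c : ℝ≥0∞) (P q : ℝ) : ℝ≥0∞ :=
  2 * (c / ENNReal.ofReal (P / q)) * ENNReal.ofReal (P / (P - 1)) ^ (1 / q)

theorem fractionalConst_ne_zero (hP : 1 < P) (hc : c ≠ 0) : fractionalConst c P q ≠ 0 := by
  have hP1 : 0 < P / (P - 1) := div_pos (one_pos.trans hP) (by linarith)
  refine mul_ne_zero (mul_ne_zero two_ne_zero
    (ENNReal.div_ne_zero.2 ⟨hc, ENNReal.ofReal_ne_top⟩)) ?_
  exact (ENNReal.rpow_pos (by simpa using hP1) ENNReal.ofReal_ne_top).ne'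

theorem lintegral_rpow_lintegral_mul_le [SigmaFinite μ] [SFinite ν] {k : α → β → ℝ≥0∞}
    (hk : Measurable (Function.uncurry k))
    (hkν : ∀ t E, MeasurableSet E → ∫⁻ s in E, k t s ∂ν ≤ c * ν E ^ (1 - γ))
    (hkμ : ∀ s E, MeasurableSet E → ∫⁻ t in E, k t s ∂μ ≤ c * μ E ^ (1 - γ))
    (hγ : 0 < γ) (hγ1 : γ < 1) (hP : 1 < P) (hq : 0 < q) (hPq : 1 / q + 1 = 1 / P + γ)
    (hc : c ≠ 0) (hc' : c ≠ ⊤) {f : β → ℝ≥0∞} (hf : Measurable f) (hfP : ∫⁻ s, f s ^ P ∂ν ≤ 1) :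
    ∫⁻ t, (∫⁻ s, k t s * f s ∂ν) ^ q ∂μ ≤ fractionalConst c P q ^ q := by
  have hκ : 0 < P / q := by positivity
  have hθ : 0 < (P - 1) / (P / q) := div_pos (by linarith) hκ
  set T := fun t => ∫⁻ s, k t s * f s ∂ν
  have hT : Measurable T := (hk.mul (hf.comp measurable_snd)).lintegral_prod_right'
  set C := 2 * (c / ENNReal.ofReal (P / q)) with hC_def
  have hC : C ≠ 0 := mul_ne_zero two_ne_zero (ENNReal.div_ne_zero.2 ⟨hc, ENNReal.ofReal_ne_top⟩)
  have hC' : C ≠ ⊤ := ENNReal.mul_ne_top (by simp) (ENNReal.div_ne_top hc' (by simpa using hκ))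
  have hlevel (l : ℝ) (hl : 0 < l) :
      ENNReal.ofReal (l ^ (q - 1)) * μ {t | ENNReal.ofReal l < T t / C} ≤
        ENNReal.ofReal (l ^ ((P - 1) / (P / q) - 1)) *
          ∫⁻ s in {s | ENNReal.ofReal l < f s ^ (P / q)}, f s ∂ν := by
    have hset : {t | ENNReal.ofReal l < T t / C} = {t | C * ENNReal.ofReal l < T t} := by
      simp only [ENNReal.lt_div_iff_mul_lt (Or.inl hC) (Or.inl hC'), mul_comm C]
    have hexp : (P - 1) / (P / q) - 1 = q - 1 + -(q / P) := by field_simp; ring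
    rw [hset, hexp, Real.rpow_add hl, ENNReal.ofReal_mul (by positivity),
      mul_assoc (ENNReal.ofReal _)]
    exact mul_le_mul_right
      (measure_lt_lintegral_mul_le_of_weak hk hkν hkμ hγ hγ1 hP hq hPq hc hc' hf hfP hl) _
  have hnormalized : ∫⁻ t, (T t / C) ^ q ∂μ ≤ ENNReal.ofReal (P / (P - 1)) := calc
    ∫⁻ t, (T t / C) ^ q ∂μ = ENNReal.ofReal q * ∫⁻ l in Set.Ioi 0,
        ENNReal.ofReal (l ^ (q - 1)) * μ {t | ENNReal.ofReal l < T t / C} :=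
      lintegral_rpow_eq_lintegral_measure_lt (hT.div_const C) hq
    _ ≤ ENNReal.ofReal q * ∫⁻ l in Set.Ioi 0, ENNReal.ofReal (l ^ ((P - 1) / (P / q) - 1)) *
        ∫⁻ s in {s | ENNReal.ofReal l < f s ^ (P / q)}, f s ∂ν := by
      gcongr _ * ?_
      exact setLIntegral_mono' measurableSet_Ioi hlevel
    _ = ENNReal.ofReal q * ((∫⁻ s, f s ^ P ∂ν) / ENNReal.ofReal ((P - 1) / (P / q))) := by
      rw [setLIntegral_rpow_mul_setLIntegral_lt_rpow hf hκ hθ, mul_div_cancel₀ _ hκ.ne',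
        sub_add_cancel]
    _ ≤ ENNReal.ofReal q * (1 / ENNReal.ofReal ((P - 1) / (P / q))) := by gcongr
    _ = ENNReal.ofReal (P / (P - 1)) := by
      rw [one_div, ← ENNReal.ofReal_inv_of_pos hθ, ← ENNReal.ofReal_mul hq.le]
      congr 1
      have : P - 1 ≠ 0 := by linarith
      field_simp
  calc ∫⁻ t, T t ^ q ∂μ = ∫⁻ t, C ^ q * (T t / C) ^ q ∂μ := by
        refine lintegral_congr fun t => ?_
        rw [← ENNReal.mul_rpow_of_nonneg _ _ hq.le, ENNReal.mul_div_cancel hC hC']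
    _ = C ^ q * ∫⁻ t, (T t / C) ^ q ∂μ :=
        lintegral_const_mul _ ((hT.div_const C).pow_const q)
    _ ≤ C ^ q * ENNReal.ofReal (P / (P - 1)) := by gcongr
    _ = fractionalConst c P q ^ q := by
        rw [fractionalConst, ← hC_def, ENNReal.mul_rpow_of_nonneg C _ hq.le, ← ENNReal.rpow_mul,
          one_div_mul_cancel hq.ne', ENNReal.rpow_one]

theorem lintegral_div_eLpNorm'_rpow_le_one {f : β → ℝ≥0∞} (hf : Measurable f) (hP : 0 < P) :
    ∫⁻ s, (f s / eLpNorm' f P ν) ^ P ∂ν ≤ 1 := by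
  have hN : ∫⁻ s, f s ^ P ∂ν = eLpNorm' f P ν ^ P := by
    simp [eLpNorm', ← ENNReal.rpow_mul, hP.ne']
  simp only [ENNReal.div_rpow_of_nonneg _ _ hP.le, div_eq_mul_inv (f _ ^ P)]
  rw [lintegral_mul_const _ (hf.pow_const P), hN]
  exact ENNReal.mul_inv_le_one _

theorem eLpNorm'_lintegral_mul_le [SigmaFinite μ] [SFinite ν] {k : α → β → ℝ≥0∞}
    (hk : Measurable (Function.uncurry k))
    (hkν : ∀ t E, MeasurableSet E → ∫⁻ s in E, k t s ∂ν ≤ c * ν E ^ (1 - γ))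
    (hkμ : ∀ s E, MeasurableSet E → ∫⁻ t in E, k t s ∂μ ≤ c * μ E ^ (1 - γ))
    (hγ : 0 < γ) (hγ1 : γ < 1) (hP : 1 < P) (hq : 0 < q) (hPq : 1 / q + 1 = 1 / P + γ)
    (hc : c ≠ 0) (hc' : c ≠ ⊤) {f : β → ℝ≥0∞} (hf : AEMeasurable f ν) :
    eLpNorm' (fun t => ∫⁻ s, k t s * f s ∂ν) q μ ≤ fractionalConst c P q * eLpNorm' f P ν := by
  wlog hfm : Measurable f generalizing f
  · have hTf : (fun t => ∫⁻ s, k t s * f s ∂ν) = fun t => ∫⁻ s, k t s * hf.mk f s ∂ν := by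
      funext t
      exact lintegral_congr_ae (hf.ae_eq_mk.mono fun s hs => by simp only [hs])
    rw [hTf, eLpNorm'_congr_ae hf.ae_eq_mk]
    exact this hf.measurable_mk.aemeasurable hf.measurable_mk
  have hP0 : 0 < P := one_pos.trans hP
  set N := eLpNorm' f P ν
  rcases eq_or_ne N 0 with hN0 | hN0
  · have hf0 : f =ᵐ[ν] 0 := (eLpNorm'_eq_zero_iff hP0 hf.aestronglyMeasurable).1 hN0
    have hTf (t : α) : ∫⁻ s, k t s * f s ∂ν = 0 := by
      rw [lintegral_congr_ae (hf0.mono fun s hs => by rw [hs, Pi.zero_apply, mul_zero]),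
        lintegral_zero]
    simp [eLpNorm', hTf, hq]
  rcases eq_or_ne N ⊤ with hN | hN
  · rw [hN, ENNReal.mul_top (fractionalConst_ne_zero hP hc)]
    exact le_top
  have hscale (t : α) : ∫⁻ s, k t s * f s ∂ν = N * ∫⁻ s, k t s * (f s / N) ∂ν := by
    rw [← lintegral_const_mul' _ _ hN]
    refine lintegral_congr fun s => ?_
    rw [mul_left_comm, ENNReal.mul_div_cancel hN0 hN]
  calc eLpNorm' (fun t => ∫⁻ s, k t s * f s ∂ν) q μ
      = N * (∫⁻ t, (∫⁻ s, k t s * (f s / N) ∂ν) ^ q ∂μ) ^ (1 / q) := by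
        simp only [eLpNorm', enorm_eq_self, hscale, ENNReal.mul_rpow_of_nonneg _ _ hq.le]
        rw [lintegral_const_mul' _ _ (ENNReal.rpow_ne_top_of_nonneg hq.le hN),
          ENNReal.mul_rpow_of_nonneg _ _ (by positivity), ← ENNReal.rpow_mul,
          mul_one_div_cancel hq.ne', ENNReal.rpow_one]
    _ ≤ N * (fractionalConst c P q ^ q) ^ (1 / q) := by
        gcongr
        exact lintegral_rpow_lintegral_mul_le hk hkν hkμ hγ hγ1 hP hq hPq hc hc'
          (hfm.div_const N) (lintegral_div_eLpNorm'_rpow_le_one hfm hP0)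
    _ = fractionalConst c P q * N := by
        rw [← ENNReal.rpow_mul, mul_one_div_cancel hq.ne', ENNReal.rpow_one, mul_comm]

end FractionalIntegration

/-- The kernel `|x|^{-γ}` of the Riesz potential on the line. -/
def rieszKer (γ x : ℝ) : ℝ≥0∞ := ENNReal.ofReal (|x| ^ (-γ))

theorem measurable_rieszKer (γ : ℝ) : Measurable (rieszKer γ) := by
  unfold rieszKer
  fun_prop

theorem rieszKer_sub_comm (γ s t : ℝ) : rieszKer γ (t - s) = rieszKer γ (s - t) := by
  rw [rieszKer, rieszKer, abs_sub_comm]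

theorem setLIntegral_rieszKer_ball_le {γ R : ℝ} (hγ : γ < 1) (hR : 0 ≤ R) :
    ∫⁻ x in Metric.ball 0 R, rieszKer γ x ≤ ENNReal.ofReal (2 / (1 - γ) * R ^ (1 - γ)) := by
  have hpos : ∫⁻ x in Set.Ioo 0 R, rieszKer γ x = ENNReal.ofReal (R ^ (1 - γ) / (1 - γ)) := by
    rw [← neg_add_eq_sub γ 1, ← setLIntegral_Ioo_rpow (by linarith) hR]
    exact setLIntegral_congr_fun measurableSet_Ioo fun x hx => by rw [rieszKer, abs_of_pos hx.1]
  have hneg : ∫⁻ x in Set.Ioo (-R) 0, rieszKer γ x = ∫⁻ x in Set.Ioo 0 R, rieszKer γ x := by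
    rw [← (Measure.measurePreserving_neg volume).setLIntegral_comp_preimage measurableSet_Ioo
      (measurable_rieszKer γ)]
    simp [rieszKer]
  have hball : Metric.ball 0 R ⊆ Set.Ioo (-R) 0 ∪ Set.Ioo 0 R ∪ {0} := by
    intro x hx
    rw [Real.ball_eq_Ioo, zero_sub, zero_add] at hx
    rcases lt_trichotomy x 0 with h | h | h
    exacts [Or.inl (Or.inl ⟨hx.1, h⟩), Or.inr h, Or.inl (Or.inr ⟨h, hx.2⟩)]
  calc ∫⁻ x in Metric.ball 0 R, rieszKer γ x
      ≤ ∫⁻ x in Set.Ioo (-R) 0 ∪ Set.Ioo 0 R ∪ {0}, rieszKer γ x := lintegral_mono_set hball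
    _ ≤ (∫⁻ x in Set.Ioo (-R) 0, rieszKer γ x) + (∫⁻ x in Set.Ioo 0 R, rieszKer γ x) +
          ∫⁻ x in {0}, rieszKer γ x :=
        (lintegral_union_le _ _ _).trans (by gcongr; exact lintegral_union_le _ _ _)
    _ = ENNReal.ofReal (2 / (1 - γ) * R ^ (1 - γ)) := by
        have : 0 ≤ R ^ (1 - γ) / (1 - γ) := div_nonneg (by positivity) (by linarith)
        rw [hneg, hpos, setLIntegral_measure_zero _ _ (by simp), add_zero,
          ← ENNReal.ofReal_add this this]
        congr 1
        ring

theorem setLIntegral_rieszKer_sub_ball_le {γ R : ℝ} (hγ : γ < 1) (hR : 0 ≤ R) (t : ℝ) :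
    ∫⁻ s in Metric.ball t R, rieszKer γ (t - s) ≤
      ENNReal.ofReal (2 / (1 - γ) * R ^ (1 - γ)) := by
  refine le_of_eq_of_le ?_ (setLIntegral_rieszKer_ball_le hγ hR)
  rw [← (Measure.measurePreserving_sub_left volume t).setLIntegral_comp_preimage
    Metric.isOpen_ball.measurableSet (measurable_rieszKer γ)]
  congr 2
  ext s
  simp [Real.dist_eq, abs_sub_comm]

theorem setLIntegral_rieszKer_sub_le {γ : ℝ} (hγ0 : 0 ≤ γ) (hγ : γ < 1) (t : ℝ) {E : Set ℝ} :
    ∫⁻ s in E, rieszKer γ (t - s) ≤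
      ENNReal.ofReal (2 / (1 - γ) + 1) * volume E ^ (1 - γ) := by
  have hγ' : 0 < 1 - γ := by linarith
  have hc : 0 < 2 / (1 - γ) + 1 := by positivity
  rcases eq_or_ne (volume E) 0 with hE0 | hE0
  · rw [setLIntegral_measure_zero _ _ hE0]
    exact zero_le
  rcases eq_or_ne (volume E) ⊤ with hE | hE
  · rw [hE, ENNReal.top_rpow_of_pos hγ', ENNReal.mul_top (by simpa using hc)]
    exact le_top
  set R := (volume E).toReal
  have hR : 0 < R := ENNReal.toReal_pos hE0 hE
  have hRE : volume E = ENNReal.ofReal R := (ENNReal.ofReal_toReal hE).symm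
  have hfar : ∫⁻ s in E \ Metric.ball t R, rieszKer γ (t - s) ≤
      ENNReal.ofReal (R ^ (-γ)) * volume E := calc
    _ ≤ ∫⁻ _ in E \ Metric.ball t R, ENNReal.ofReal (R ^ (-γ)) := by
      refine setLIntegral_mono measurable_const fun s hs => ENNReal.ofReal_le_ofReal
        (Real.rpow_le_rpow_of_nonpos hR ?_ (by linarith))
      simpa [Real.dist_eq, abs_sub_comm] using hs.2
    _ ≤ _ := by
      rw [setLIntegral_const]
      gcongr
      exact Set.sdiff_subset
  calc ∫⁻ s in E, rieszKer γ (t - s)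
      ≤ ∫⁻ s in Metric.ball t R ∪ E \ Metric.ball t R, rieszKer γ (t - s) :=
        lintegral_mono_set (by rw [Set.union_sdiff_self]; exact Set.subset_union_right)
    _ ≤ ENNReal.ofReal (2 / (1 - γ) * R ^ (1 - γ)) + ENNReal.ofReal (R ^ (-γ)) * volume E :=
        (lintegral_union_le _ _ _).trans
          (add_le_add (setLIntegral_rieszKer_sub_ball_le hγ hR.le t) hfar)
    _ = ENNReal.ofReal (2 / (1 - γ) + 1) * volume E ^ (1 - γ) := by
        have hpow : R ^ (-γ) * R = R ^ (1 - γ) := by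
          rw [← Real.rpow_add_one hR.ne', neg_add_eq_sub]
        rw [hRE, ENNReal.ofReal_rpow_of_pos hR, ← ENNReal.ofReal_mul (by positivity), hpow,
          ← ENNReal.ofReal_add (by positivity) (by positivity), ← ENNReal.ofReal_mul hc.le,
          add_mul, one_mul]

theorem exists_eLpNorm'_lintegral_rieszKer_mul_le {γ P q : ℝ} (hγ : 0 < γ) (hγ1 : γ < 1)
    (hP : 1 < P) (hq : 0 < q) (hPq : 1 / q + 1 = 1 / P + γ) :
    ∃ C : ℝ, 0 ≤ C ∧ ∀ (S : Set ℝ) (f : ℝ → ℝ≥0∞), AEMeasurable f (volume.restrict S) →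
      eLpNorm' (fun t => ∫⁻ s in S, rieszKer γ (t - s) * f s) q (volume.restrict S) ≤
        ENNReal.ofReal C * eLpNorm' f P (volume.restrict S) := by
  set c := ENNReal.ofReal (2 / (1 - γ) + 1)
  have hc : c ≠ 0 := by
    have : 0 < 2 / (1 - γ) + 1 := by
      have : 0 < 1 - γ := by linarith
      positivity
    simpa [c] using this
  have hC : fractionalConst c P q ≠ ⊤ := by
    have hκ : 0 < P / q := div_pos (by linarith) hq
    exact ENNReal.mul_ne_top (ENNReal.mul_ne_top (by simp)
      (ENNReal.div_ne_top ENNReal.ofReal_ne_top (by simpa using hκ)))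
      (ENNReal.rpow_ne_top_of_nonneg (by positivity) ENNReal.ofReal_ne_top)
  refine ⟨(fractionalConst c P q).toReal, ENNReal.toReal_nonneg, fun S f hf => ?_⟩
  rw [ENNReal.ofReal_toReal hC]
  have hset (t : ℝ) (E : Set ℝ) (hE : MeasurableSet E) :
      ∫⁻ s in E, rieszKer γ (t - s) ∂(volume.restrict S) ≤
        c * volume.restrict S E ^ (1 - γ) := by
    rw [Measure.restrict_restrict hE, Measure.restrict_apply hE]
    exact setLIntegral_rieszKer_sub_le hγ.le hγ1 t
  exact eLpNorm'_lintegral_mul_le (k := fun t s => rieszKer γ (t - s))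
    ((measurable_rieszKer γ).comp (measurable_fst.sub measurable_snd)) hset
    (fun s E hE => by simpa only [rieszKer_sub_comm γ s] using hset s E hE)
    hγ hγ1 hP hq hPq hc ENNReal.ofReal_ne_top hf

section DualityMethod

theorem eLpNorm'_le_of_forall_restrict_closedBall {α ε : Type*} [PseudoMetricSpace α]
    [MeasurableSpace α] [ENorm ε] {μ : Measure α} {f : α → ε} {q : ℝ} (hq : 0 < q) (a : α)
    {D : ℝ≥0∞} (h : ∀ n : ℕ, eLpNorm' f q (μ.restrict (Metric.closedBall a n)) ≤ D) :
    eLpNorm' f q μ ≤ D := by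
  have hmono : Monotone fun n : ℕ => Metric.closedBall a n := fun m n hmn =>
    Metric.closedBall_subset_closedBall (by exact_mod_cast hmn)
  rw [eLpNorm', one_div, ENNReal.rpow_inv_le_iff hq, ← Measure.restrict_univ (μ := μ),
    ← Metric.iUnion_closedBall_nat a, setLIntegral_iUnion_of_directed _ hmono.directed_le]
  refine iSup_le fun n => ?_
  rw [← ENNReal.rpow_inv_le_iff hq, ← one_div]
  exact h n

variable {H : Type*} [NormedAddCommGroup H] [InnerProductSpace ℂ H]

theorem enorm_inner_le (v w : H) : ‖inner ℂ v w‖ₑ ≤ ‖v‖ₑ * ‖w‖ₑ := by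
  simp_rw [← ofReal_norm]
  rw [← ENNReal.ofReal_mul (norm_nonneg _)]
  exact ENNReal.ofReal_le_ofReal (norm_inner_le_norm _ _)

section Integral

variable [CompleteSpace H] {α : Type*} [MeasurableSpace α] {μ : Measure α}

theorem enorm_inner_integral_le {Θ : α → H} (hΘ : Integrable Θ μ) (v : H) :
    ‖inner ℂ v (∫ t, Θ t ∂μ)‖ₑ ≤ ∫⁻ t, ‖inner ℂ v (Θ t)‖ₑ ∂μ := by
  rw [← integral_inner hΘ v]
  exact enorm_integral_le_lintegral_enorm _

theorem enorm_integral_sq_le {Θ : α → H} (hΘ : Integrable Θ μ) :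
    ‖∫ t, Θ t ∂μ‖ₑ ^ 2 ≤ ∫⁻ s, ∫⁻ t, ‖inner ℂ (Θ s) (Θ t)‖ₑ ∂μ ∂μ := by
  have hinner : ‖∫ t, Θ t ∂μ‖ₑ ^ 2 = ‖inner ℂ (∫ t, Θ t ∂μ) (∫ t, Θ t ∂μ)‖ₑ := by
    rw [inner_self_eq_norm_sq_to_K, enorm_pow, ← enorm_norm (∫ t, Θ t ∂μ)]
    simp [enorm_eq_nnnorm]
  rw [hinner]
  refine (enorm_inner_integral_le hΘ _).trans (lintegral_mono fun s => ?_)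
  rw [← enorm_norm, norm_inner_symm, enorm_norm]
  exact enorm_inner_integral_le hΘ _

end Integral

variable {q : ℝ} {Ψ : ℝ → H} {w : H}

/-- The function `|z|^{q-2} z Ψ` with `z = ⟨Ψ, w⟩`, whose integral is paired with `w` in the
`T T*` argument. -/
def extremizer (q : ℝ) (Ψ : ℝ → H) (w : H) (t : ℝ) : H :=
  ((‖inner ℂ (Ψ t) w‖ ^ (q - 2) : ℝ) * inner ℂ (Ψ t) w : ℂ) • Ψ t

theorem inner_extremizer (hq : 2 < q) (t : ℝ) :
    inner ℂ w (extremizer q Ψ w t) = ((‖inner ℂ (Ψ t) w‖ ^ q : ℝ) : ℂ) := by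
  rw [extremizer, inner_smul_right, mul_assoc, ← inner_conj_symm w, Complex.mul_conj,
    Complex.normSq_eq_norm_sq, ← Complex.ofReal_mul, ← Real.rpow_natCast,
    ← Real.rpow_add_of_nonneg (norm_nonneg _) (by linarith) (by positivity)]
  norm_num

theorem enorm_inner_extremizer_extremizer (hq : 2 < q) (s t : ℝ) :
    ‖inner ℂ (extremizer q Ψ w s) (extremizer q Ψ w t)‖ₑ =
      ‖inner ℂ (Ψ s) w‖ₑ ^ (q - 1) * ‖inner ℂ (Ψ s) (Ψ t)‖ₑ * ‖inner ℂ (Ψ t) w‖ₑ ^ (q - 1) := by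
  have hcoeff (z : ℂ) : ‖((‖z‖ ^ (q - 2) : ℝ) * z : ℂ)‖ₑ = ‖z‖ₑ ^ (q - 1) := by
    rw [enorm_mul, ← ofReal_norm, Complex.norm_real, Real.norm_of_nonneg (by positivity),
      ← ENNReal.ofReal_rpow_of_nonneg (norm_nonneg _) (by linarith), ofReal_norm]
    nth_rw 2 [← ENNReal.rpow_one ‖z‖ₑ]
    rw [← ENNReal.rpow_add_of_nonneg _ _ (by linarith) zero_le_one]
    ring_nf
  rw [extremizer, extremizer, inner_smul_left, inner_smul_right, enorm_mul, enorm_mul,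
    RCLike.enorm_conj, hcoeff, hcoeff]
  ring

theorem integrableOn_extremizer (hq : 2 < q) (hΨ : StronglyMeasurable Ψ) {B : ℝ}
    (hB : ∀ t, ‖Ψ t‖ ≤ B) (R : ℝ) : IntegrableOn (extremizer q Ψ w) (Set.Icc (-R) R) := by
  have hB0 : 0 ≤ B := (norm_nonneg _).trans (hB 0)
  have hz : StronglyMeasurable fun t => inner ℂ (Ψ t) w := hΨ.inner stronglyMeasurable_const
  have hzB (t : ℝ) : ‖inner ℂ (Ψ t) w‖ ≤ B * ‖w‖ :=
    (norm_inner_le_norm _ _).trans (by gcongr; exact hB t)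
  refine IntegrableOn.of_bound (C := (B * ‖w‖) ^ (q - 2) * (B * ‖w‖) * B) (by simp) ?_
    (Eventually.of_forall fun t => ?_)
  · refine (StronglyMeasurable.smul (Measurable.stronglyMeasurable ?_) hΨ).aestronglyMeasurable
    have := hz.measurable
    fun_prop
  · rw [extremizer, norm_smul, norm_mul, Complex.norm_real, Real.norm_of_nonneg (by positivity)]
    gcongr ?_ * ?_ * ?_
    exacts [Real.rpow_le_rpow (norm_nonneg _) (hzB t) (by linarith), hzB t, hB t]

theorem eLpNorm'_rpow_sub_one {α : Type*} [MeasurableSpace α] {μ : Measure α} {f : α → ℝ≥0∞}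
    (hq : 1 < q) :
    eLpNorm' (fun t => f t ^ (q - 1)) (q / (q - 1)) μ = eLpNorm' f q μ ^ (q - 1) := by
  have hq1 : q - 1 ≠ 0 := by linarith
  simp only [eLpNorm', enorm_eq_self, ← ENNReal.rpow_mul, mul_div_cancel₀ q hq1]
  congr 1
  field_simp

theorem lintegral_lintegral_rieszKer_le {q : ℝ} (hq : 2 < q) :
    ∃ C : ℝ, ∀ (S : Set ℝ) (f : ℝ → ℝ≥0∞), AEMeasurable f (volume.restrict S) →
      ∫⁻ s in S, f s ^ (q - 1) * ∫⁻ t in S, rieszKer (2 / q) (s - t) * f t ^ (q - 1) ≤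
        ENNReal.ofReal C * (eLpNorm' f q (volume.restrict S) ^ (q - 1)) ^ 2 := by
  have hq0 : 0 < q := by linarith
  have hconj : (q / (q - 1)).HolderConjugate q :=
    (Real.HolderConjugate.conjExponent (by linarith : 1 < q)).symm
  obtain ⟨C, -, hC⟩ := exists_eLpNorm'_lintegral_rieszKer_mul_le (γ := 2 / q) (P := q / (q - 1))
    (q := q) (by positivity) (by rw [div_lt_one hq0]; exact hq) hconj.lt hq0
    (by field_simp; ring)
  refine ⟨C, fun S f hf => ?_⟩
  have hg : AEMeasurable (fun s => f s ^ (q - 1)) (volume.restrict S) := hf.pow_const _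
  have hGm : AEMeasurable (fun s => ∫⁻ t in S, rieszKer (2 / q) (s - t) * f t ^ (q - 1))
      (volume.restrict S) := by
    refine AEMeasurable.lintegral_prod_right' (f := fun z : ℝ × ℝ =>
      rieszKer (2 / q) (z.1 - z.2) * f z.2 ^ (q - 1)) ?_
    exact ((measurable_rieszKer _).comp (measurable_fst.sub measurable_snd)).aemeasurable.mul
      hg.comp_snd
  calc _ ≤ eLpNorm' (fun s => f s ^ (q - 1)) (q / (q - 1)) (volume.restrict S) *
        eLpNorm' (fun s => ∫⁻ t in S, rieszKer (2 / q) (s - t) * f t ^ (q - 1)) q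
          (volume.restrict S) := by
        simpa only [eLpNorm', enorm_eq_self, Pi.mul_apply] using
          ENNReal.lintegral_mul_le_Lp_mul_Lq (volume.restrict S) hconj hg hGm
    _ ≤ eLpNorm' (fun s => f s ^ (q - 1)) (q / (q - 1)) (volume.restrict S) *
        (ENNReal.ofReal C *
          eLpNorm' (fun s => f s ^ (q - 1)) (q / (q - 1)) (volume.restrict S)) := by
        gcongr
        exact hC S _ hg
    _ = _ := by
        rw [eLpNorm'_rpow_sub_one (by linarith)]
        ring

/-- A selection `Ψ_N(t)` among `Φ_0(t), …, Φ_N(t)` that maximizes `|⟨Ψ_N(t), w⟩|`: it linearizes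
the supremum in the maximal `T T*` estimate. -/
def maxSelect (Φ : ℕ → ℝ → H) (w : H) : ℕ → ℝ → H
  | 0 => Φ 0
  | N + 1 => fun t =>
      if ‖inner ℂ (maxSelect Φ w N t) w‖ < ‖inner ℂ (Φ (N + 1) t) w‖ then Φ (N + 1) t
      else maxSelect Φ w N t

section MaxSelect

variable (Φ : ℕ → ℝ → H) (w : H)

theorem maxSelect_mem (N : ℕ) (t : ℝ) : ∃ n ≤ N, maxSelect Φ w N t = Φ n t := by
  induction N with
  | zero => exact ⟨0, le_rfl, rfl⟩
  | succ N ih =>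
    simp only [maxSelect]
    split_ifs
    · exact ⟨N + 1, le_rfl, rfl⟩
    · obtain ⟨n, hn, h⟩ := ih
      exact ⟨n, by lia, h⟩

theorem stronglyMeasurable_maxSelect (hΦ : ∀ n, StronglyMeasurable (Φ n)) (N : ℕ) :
    StronglyMeasurable (maxSelect Φ w N) := by
  induction N with
  | zero => exact hΦ 0
  | succ N ih =>
    refine StronglyMeasurable.ite ?_ (hΦ _) ih
    exact measurableSet_lt (ih.inner stronglyMeasurable_const).norm.measurable
      ((hΦ _).inner stronglyMeasurable_const).norm.measurable

theorem exists_norm_maxSelect_le {B : ℕ → ℝ} (hB : ∀ n t, ‖Φ n t‖ ≤ B n) (N : ℕ) :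
    ∃ b, ∀ t, ‖maxSelect Φ w N t‖ ≤ b := by
  refine ⟨∑ n ∈ Finset.range (N + 1), |B n|, fun t => ?_⟩
  obtain ⟨n, hn, h⟩ := maxSelect_mem Φ w N t
  rw [h]
  exact ((hB n t).trans (le_abs_self _)).trans (Finset.single_le_sum (f := fun n => |B n|)
    (fun _ _ => abs_nonneg _) (Finset.mem_range.2 (by lia)))

theorem monotone_enorm_inner_maxSelect (t : ℝ) :
    Monotone fun N => ‖inner ℂ (maxSelect Φ w N t) w‖ₑ := by
  refine monotone_nat_of_le_succ fun N => enorm_le_iff_norm_le.2 ?_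
  simp only [maxSelect]
  split_ifs with h
  · exact h.le
  · exact le_rfl

theorem enorm_inner_le_maxSelect (N : ℕ) (t : ℝ) :
    ‖inner ℂ (Φ N t) w‖ₑ ≤ ‖inner ℂ (maxSelect Φ w N t) w‖ₑ := by
  refine enorm_le_iff_norm_le.2 ?_
  cases N with
  | zero => exact le_rfl
  | succ N =>
    simp only [maxSelect]
    split_ifs with h
    · exact le_rfl
    · exact not_lt.1 h

end MaxSelect

variable [CompleteSpace H]

theorem enorm_setIntegral_extremizer_sq_le {q : ℝ} (hq : 2 < q) :
    ∃ C : ℝ, ∀ (κ : ℝ≥0∞) (B R : ℝ) (Ψ : ℝ → H) (w : H), κ ≠ ⊤ →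
      StronglyMeasurable Ψ → (∀ t, ‖Ψ t‖ ≤ B) →
      (∀ s t, s ≠ t → ‖inner ℂ (Ψ s) (Ψ t)‖ₑ ≤ κ * rieszKer (2 / q) (s - t)) →
      ‖∫ t in Set.Icc (-R) R, extremizer q Ψ w t‖ₑ ^ 2 ≤ κ * (ENNReal.ofReal C *
        (eLpNorm' (fun t => ‖inner ℂ (Ψ t) w‖ₑ) q (volume.restrict (Set.Icc (-R) R)) ^ (q - 1))
          ^ 2) := by
  obtain ⟨C, hC⟩ := lintegral_lintegral_rieszKer_le hq
  refine ⟨C, fun κ B R Ψ w hκ hΨ hB hin => ?_⟩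
  set S := Set.Icc (-R) R
  have hfin (t : ℝ) : ‖inner ℂ (Ψ t) w‖ₑ ^ (q - 1) ≠ ⊤ :=
    ENNReal.rpow_ne_top_of_nonneg (by linarith) enorm_ne_top
  calc _ ≤ ∫⁻ s in S, ∫⁻ t in S, ‖inner ℂ (extremizer q Ψ w s) (extremizer q Ψ w t)‖ₑ :=
        enorm_integral_sq_le (integrableOn_extremizer hq hΨ hB R)
    _ ≤ ∫⁻ s in S, ∫⁻ t in S, κ * (‖inner ℂ (Ψ s) w‖ₑ ^ (q - 1) *
          (rieszKer (2 / q) (s - t) * ‖inner ℂ (Ψ t) w‖ₑ ^ (q - 1))) := by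
        refine lintegral_mono fun s => lintegral_mono_ae (ae_restrict_of_ae ?_)
        filter_upwards [Measure.ae_ne volume s] with t hts
        rw [enorm_inner_extremizer_extremizer hq]
        calc _ ≤ ‖inner ℂ (Ψ s) w‖ₑ ^ (q - 1) * (κ * rieszKer (2 / q) (s - t)) *
              ‖inner ℂ (Ψ t) w‖ₑ ^ (q - 1) := by gcongr; exact hin s t hts.symm
          _ = _ := by ring
    _ = κ * ∫⁻ s in S, ‖inner ℂ (Ψ s) w‖ₑ ^ (q - 1) *
          ∫⁻ t in S, rieszKer (2 / q) (s - t) * ‖inner ℂ (Ψ t) w‖ₑ ^ (q - 1) := by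
        simp_rw [lintegral_const_mul' _ _ hκ, lintegral_const_mul' _ _ (hfin _)]
    _ ≤ _ := by
        gcongr
        exact hC S _ (hΨ.inner stronglyMeasurable_const).measurable.enorm.aemeasurable

theorem eLpNorm'_inner_rpow_le (hq : 2 < q) {B : ℝ} (hΨ : StronglyMeasurable Ψ)
    (hB : ∀ t, ‖Ψ t‖ ≤ B) (R : ℝ) :
    eLpNorm' (fun t => ‖inner ℂ (Ψ t) w‖ₑ) q (volume.restrict (Set.Icc (-R) R)) ^ q ≤
      ‖w‖ₑ * ‖∫ t in Set.Icc (-R) R, extremizer q Ψ w t‖ₑ := by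
  have hq0 : 0 < q := by linarith
  set S := Set.Icc (-R) R
  have hint : IntegrableOn (extremizer q Ψ w) S := integrableOn_extremizer hq hΨ hB R
  have hpow (t : ℝ) : ‖inner ℂ w (extremizer q Ψ w t)‖ = ‖inner ℂ (Ψ t) w‖ ^ q := by
    rw [inner_extremizer hq, Complex.norm_real, Real.norm_of_nonneg (by positivity)]
  calc _ = ∫⁻ t in S, ENNReal.ofReal (‖inner ℂ (Ψ t) w‖ ^ q) := by
        simp_rw [← ENNReal.ofReal_rpow_of_nonneg (norm_nonneg _) hq0.le, ofReal_norm, eLpNorm',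
          enorm_eq_self]
        rw [← ENNReal.rpow_mul, one_div_mul_cancel hq0.ne', ENNReal.rpow_one]
    _ = ‖inner ℂ w (∫ t in S, extremizer q Ψ w t)‖ₑ := by
        rw [← integral_inner hint w, ← ofReal_integral_eq_lintegral_ofReal
          (by simpa only [hpow] using (hint.const_inner (𝕜 := ℂ) w).norm)
          (Eventually.of_forall fun t => by positivity)]
        simp_rw [inner_extremizer hq]
        rw [integral_complex_ofReal, ← ofReal_norm, Complex.norm_real,
          Real.norm_of_nonneg (integral_nonneg fun t => by positivity)]
    _ ≤ ‖w‖ₑ * ‖∫ t in S, extremizer q Ψ w t‖ₑ := enorm_inner_le _ _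

theorem le_of_rpow_sq_le {x y : ℝ≥0∞} (hq : 1 < q) (hx : x ≠ ⊤)
    (h : (x ^ q) ^ 2 ≤ y ^ 2 * (x ^ (q - 1)) ^ 2) : x ≤ y := by
  rcases eq_or_ne x 0 with rfl | hx0
  · exact zero_le
  have hxq : x ^ q = x * x ^ (q - 1) := by
    nth_rw 2 [← ENNReal.rpow_one x]
    rw [← ENNReal.rpow_add _ _ hx0 hx]
    ring_nf
  have hpos : x ^ (q - 1) ≠ 0 := (ENNReal.rpow_pos hx0.bot_lt hx).ne'
  have htop : x ^ (q - 1) ≠ ⊤ := ENNReal.rpow_ne_top_of_nonneg (by linarith) hx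
  rw [hxq, ← mul_pow, ENNReal.pow_le_pow_left_iff two_ne_zero] at h
  exact (ENNReal.mul_le_mul_iff_left hpos htop).1 h

theorem exists_eLpNorm'_inner_le {q : ℝ} (hq : 2 < q) {κ : ℝ≥0∞} (hκ : κ ≠ ⊤) :
    ∃ D : ℝ≥0∞, D ≠ ⊤ ∧ ∀ (B : ℝ) (Ψ : ℝ → H), StronglyMeasurable Ψ → (∀ t, ‖Ψ t‖ ≤ B) →
      (∀ s t, s ≠ t → ‖inner ℂ (Ψ s) (Ψ t)‖ₑ ≤ κ * rieszKer (2 / q) (s - t)) →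
      ∀ w : H, eLpNorm' (fun t => ‖inner ℂ (Ψ t) w‖ₑ) q volume ≤ D * ‖w‖ₑ := by
  obtain ⟨C, hC⟩ := enorm_setIntegral_extremizer_sq_le (H := H) hq
  refine ⟨(κ * ENNReal.ofReal C) ^ (1 / 2 : ℝ), by finiteness, fun B Ψ hΨ hB hin w =>
    eLpNorm'_le_of_forall_restrict_closedBall (by linarith) 0 fun n => ?_⟩
  rw [Real.closedBall_eq_Icc, zero_sub, zero_add]
  set Z := eLpNorm' (fun t => ‖inner ℂ (Ψ t) w‖ₑ) q (volume.restrict (Set.Icc (-(n : ℝ)) n))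
  have hpair : Z ^ q ≤ ‖w‖ₑ * ‖∫ t in Set.Icc (-(n : ℝ)) n, extremizer q Ψ w t‖ₑ :=
    eLpNorm'_inner_rpow_le hq hΨ hB n
  have hZtop : Z ≠ ⊤ := by
    rintro hZ
    rw [hZ, ENNReal.top_rpow_of_pos (by linarith), top_le_iff] at hpair
    exact absurd hpair (by finiteness)
  refine le_of_rpow_sq_le (by linarith) hZtop ?_
  calc _ ≤ (‖w‖ₑ * ‖∫ t in Set.Icc (-(n : ℝ)) n, extremizer q Ψ w t‖ₑ) ^ 2 := by gcongr
    _ ≤ ‖w‖ₑ ^ 2 * (κ * (ENNReal.ofReal C * (Z ^ (q - 1)) ^ 2)) := by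
        rw [mul_pow]
        gcongr
        exact hC κ B n Ψ w hκ hΨ hB hin
    _ = _ := by
        rw [mul_pow, ← ENNReal.rpow_natCast (_ ^ (1 / 2 : ℝ)), ← ENNReal.rpow_mul]
        norm_num
        ring

theorem eLpNorm'_iSup_le {α : Type*} [MeasurableSpace α] {μ : Measure α} {f : ℕ → α → ℝ≥0∞}
    (hq : 0 < q) (hf : ∀ n, Measurable (f n)) (hmono : ∀ x, Monotone fun n => f n x)
    {D : ℝ≥0∞} (h : ∀ n, eLpNorm' (f n) q μ ≤ D) : eLpNorm' (fun x => ⨆ n, f n x) q μ ≤ D := by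
  simp only [eLpNorm', one_div, enorm_eq_self, ENNReal.rpow_inv_le_iff hq] at h ⊢
  have hsup (x : α) : (⨆ n, f n x) ^ q = ⨆ n, f n x ^ q :=
    (ENNReal.monotone_rpow_of_nonneg hq.le).map_iSup_of_continuousAt
      ENNReal.continuous_rpow_const.continuousAt (by simp [hq])
  simp_rw [hsup]
  rw [lintegral_iSup (fun n => (hf n).pow_const q)
    fun m n hmn x => ENNReal.rpow_le_rpow (hmono x hmn) hq.le]
  exact iSup_le h

/-- The maximal form of `exists_eLpNorm'_inner_le`; it handles an `L^r` norm in space, which is a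
supremum of countably many pairings. -/
theorem exists_eLpNorm'_iSup_inner_le {q : ℝ} (hq : 2 < q) {κ : ℝ≥0∞} (hκ : κ ≠ ⊤) :
    ∃ D : ℝ≥0∞, D ≠ ⊤ ∧ ∀ (B : ℕ → ℝ) (Φ : ℕ → ℝ → H), (∀ n, StronglyMeasurable (Φ n)) →
      (∀ n t, ‖Φ n t‖ ≤ B n) →
      (∀ n m s t, s ≠ t → ‖inner ℂ (Φ n s) (Φ m t)‖ₑ ≤ κ * rieszKer (2 / q) (s - t)) →
      ∀ w : H, eLpNorm' (fun t => ⨆ n, ‖inner ℂ (Φ n t) w‖ₑ) q volume ≤ D * ‖w‖ₑ := by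
  obtain ⟨D, hDtop, hD⟩ := exists_eLpNorm'_inner_le (H := H) hq hκ
  refine ⟨D, hDtop, fun B Φ hΦ hB hin w => ?_⟩
  have hq0 : 0 < q := by linarith
  have hΨm := stronglyMeasurable_maxSelect Φ w hΦ
  have hselect (N : ℕ) :
      eLpNorm' (fun t => ‖inner ℂ (maxSelect Φ w N t) w‖ₑ) q volume ≤ D * ‖w‖ₑ := by
    obtain ⟨b, hb⟩ := exists_norm_maxSelect_le Φ w hB N
    refine hD b _ (hΨm N) hb (fun s t hst => ?_) w
    obtain ⟨n, -, h⟩ := maxSelect_mem Φ w N s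
    obtain ⟨m, -, h'⟩ := maxSelect_mem Φ w N t
    rw [h, h']
    exact hin n m s t hst
  refine le_trans (eLpNorm'_mono_enorm_ae hq0.le (Eventually.of_forall fun t => ?_))
    (eLpNorm'_iSup_le hq0 (fun N => ((hΨm N).inner stronglyMeasurable_const).measurable.enorm)
      (monotone_enorm_inner_maxSelect Φ w) hselect)
  simp only [enorm_eq_self]
  exact iSup_mono fun N => enorm_inner_le_maxSelect Φ w N t

end DualityMethod

section Gronwall

theorem eLpNorm'_restrict_union_le {α ε : Type*} [MeasurableSpace α] [ENorm ε] {μ : Measure α}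
    {q : ℝ} (hq : 1 ≤ q) (f : α → ε) (s t : Set α) :
    eLpNorm' f q (μ.restrict (s ∪ t)) ≤
      eLpNorm' f q (μ.restrict s) + eLpNorm' f q (μ.restrict t) := by
  have hq0 : 0 < q := by linarith
  exact (ENNReal.rpow_le_rpow (lintegral_union_le _ _ _) (by positivity)).trans
    (ENNReal.rpow_add_le_add_rpow _ _ (by positivity) (by rwa [div_le_one hq0]))

theorem eLpNorm'_rpow_mul_le {α : Type*} [MeasurableSpace α] {μ : Measure α} {p q : ℝ}
    (hp : 0 < p) (hq : 0 < q) {f g : α → ℝ≥0∞} (hf : AEMeasurable f μ) (hg : AEMeasurable g μ) :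
    eLpNorm' (fun x => f x ^ p * g x) (q / (p + 1)) μ ≤ eLpNorm' f q μ ^ p * eLpNorm' g q μ := by
  have hlt : q / (p + 1) < q := div_lt_self hq (by linarith)
  have hexp : 1 / (q / (p + 1)) = 1 / (q / p) + 1 / q := by field_simp
  have h := ENNReal.lintegral_Lp_mul_le_Lq_mul_Lr (by positivity) hlt
    (hexp.trans (add_comm _ _)) μ hg (hf.pow_const p)
  simp only [Pi.mul_apply, ← ENNReal.rpow_mul, mul_div_cancel₀ q hp.ne'] at h
  simp only [eLpNorm', enorm_eq_self, ← ENNReal.rpow_mul]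
  rw [one_div_mul_eq_div, ← one_div_div q p, mul_comm (_ ^ _)]
  simpa only [mul_comm] using h

theorem eLpNorm'_rpow_eq {α ε : Type*} [MeasurableSpace α] [ENorm ε] {μ : Measure α} {q : ℝ}
    (hq : 0 < q) (f : α → ε) : eLpNorm' f q μ ^ q = ∫⁻ x, ‖f x‖ₑ ^ q ∂μ := by
  rw [eLpNorm', ← ENNReal.rpow_mul, one_div_mul_cancel hq.ne', ENNReal.rpow_one]

theorem eLpNorm'_sdiff_le {α : Type*} [MeasurableSpace α] {μ : Measure α} {q : ℝ} (hq : 0 < q)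
    {f : α → ℝ≥0∞} {s t : Set α} (hst : s ⊆ t) (hs : MeasurableSet s) {y η : ℝ≥0∞} (hy : y ≠ ⊤)
    (hfs : y ≤ ∫⁻ x in s, f x ^ q ∂μ) (hft : ∫⁻ x in t, f x ^ q ∂μ ≤ y + η ^ q) :
    eLpNorm' f q (μ.restrict (t \ s)) ≤ η := by
  simp only [eLpNorm', one_div, enorm_eq_self, ENNReal.rpow_inv_le_iff hq]
  refine (ENNReal.add_le_add_iff_left hy).1 (le_trans ?_ hft)
  rw [← lintegral_inter_add_sdiff _ t hs, Set.inter_eq_right.2 hst]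
  gcongr

/-- The constants in the discrete Gronwall argument: the range of times is exhausted in `N` steps,
each of which at most doubles the constant and adds the contribution of the past. -/
def gronwallConst (K : ℝ≥0∞) : ℕ → ℝ≥0∞
  | 0 => 1
  | N + 1 => 2 * (1 + K * gronwallConst K N)

theorem gronwallConst_ne_top {K : ℝ≥0∞} (hK : K ≠ ⊤) (N : ℕ) : gronwallConst K N ≠ ⊤ := by
  induction N with
  | zero => simp [gronwallConst]
  | succ N ih => simp only [gronwallConst]; finiteness

theorem monotone_gronwallConst (K : ℝ≥0∞) : Monotone (gronwallConst K) := by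
  refine monotone_nat_of_le_succ fun N => ?_
  induction N with
  | zero =>
    simp only [gronwallConst]
    calc (1 : ℝ≥0∞) ≤ 2 * 1 := by norm_num
      _ ≤ 2 * (1 + K * 1) := by gcongr; exact le_self_add
  | succ N ih =>
    rw [gronwallConst, gronwallConst.eq_2 K (N + 1)]
    gcongr

theorem le_two_mul_of_le_add_half {x y : ℝ≥0∞} (hx : x ≠ ⊤) (h : x ≤ y + 2⁻¹ * x) : x ≤ 2 * y := by
  have hhalf : 2⁻¹ * x ≤ y := by
    refine (ENNReal.add_le_add_iff_right (a := 2⁻¹ * x) (by finiteness)).1 (le_trans ?_ h)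
    rw [← add_mul, ENNReal.inv_two_add_inv_two, one_mul]
  calc x = 2 * (2⁻¹ * x) := by
        rw [← mul_assoc, ENNReal.mul_inv_cancel two_ne_zero ENNReal.ofNat_ne_top, one_mul]
    _ ≤ 2 * y := by gcongr

variable {μ : Measure ℝ} {t₀ : ℝ} {b m : ℝ → ℝ≥0∞} {p q T : ℝ} {c D Λ η : ℝ≥0∞}

theorem eLpNorm'_rpow_mul_eq_zero_of_lintegral_eq_zero (hp : 0 < p) (hq : 0 < q)
    (hb : AEMeasurable b μ) (hm : AEMeasurable m μ) (hmass : ∫⁻ t, b t ^ q ∂μ = 0) :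
    eLpNorm' (fun t => b t ^ p * m t) (q / (p + 1)) μ = 0 := by
  have hb0 : eLpNorm' b q μ = 0 := by
    rw [← ENNReal.rpow_eq_zero_iff_of_pos hq, eLpNorm'_rpow_eq hq]
    exact hmass
  have hprod := eLpNorm'_rpow_mul_le hp hq hb hm
  rwa [hb0, ENNReal.zero_rpow_of_pos hp, zero_mul, nonpos_iff_eq_zero] at hprod

/-- The increment on `closedBall t₀ τ \ closedBall t₀ τ'` is absorbed because the mass of `b` there
is small. -/
theorem eLpNorm'_closedBall_le_of_diff (hp : 0 < p) (hq : p + 1 ≤ q) (hb : AEMeasurable b μ)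
    (hm : AEMeasurable m μ) (hη : c * η ^ p ≤ 2⁻¹) {τ τ' : ℝ} {M : ℝ≥0∞} (hτ : τ' ≤ τ)
    (hfin : eLpNorm' m q (μ.restrict (Metric.closedBall t₀ τ)) ≠ ⊤)
    (hlin : eLpNorm' m q (μ.restrict (Metric.closedBall t₀ τ)) ≤ D +
      c * eLpNorm' (fun t => b t ^ p * m t) (q / (p + 1)) (μ.restrict (Metric.closedBall t₀ τ)))
    (hΛ : eLpNorm' b q (μ.restrict (Metric.closedBall t₀ τ')) ≤ Λ)
    (hM : eLpNorm' m q (μ.restrict (Metric.closedBall t₀ τ')) ≤ M)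
    (hdiff : eLpNorm' b q
      (μ.restrict (Metric.closedBall t₀ τ \ Metric.closedBall t₀ τ')) ≤ η) :
    eLpNorm' m q (μ.restrict (Metric.closedBall t₀ τ)) ≤ 2 * (D + c * Λ ^ p * M) := by
  have hq0 : 0 < q := by linarith
  set J := Metric.closedBall t₀ τ
  set J' := Metric.closedBall t₀ τ'
  have hsub : J' ⊆ J := Metric.closedBall_subset_closedBall hτ
  have hHolder (s : Set ℝ) : eLpNorm' (fun t => b t ^ p * m t) (q / (p + 1)) (μ.restrict s) ≤
      eLpNorm' b q (μ.restrict s) ^ p * eLpNorm' m q (μ.restrict s) :=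
    eLpNorm'_rpow_mul_le hp hq0 hb.restrict hm.restrict
  refine le_two_mul_of_le_add_half hfin (hlin.trans ?_)
  rw [add_assoc]
  gcongr
  calc _ = c * eLpNorm' (fun t => b t ^ p * m t) (q / (p + 1)) (μ.restrict (J' ∪ J \ J')) := by
        rw [Set.union_sdiff_cancel hsub]
    _ ≤ c * (Λ ^ p * M + η ^ p * eLpNorm' m q (μ.restrict J)) := by
        gcongr
        refine (eLpNorm'_restrict_union_le (by rwa [le_div_iff₀ (by linarith), one_mul])
          _ _ _).trans (add_le_add ((hHolder J').trans ?_) ((hHolder _).trans ?_))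
        · gcongr
        · gcongr
          exact Set.sdiff_subset
    _ = c * Λ ^ p * M + c * η ^ p * eLpNorm' m q (μ.restrict J) := by ring
    _ ≤ _ := by gcongr

variable [NullSingletonClass μ]

theorem continuousOn_setLIntegral_closedBall {f : ℝ → ℝ≥0∞} (hf : AEMeasurable f μ)
    (hfin : ∫⁻ t in Metric.closedBall t₀ T, f t ∂μ ≠ ⊤) :
    ContinuousOn (fun τ => ∫⁻ t in Metric.closedBall t₀ τ, f t ∂μ) (Set.Icc 0 T) := by
  set g : ℝ → ℝ := (Metric.closedBall t₀ T).indicator fun t => (f t).toReal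
  have hg : Integrable g μ :=
    (integrable_indicator_iff measurableSet_closedBall).2
      (integrable_toReal_of_lintegral_ne_top hf.restrict hfin)
  have hprim : Continuous fun τ => ∫ t in t₀..τ, g t ∂μ :=
    intervalIntegral.continuous_primitive (fun _ _ => hg.intervalIntegrable) t₀
  have hcont : Continuous fun τ => ENNReal.ofReal
      ((∫ t in t₀..(t₀ + τ), g t ∂μ) - ∫ t in t₀..(t₀ - τ), g t ∂μ) :=
    ENNReal.continuous_ofReal.comp (by fun_prop)
  refine hcont.continuousOn.congr fun τ hτ => ?_
  beta_reduce
  have hsub : Metric.closedBall t₀ τ ⊆ Metric.closedBall t₀ T :=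
    Metric.closedBall_subset_closedBall hτ.2
  have hlt : ∀ᵐ t ∂μ.restrict (Metric.closedBall t₀ τ), f t < ⊤ :=
    ae_restrict_of_ae_restrict_of_subset hsub (ae_lt_top' hf.restrict hfin)
  have hgτ : ∀ t ∈ Metric.closedBall t₀ τ, g t = (f t).toReal := fun t ht =>
    Set.indicator_of_mem (hsub ht) _
  rw [intervalIntegral.integral_interval_sub_left hg.intervalIntegrable hg.intervalIntegrable,
    intervalIntegral.integral_of_le (by linarith [hτ.1]), ← integral_Icc_eq_integral_Ioc,
    ← Real.closedBall_eq_Icc, setIntegral_congr_fun measurableSet_closedBall hgτ,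
    integral_toReal hf.restrict hlt]
  exact (ENNReal.ofReal_toReal (ne_top_of_le_ne_top hfin (lintegral_mono_set hsub))).symm

theorem eLpNorm'_le_gronwallConst_mul (hp : 0 < p) (hq : p + 1 ≤ q) (hb : AEMeasurable b μ)
    (hm : AEMeasurable m μ) (hη : c * η ^ p ≤ 2⁻¹) (hηtop : η ≠ ⊤)
    (hΛ : eLpNorm' b q (μ.restrict (Metric.closedBall t₀ T)) ≤ Λ) (hΛtop : Λ ≠ ⊤)
    (hfin : eLpNorm' m q (μ.restrict (Metric.closedBall t₀ T)) ≠ ⊤)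
    (hlin : ∀ τ ∈ Set.Icc 0 T, eLpNorm' m q (μ.restrict (Metric.closedBall t₀ τ)) ≤ D +
      c * eLpNorm' (fun t => b t ^ p * m t) (q / (p + 1)) (μ.restrict (Metric.closedBall t₀ τ)))
    (N : ℕ) : ∀ τ ∈ Set.Icc 0 T, ∫⁻ t in Metric.closedBall t₀ τ, b t ^ q ∂μ ≤ N * η ^ q →
      eLpNorm' m q (μ.restrict (Metric.closedBall t₀ τ)) ≤ gronwallConst (c * Λ ^ p) N * D := by
  have hq0 : 0 < q := by linarith
  have hmono {f : ℝ → ℝ≥0∞} {τ : ℝ} (hτ : τ ≤ T) :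
      eLpNorm' f q (μ.restrict (Metric.closedBall t₀ τ)) ≤
        eLpNorm' f q (μ.restrict (Metric.closedBall t₀ T)) :=
    eLpNorm'_mono_measure _
      (Measure.restrict_mono (Metric.closedBall_subset_closedBall hτ) le_rfl) hq0.le
  have hbfin : ∫⁻ t in Metric.closedBall t₀ T, b t ^ q ∂μ ≠ ⊤ := by
    have h := eLpNorm'_rpow_eq (μ := μ.restrict (Metric.closedBall t₀ T)) hq0 b
    simp only [enorm_eq_self] at h
    rw [← h]
    exact ENNReal.rpow_ne_top_of_nonneg hq0.le (ne_top_of_le_ne_top hΛtop hΛ)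
  induction N with
  | zero =>
    intro τ hτ hmass
    have hzero := eLpNorm'_rpow_mul_eq_zero_of_lintegral_eq_zero hp hq0
      (μ := μ.restrict (Metric.closedBall t₀ τ)) hb.restrict hm.restrict (by simpa using hmass)
    simpa [hzero, gronwallConst] using hlin τ hτ
  | succ N ih =>
    intro τ hτ hmass
    by_cases hle : ∫⁻ t in Metric.closedBall t₀ τ, b t ^ q ∂μ ≤ N * η ^ q
    · refine (ih τ hτ hle).trans ?_
      gcongr
      exact monotone_gronwallConst _ N.le_succ
    obtain ⟨τ', hτ', hmass'⟩ : ∃ τ' ∈ Set.Icc 0 τ,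
        ∫⁻ t in Metric.closedBall t₀ τ', b t ^ q ∂μ = N * η ^ q := by
      refine intermediate_value_Icc hτ.1 ((continuousOn_setLIntegral_closedBall (hb.pow_const q)
        hbfin).mono (Set.Icc_subset_Icc_right hτ.2)) ⟨?_, (not_le.1 hle).le⟩
      simp [Metric.closedBall_zero]
    have hdiff : eLpNorm' b q
        (μ.restrict (Metric.closedBall t₀ τ \ Metric.closedBall t₀ τ')) ≤ η := by
      refine eLpNorm'_sdiff_le hq0 (Metric.closedBall_subset_closedBall hτ'.2)
        measurableSet_closedBall (y := N * η ^ q) (by finiteness) hmass'.ge (hmass.trans_eq ?_)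
      push_cast
      ring
    refine (eLpNorm'_closedBall_le_of_diff hp hq hb hm hη hτ'.2
      (ne_top_of_le_ne_top hfin (hmono hτ.2)) (hlin τ hτ) ((hmono (hτ'.2.trans hτ.2)).trans hΛ)
      (ih τ' ⟨hτ'.1, hτ'.2.trans hτ.2⟩ hmass'.le) hdiff).trans_eq ?_
    rw [gronwallConst]
    ring

theorem exists_ne_zero_mul_rpow_le (hp : 0 < p) (hc : c ≠ ⊤) :
    ∃ η : ℝ≥0∞, η ≠ 0 ∧ η ≠ ⊤ ∧ c * η ^ p ≤ 2⁻¹ := by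
  have hne : (2 * (c + 1))⁻¹ ≠ 0 := ENNReal.inv_ne_zero.2 (by finiteness)
  have htop : (2 * (c + 1))⁻¹ ≠ ⊤ := ENNReal.inv_ne_top.2 (by simp)
  refine ⟨(2 * (c + 1))⁻¹ ^ (1 / p), (ENNReal.rpow_pos hne.bot_lt htop).ne', by finiteness, ?_⟩
  rw [← ENNReal.rpow_mul, one_div_mul_cancel hp.ne', ENNReal.rpow_one,
    ENNReal.mul_inv (by simp) (by simp), mul_left_comm]
  refine mul_le_of_le_one_right' (ENNReal.div_le_of_le_mul ?_)
  rw [one_mul]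
  exact le_self_add

theorem exists_eLpNorm'_le_mul_of_gronwall (hp : 0 < p) (hq : p + 1 ≤ q) (hc : c ≠ ⊤)
    (hΛ : Λ ≠ ⊤) : ∃ Γ : NNReal, ∀ (μ : Measure ℝ) [NullSingletonClass μ] (t₀ T : ℝ)
      (b m : ℝ → ℝ≥0∞) (D : ℝ≥0∞), 0 ≤ T → AEMeasurable b μ → AEMeasurable m μ →
      eLpNorm' b q (μ.restrict (Metric.closedBall t₀ T)) ≤ Λ →
      eLpNorm' m q (μ.restrict (Metric.closedBall t₀ T)) ≠ ⊤ →
      (∀ τ ∈ Set.Icc 0 T, eLpNorm' m q (μ.restrict (Metric.closedBall t₀ τ)) ≤ D + c *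
        eLpNorm' (fun t => b t ^ p * m t) (q / (p + 1)) (μ.restrict (Metric.closedBall t₀ τ))) →
      eLpNorm' m q (μ.restrict (Metric.closedBall t₀ T)) ≤ Γ * D := by
  have hq0 : 0 < q := by linarith
  obtain ⟨η, hη0, hηtop, hη⟩ := exists_ne_zero_mul_rpow_le hp hc
  obtain ⟨N, hN⟩ := ENNReal.exists_nat_mul_gt (a := η ^ q) (b := Λ ^ q)
    (ENNReal.rpow_pos hη0.bot_lt hηtop).ne' (by finiteness)
  have hΓ : gronwallConst (c * Λ ^ p) N ≠ ⊤ := gronwallConst_ne_top (by finiteness) N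
  refine ⟨(gronwallConst (c * Λ ^ p) N).toNNReal,
    fun μ _ t₀ T b m D hT hb hm hbΛ hfin hlin => ?_⟩
  rw [ENNReal.coe_toNNReal hΓ]
  refine eLpNorm'_le_gronwallConst_mul hp hq hb hm hη hηtop hbΛ hΛ hfin hlin N T ⟨hT, le_rfl⟩ ?_
  have hmass := eLpNorm'_rpow_eq (μ := μ.restrict (Metric.closedBall t₀ T)) hq0 b
  simp only [enorm_eq_self] at hmass
  rw [← hmass]
  exact (ENNReal.rpow_le_rpow hbΛ hq0.le).trans hN.le

/-- The continuity argument: the Gronwall bound applies as long as the norm of `m` is at most `1`,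
and then it improves this to `< 1`. -/
theorem exists_eLpNorm'_le_mul_of_gronwall_add (hp : 0 < p) (hq : p + 1 ≤ q) (hc : c ≠ ⊤)
    (hΛ : Λ ≠ ⊤) : ∃ Γ : NNReal, ∀ (μ : Measure ℝ) [NullSingletonClass μ] (t₀ : ℝ)
      (n m : ℝ → ℝ≥0∞) (D : ℝ≥0∞), AEMeasurable n μ → AEMeasurable m μ → eLpNorm' n q μ ≤ Λ →
      (∀ τ, eLpNorm' m q (μ.restrict (Metric.closedBall t₀ τ)) ≠ ⊤) →
      (∀ τ, eLpNorm' m q (μ.restrict (Metric.closedBall t₀ τ)) ≤ D + c *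
        eLpNorm' (fun t => (n t + m t) ^ p * m t) (q / (p + 1))
          (μ.restrict (Metric.closedBall t₀ τ))) →
      Γ * D < 1 → eLpNorm' m q μ ≤ Γ * D := by
  have hq0 : 0 < q := by linarith
  obtain ⟨Γ, hΓ⟩ := exists_eLpNorm'_le_mul_of_gronwall hp hq hc
    (ENNReal.add_ne_top.2 ⟨hΛ, ENNReal.one_ne_top⟩)
  refine ⟨Γ, fun μ _ t₀ n m D hn hm hnΛ hfin hlin hsmall => ?_⟩
  have himprove (T : ℝ) (hT : 0 ≤ T)
      (h1 : eLpNorm' m q (μ.restrict (Metric.closedBall t₀ T)) ≤ 1) :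
      eLpNorm' m q (μ.restrict (Metric.closedBall t₀ T)) ≤ Γ * D := by
    refine hΓ μ t₀ T _ m D hT (hn.add hm) hm ?_ (hfin T) fun τ _ => hlin τ
    exact (eLpNorm'_add_le hn.restrict.aestronglyMeasurable hm.restrict.aestronglyMeasurable
      (by linarith)).trans (add_le_add ((eLpNorm'_mono_measure n Measure.restrict_le_self
        hq0.le).trans hnΛ) h1)
  have hle_one (T : ℝ) (hT : 0 ≤ T) :
      eLpNorm' m q (μ.restrict (Metric.closedBall t₀ T)) ≤ 1 := by
    have hmass (τ : ℝ) := eLpNorm'_rpow_eq (μ := μ.restrict (Metric.closedBall t₀ τ)) hq0 m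
    simp only [enorm_eq_self] at hmass
    by_contra! hgt
    obtain ⟨τ, hτ, hτ1⟩ : ∃ τ ∈ Set.Icc 0 T, ∫⁻ t in Metric.closedBall t₀ τ, m t ^ q ∂μ = 1 := by
      refine intermediate_value_Icc hT (continuousOn_setLIntegral_closedBall (hm.pow_const q) ?_)
        ⟨by simp [Metric.closedBall_zero], ?_⟩
      · rw [← hmass]
        exact ENNReal.rpow_ne_top_of_nonneg hq0.le (hfin T)
      · rw [← hmass]
        exact ENNReal.one_le_rpow hgt.le hq0
    rw [← hmass] at hτ1
    have hτ1 : eLpNorm' m q (μ.restrict (Metric.closedBall t₀ τ)) = 1 :=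
      ENNReal.rpow_left_injective hq0.ne' (hτ1.trans (ENNReal.one_rpow q).symm)
    exact (himprove τ hτ.1 hτ1.le).not_gt (hτ1 ▸ hsmall)
  exact eLpNorm'_le_of_forall_restrict_closedBall hq0 t₀ fun k =>
    himprove k k.cast_nonneg (hle_one k k.cast_nonneg)

end Gronwall

section ScalarStability

variable {p q γ : ℝ}

theorem exists_eLpNorm'_le_of_le_add_rieszKer (hγ : 0 < γ) (hγ1 : γ < 1) {P : ℝ} (hP : 1 < P)
    (hq : 1 ≤ q) (hPq : 1 / q + 1 = 1 / P + γ) (κ : NNReal) :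
    ∃ K : NNReal, ∀ (S : Set ℝ) (m h f : ℝ → ℝ≥0∞), AEMeasurable h (volume.restrict S) →
      AEMeasurable f (volume.restrict S) →
      (∀ᵐ t ∂volume.restrict S, m t ≤ h t + κ * ∫⁻ s in S, rieszKer γ (t - s) * f s) →
      eLpNorm' m q (volume.restrict S) ≤
        eLpNorm' h q (volume.restrict S) + K * eLpNorm' f P (volume.restrict S) := by
  have hq0 : 0 < q := by linarith
  obtain ⟨C, -, hC⟩ := exists_eLpNorm'_lintegral_rieszKer_mul_le hγ hγ1 hP hq0 hPq
  refine ⟨κ * C.toNNReal, fun S m h f hh hf hm => ?_⟩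
  set I : ℝ → ℝ≥0∞ := fun t => ∫⁻ s in S, rieszKer γ (t - s) * f s
  have hI : AEMeasurable I (volume.restrict S) := by
    refine AEMeasurable.lintegral_prod_right' (f := fun z : ℝ × ℝ => rieszKer γ (z.1 - z.2) * f z.2)
      (AEMeasurable.mul ?_ hf.comp_snd)
    exact ((measurable_rieszKer γ).comp (measurable_fst.sub measurable_snd)).aemeasurable
  calc eLpNorm' m q (volume.restrict S)
      ≤ eLpNorm' (fun t => h t + κ * I t) q (volume.restrict S) :=
        eLpNorm'_mono_enorm_ae hq0.le hm
    _ ≤ eLpNorm' h q (volume.restrict S) + eLpNorm' (fun t => κ * I t) q (volume.restrict S) :=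
        eLpNorm'_add_le hh.aestronglyMeasurable (hI.const_mul _).aestronglyMeasurable hq
    _ ≤ eLpNorm' h q (volume.restrict S) + κ * eLpNorm' I q (volume.restrict S) := by
        gcongr
        exact eLpNorm'_le_nnreal_smul_eLpNorm'_of_ae_le_mul' (.of_forall fun t => le_rfl) hq0
    _ ≤ _ := by
        rw [ENNReal.coe_mul, mul_assoc]
        gcongr
        exact hC S f hf

theorem uIoc_subset_closedBall_inter {I : Set ℝ} {t₀ t τ : ℝ} (hI : I.OrdConnected) (ht₀ : t₀ ∈ I)
    (ht : t ∈ Metric.closedBall t₀ τ ∩ I) : Set.uIoc t₀ t ⊆ Metric.closedBall t₀ τ ∩ I := by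
  have hτ : 0 ≤ τ := dist_nonneg.trans ht.1
  have hJ : (Metric.closedBall t₀ τ ∩ I).OrdConnected := by
    rw [Real.closedBall_eq_Icc]
    exact Set.ordConnected_Icc.inter hI
  exact Set.uIoc_subset_uIcc.trans (hJ.uIcc_subset ⟨Metric.mem_closedBall_self hτ, ht₀⟩ ht)

theorem exists_eLpNorm'_closedBall_inter_le_of_duhamel (hγ : 0 < γ) (hγ1 : γ < 1) {P : ℝ}
    (hP : 1 < P) (hq : 1 ≤ q) (hPq : 1 / q + 1 = 1 / P + γ) (κ : NNReal) :
    ∃ K : NNReal, ∀ (I : Set ℝ) (t₀ : ℝ) (m h f : ℝ → ℝ≥0∞), I.OrdConnected → t₀ ∈ I →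
      AEMeasurable h (volume.restrict I) → AEMeasurable f (volume.restrict I) →
      (∀ᵐ t ∂volume.restrict I,
        m t ≤ h t + κ * ∫⁻ s in Set.uIoc t₀ t, rieszKer γ (t - s) * f s) →
      ∀ τ, eLpNorm' m q (volume.restrict (Metric.closedBall t₀ τ ∩ I)) ≤
        eLpNorm' h q (volume.restrict I) +
          K * eLpNorm' f P (volume.restrict (Metric.closedBall t₀ τ ∩ I)) := by
  obtain ⟨K, hK⟩ := exists_eLpNorm'_le_of_le_add_rieszKer hγ hγ1 hP hq hPq κ
  refine ⟨K, fun I t₀ m h f hI ht₀ hh hf hduhamel τ => ?_⟩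
  set J := Metric.closedBall t₀ τ ∩ I
  have hJI : J ⊆ I := Set.inter_subset_right
  have hJd : ∀ᵐ t ∂volume.restrict J,
      m t ≤ h t + κ * ∫⁻ s in J, rieszKer γ (t - s) * f s := by
    filter_upwards [ae_restrict_of_ae_restrict_of_subset hJI hduhamel, ae_restrict_mem
      (measurableSet_closedBall.inter hI.measurableSet)] with t ht htJ
    refine ht.trans ?_
    gcongr
    exact uIoc_subset_closedBall_inter hI ht₀ htJ
  refine (hK J m h f (hh.mono_set hJI) (hf.mono_set hJI) hJd).trans ?_
  gcongr

theorem eLpNorm'_rpow_add_mul_le (hp : 0 < p) (hq : 1 ≤ q) {A : NNReal} {μ : Measure ℝ}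
    {n m g : ℝ → ℝ≥0∞} {a ℓ x : ℝ≥0∞} (hn : AEMeasurable n μ) (hm : AEMeasurable m μ)
    (hg : ∀ᵐ t ∂μ, g t ≤ A * ((n t + m t) ^ p * m t)) (hℓ : eLpNorm' n q μ ≤ ℓ)
    (ha : eLpNorm' m q μ ≤ a) (hx : eLpNorm' m q μ ≤ x) :
    eLpNorm' g (q / (p + 1)) μ ≤ A * ((ℓ + a) ^ p * x) := by
  have hq0 : 0 < q := by linarith
  calc eLpNorm' g (q / (p + 1)) μ
      ≤ A * eLpNorm' (fun t => (n t + m t) ^ p * m t) (q / (p + 1)) μ :=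
        eLpNorm'_le_nnreal_smul_eLpNorm'_of_ae_le_mul' hg (by positivity)
    _ ≤ A * (eLpNorm' (fun t => n t + m t) q μ ^ p * eLpNorm' m q μ) := by
        gcongr
        exact eLpNorm'_rpow_mul_le hp hq0 (hn.add hm) hm
    _ ≤ A * ((ℓ + a) ^ p * x) := by
        gcongr
        exact (eLpNorm'_add_le hn.aestronglyMeasurable hm.aestronglyMeasurable hq).trans
          (add_le_add hℓ ha)

theorem mul_mul_lt_one_of_le_inv {Γ K : NNReal} {ε : ℝ≥0∞} (hε : ε ≤ (Γ * K + 1)⁻¹) :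
    Γ * (K * ε) < 1 := by
  calc Γ * (K * ε) ≤ Γ * (K * (Γ * K + 1)⁻¹ : NNReal) := by
        rw [ENNReal.coe_mul]
        gcongr
    _ = (Γ * K / (Γ * K + 1) : NNReal) := by rw [← ENNReal.coe_mul, ← mul_assoc, div_eq_mul_inv]
    _ < 1 := by
        rw [ENNReal.coe_lt_one_iff, div_lt_one (by positivity)]
        exact lt_add_one _

theorem exists_scalar_stability (hp : 0 < p) (hq : p + 1 < q) (hγ : 0 < γ) (hγ1 : γ < 1)
    (hpq : 1 / q + 1 = (p + 1) / q + γ) (κ A L B : NNReal) :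
    ∃ ε₁ > (0 : NNReal), ∃ C : NNReal, ∀ (I : Set ℝ) (t₀ : ℝ) (m n g e h : ℝ → ℝ≥0∞) (ε : ℝ≥0∞),
      I.OrdConnected → t₀ ∈ I → AEMeasurable m (volume.restrict I) →
      AEMeasurable n (volume.restrict I) → AEMeasurable g (volume.restrict I) →
      AEMeasurable e (volume.restrict I) → AEMeasurable h (volume.restrict I) →
      (∀ᵐ t ∂volume.restrict I,
        m t ≤ h t + κ * ∫⁻ s in Set.uIoc t₀ t, rieszKer γ (t - s) * (g s + e s)) →
      (∀ᵐ t ∂volume.restrict I, g t ≤ A * ((n t + m t) ^ p * m t)) →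
      (∀ τ, eLpNorm' m q (volume.restrict (Metric.closedBall t₀ τ ∩ I)) ≠ ⊤) →
      eLpNorm' n q (volume.restrict I) ≤ L → eLpNorm' h q (volume.restrict I) ≤ B * ε →
      eLpNorm' e (q / (p + 1)) (volume.restrict I) ≤ ε → ε ≤ ε₁ →
      eLpNorm' m q (volume.restrict I) + eLpNorm' g (q / (p + 1)) (volume.restrict I) ≤ C * ε := by
  have hα : 1 < q / (p + 1) := by rwa [lt_div_iff₀ (by linarith), one_mul]
  have hq1 : 1 ≤ q := by linarith
  obtain ⟨K, hK⟩ := exists_eLpNorm'_closedBall_inter_le_of_duhamel (q := q) hγ hγ1 hα hq1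
    (by rw [hpq, one_div_div]) κ
  obtain ⟨Γ, hΓ⟩ := exists_eLpNorm'_le_mul_of_gronwall_add hp hq.le (c := K * A) (Λ := L)
    (by finiteness) (by finiteness)
  refine ⟨(Γ * (B + K) + 1)⁻¹, by positivity, Γ * (B + K) * (1 + A * (L + 1) ^ p), ?_⟩
  intro I t₀ m n g e h ε hI ht₀ hm hn hg he hh hduhamel hgle hfin hL hB hε hε₁
  have hwindow (τ : ℝ) : eLpNorm' m q (volume.restrict (Metric.closedBall t₀ τ ∩ I)) ≤
      (B + K) * ε + K * A * eLpNorm' (fun t => (n t + m t) ^ p * m t) (q / (p + 1))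
        (volume.restrict (Metric.closedBall t₀ τ ∩ I)) := by
    set J := Metric.closedBall t₀ τ ∩ I
    have hJI : J ⊆ I := Set.inter_subset_right
    calc _ ≤ eLpNorm' h q (volume.restrict I) +
          K * eLpNorm' (fun s => g s + e s) (q / (p + 1)) (volume.restrict J) :=
        hK I t₀ m h _ hI ht₀ hh (hg.add he) hduhamel τ
      _ ≤ B * ε + K * (A * eLpNorm' (fun t => (n t + m t) ^ p * m t) (q / (p + 1))
          (volume.restrict J) + ε) := by
        gcongr
        refine (eLpNorm'_add_le (hg.mono_set hJI).aestronglyMeasurable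
          (he.mono_set hJI).aestronglyMeasurable hα.le).trans (add_le_add ?_ ?_)
        · exact eLpNorm'_le_nnreal_smul_eLpNorm'_of_ae_le_mul'
            (ae_restrict_of_ae_restrict_of_subset hJI hgle) (by positivity)
        · exact (eLpNorm'_mono_measure e (Measure.restrict_mono hJI le_rfl)
            (by positivity)).trans hε
      _ = _ := by ring
  have hsmall : Γ * ((B + K) * ε) < 1 := by
    exact_mod_cast mul_mul_lt_one_of_le_inv hε₁
  have hmI : eLpNorm' m q (volume.restrict I) ≤ Γ * ((B + K) * ε) := by
    refine hΓ (volume.restrict I) t₀ n m _ hn hm hL (fun τ => ?_) (fun τ => ?_) hsmall <;>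
      rw [Measure.restrict_restrict measurableSet_closedBall]
    exacts [hfin τ, hwindow τ]
  calc _ ≤ Γ * ((B + K) * ε) + A * ((L + 1) ^ p * (Γ * ((B + K) * ε))) :=
      add_le_add hmI (eLpNorm'_rpow_add_mul_le hp hq1 hn hm hgle hL (hmI.trans hsmall.le) hmI)
    _ = _ := by
      push_cast [ENNReal.coe_rpow_of_nonneg _ hp.le]
      ring

end ScalarStability

/-! ### Duality with test functions -/

section TestFunctions

theorem tendsto_eLpNorm'_of_dominated {α F : Type*} [MeasurableSpace α] {μ : Measure α}
    [NormedAddCommGroup F] {f : α → F} {g : ℕ → α → F} {s : ℝ} (hs : 0 < s) (bound : α → ℝ≥0∞)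
    (hg : ∀ n, AEStronglyMeasurable (g n) μ) (hle : ∀ n, ∀ᵐ x ∂μ, ‖g n x‖ₑ ≤ bound x)
    (hbound : ∫⁻ x, bound x ^ s ∂μ ≠ ⊤) (hlim : ∀ᵐ x ∂μ, Tendsto (fun n => g n x) atTop (𝓝 (f x))) :
    Tendsto (fun n => eLpNorm' (g n) s μ) atTop (𝓝 (eLpNorm' f s μ)) := by
  refine (ENNReal.continuous_rpow_const.tendsto _).comp
    (tendsto_lintegral_of_dominated_convergence' _ (fun n => (hg n).enorm.pow_const s)
      (fun n => (hle n).mono fun x hx => ENNReal.rpow_le_rpow hx hs.le) hbound ?_)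
  filter_upwards [hlim] with x hx
  exact (ENNReal.continuous_rpow_const.tendsto _).comp ((continuous_enorm.tendsto _).comp hx)

theorem exists_seq_contDiffBump_rOut_tendsto_zero (E : Type*) [NormedAddCommGroup E]
    [NormedSpace ℝ E] : ∃ φ : ℕ → ContDiffBump (0 : E), Tendsto (fun n => (φ n).rOut) atTop (𝓝 0) ∧
      ∀ n, (φ n).rOut ≤ 1 ∧ (φ n).rOut ≤ 2 * (φ n).rIn := by
  refine ⟨fun n => ⟨1 / ((n : ℝ) + 1) / 2, 1 / ((n : ℝ) + 1), by positivity,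
    half_lt_self (by positivity)⟩, tendsto_one_div_add_atTop_nhds_zero_nat, fun n => ⟨?_, ?_⟩⟩
  · rw [div_le_one (by positivity)]
    linarith [n.cast_nonneg (α := ℝ)]
  · exact (mul_div_cancel₀ _ two_ne_zero).ge

variable {E : Type*} [NormedAddCommGroup E] [NormedSpace ℝ E] [FiniteDimensional ℝ E]
  [MeasurableSpace E] {μ : Measure E}

theorem integrable_of_norm_le_of_eq_zero_compl_closedBall {F : Type*} [NormedAddCommGroup F]
    [IsFiniteMeasureOnCompacts μ] {f : E → F} (hf : AEStronglyMeasurable f μ) {b R : ℝ}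
    (hb : ∀ x, ‖f x‖ ≤ b) (hR : ∀ x, x ∉ Metric.closedBall (0 : E) R → f x = 0) :
    Integrable f μ := by
  refine (integrableOn_iff_integrable_of_support_subset
    (Function.support_subset_iff'.2 hR)).1 ?_
  exact IntegrableOn.of_bound measure_closedBall_lt_top hf.restrict b (.of_forall hb)

variable [BorelSpace E]

theorem tendsto_integral_mul_of_norm_le {w f : E → ℂ} {g : ℕ → E → ℂ} (hw : LocallyIntegrable w μ)
    {b R : ℝ} (hg : ∀ n, AEStronglyMeasurable (g n) μ) (hb : ∀ n x, ‖g n x‖ ≤ b)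
    (hR : ∀ n x, x ∉ Metric.closedBall (0 : E) R → g n x = 0)
    (hlim : ∀ᵐ x ∂μ, Tendsto (fun n => g n x) atTop (𝓝 (f x))) :
    Tendsto (fun n => ∫ x, w x * g n x ∂μ) atTop (𝓝 (∫ x, w x * f x ∂μ)) := by
  refine tendsto_integral_of_dominated_convergence
    ((Metric.closedBall (0 : E) R).indicator fun x => ‖w x‖ * b)
    (fun n => hw.aestronglyMeasurable.mul (hg n)) ?_ (fun n => .of_forall fun x => ?_) ?_
  · exact (integrable_indicator_iff measurableSet_closedBall).2
      ((hw.integrableOn_isCompact (isCompact_closedBall _ _)).norm.mul_const _)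
  · by_cases hx : x ∈ Metric.closedBall (0 : E) R
    · rw [Set.indicator_of_mem hx, norm_mul]
      exact mul_le_mul_of_nonneg_left (hb n x) (norm_nonneg _)
    · rw [Set.indicator_of_notMem hx, hR n x hx, mul_zero, norm_zero]
  · filter_upwards [hlim] with x hx using hx.const_mul _

variable [μ.IsAddHaarMeasure]

theorem exists_contDiff_seq_tendsto_ae {F : Type*} [NormedAddCommGroup F] [NormedSpace ℝ F]
    [CompleteSpace F] {f : E → F} (hf : AEStronglyMeasurable f μ) {b R : ℝ} (hb : ∀ x, ‖f x‖ ≤ b)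
    (hR : ∀ x, x ∉ Metric.closedBall (0 : E) R → f x = 0) :
    ∃ g : ℕ → E → F, (∀ n, ContDiff ℝ ∞ (g n)) ∧ (∀ n, HasCompactSupport (g n)) ∧
      (∀ n x, ‖g n x‖ ≤ b) ∧ (∀ n x, x ∉ Metric.closedBall (0 : E) (R + 1) → g n x = 0) ∧
      ∀ᵐ x ∂μ, Tendsto (fun n => g n x) atTop (𝓝 (f x)) := by
  have hint := integrable_of_norm_le_of_eq_zero_compl_closedBall hf hb hR
  obtain ⟨φ, hφ0, hφ⟩ := exists_seq_contDiffBump_rOut_tendsto_zero E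
  refine ⟨fun n => convolution ((φ n).normed μ) f (ContinuousLinearMap.lsmul ℝ ℝ) μ,
    fun n => ?_, fun n => ?_, fun n x => ?_, fun n x hx => ?_, ?_⟩
  · exact (φ n).hasCompactSupport_normed.contDiff_convolution_left _ (φ n).contDiff_normed
      hint.locallyIntegrable
  · exact (φ n).hasCompactSupport_normed.convolution _
      (HasCompactSupport.intro (isCompact_closedBall _ R) hR)
  · beta_reduce
    rw [convolution_def]
    calc _ ≤ ∫ t, (φ n).normed μ t * b ∂μ := by
          refine norm_integral_le_of_norm_le ((φ n).integrable_normed.mul_const b)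
            (.of_forall fun t => ?_)
          rw [ContinuousLinearMap.lsmul_apply, norm_smul,
            Real.norm_of_nonneg ((φ n).nonneg_normed t)]
          exact mul_le_mul_of_nonneg_left (hb _) ((φ n).nonneg_normed t)
      _ = b := by rw [integral_mul_const, (φ n).integral_normed, one_mul]
  · by_contra hne
    obtain ⟨y, hy, z, hz, rfl⟩ := Set.mem_add.1
      (support_convolution_subset _ (Function.mem_support.2 hne))
    rw [(φ n).support_normed_eq, mem_ball_zero_iff] at hy
    have hzR := mem_closedBall_zero_iff.1 (Function.support_subset_iff'.2 hR hz)
    exact hx (mem_closedBall_zero_iff.2 (by linarith [norm_add_le y z, (hφ n).1]))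
  · exact ContDiffBump.ae_convolution_tendsto_right_of_locallyIntegrable hφ0
      (.of_forall fun n => (hφ n).2) hint.locallyIntegrable

theorem enorm_integral_mul_le_of_forall_contDiff {s : ℝ} (hs : 0 < s) {w : E → ℂ}
    (hw : LocallyIntegrable w μ) {M : ℝ≥0∞} (hM : M ≠ ⊤)
    (H : ∀ g : E → ℂ, ContDiff ℝ ∞ g → HasCompactSupport g →
      ‖∫ x, w x * g x ∂μ‖ₑ ≤ M * eLpNorm' g s μ) {f : E → ℂ} (hf : AEStronglyMeasurable f μ)
    {b R : ℝ} (hb : ∀ x, ‖f x‖ ≤ b) (hR : ∀ x, x ∉ Metric.closedBall (0 : E) R → f x = 0) :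
    ‖∫ x, w x * f x ∂μ‖ₑ ≤ M * eLpNorm' f s μ := by
  obtain ⟨g, hgc, hgs, hgb, hgR, hgt⟩ := exists_contDiff_seq_tendsto_ae hf hb hR
  have hgm (n : ℕ) : AEStronglyMeasurable (g n) μ := (hgc n).continuous.aestronglyMeasurable
  have hlim : Tendsto (fun n => eLpNorm' (g n) s μ) atTop (𝓝 (eLpNorm' f s μ)) := by
    refine tendsto_eLpNorm'_of_dominated hs
      ((Metric.closedBall (0 : E) (R + 1)).indicator fun _ => ENNReal.ofReal b) hgm
      (fun n => .of_forall fun x => ?_) ?_ hgt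
    · by_cases hx : x ∈ Metric.closedBall (0 : E) (R + 1)
      · rw [Set.indicator_of_mem hx]
        exact (ofReal_norm (g n x)).ge.trans (ENNReal.ofReal_le_ofReal (hgb n x))
      · simp [hgR n x hx]
    · have : ∀ x, (Metric.closedBall (0 : E) (R + 1)).indicator (fun _ => ENNReal.ofReal b) x ^ s =
          (Metric.closedBall (0 : E) (R + 1)).indicator (fun _ => ENNReal.ofReal b ^ s) x := by
        intro x
        by_cases hx : x ∈ Metric.closedBall (0 : E) (R + 1) <;> simp [hx, hs]
      rw [lintegral_congr this, lintegral_indicator measurableSet_closedBall, setLIntegral_const]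
      have := measure_closedBall_lt_top (μ := μ) (x := (0 : E)) (r := R + 1)
      finiteness
  exact le_of_tendsto_of_tendsto'
    ((continuous_enorm.tendsto _).comp (tendsto_integral_mul_of_norm_le hw hgm hgb hgR hgt))
    (ENNReal.Tendsto.const_mul hlim (Or.inr hM)) fun n => H (g n) (hgc n) (hgs n)

theorem rpow_one_div_le_of_le_mul_rpow {r r' : ℝ} (hr : r.HolderConjugate r') {X M : ℝ≥0∞}
    (hX : X ≠ ⊤) (h : X ≤ M * X ^ (1 / r')) : X ^ (1 / r) ≤ M := by
  rcases eq_or_ne X 0 with rfl | h0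
  · simp [hr.pos]
  have hXX : X ^ (1 / r) * X ^ (1 / r') = X := by
    rw [← ENNReal.rpow_add _ _ h0 hX, one_div, one_div, hr.inv_add_inv_eq_one, ENNReal.rpow_one]
  have hx0 : X ^ (1 / r') ≠ 0 := by simp [ENNReal.rpow_eq_zero_iff, h0, hr.symm.nonneg]
  have hx1 : X ^ (1 / r') ≠ ⊤ :=
    ENNReal.rpow_ne_top_of_nonneg (one_div_nonneg.2 hr.symm.nonneg) hX
  exact (ENNReal.mul_le_mul_iff_left hx0 hx1).1 (hXX.le.trans h)

/-- The function `|z|^{r-2} z̄` which is extremal in the duality between `L^r` and `L^{r'}`. -/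
def conjRpow (r : ℝ) (z : ℂ) : ℂ := ((‖z‖ ^ (r - 2) : ℝ) : ℂ) * (starRingEnd ℂ) z

theorem measurable_conjRpow (r : ℝ) : Measurable (conjRpow r) :=
  (Complex.measurable_ofReal.comp (measurable_norm.pow_const _)).mul
    Complex.continuous_conj.measurable

theorem norm_conjRpow {r : ℝ} (hr : 1 < r) (z : ℂ) : ‖conjRpow r z‖ = ‖z‖ ^ (r - 1) := by
  rw [conjRpow, norm_mul, RCLike.norm_conj, Complex.norm_real, Real.norm_of_nonneg (by positivity)]
  rcases eq_or_ne z 0 with rfl | hz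
  · simp [(sub_pos.2 hr).ne']
  · rw [← Real.rpow_add_one (norm_ne_zero_iff.2 hz)]
    ring_nf

theorem mul_conjRpow {r : ℝ} (hr : 0 < r) (z : ℂ) : z * conjRpow r z = ((‖z‖ ^ r : ℝ) : ℂ) := by
  rw [conjRpow, mul_left_comm, Complex.mul_conj, Complex.normSq_eq_norm_sq, ← Complex.ofReal_mul]
  rcases eq_or_ne z 0 with rfl | hz
  · simp [hr.ne']
  · rw [← Real.rpow_add_natCast (norm_ne_zero_iff.2 hz)]
    push_cast
    ring_nf

theorem enorm_conjRpow_rpow {r r' : ℝ} (hr : r.HolderConjugate r') (z : ℂ) :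
    ‖conjRpow r z‖ₑ ^ r' = ‖z‖ₑ ^ r := by
  rw [← ofReal_norm, norm_conjRpow hr.lt,
    ← ENNReal.ofReal_rpow_of_nonneg (norm_nonneg _) hr.sub_one_pos.le, ← ENNReal.rpow_mul,
    hr.sub_one_mul_conj, ofReal_norm]

theorem enorm_setIntegral_mul_conjRpow {α : Type*} [MeasurableSpace α] {μ : Measure α} {r : ℝ}
    (hr : 0 < r) {w : α → ℂ} {s : Set α} (hw : AEStronglyMeasurable w μ)
    (hfin : ∫⁻ x in s, ‖w x‖ₑ ^ r ∂μ ≠ ⊤) :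
    ‖∫ x in s, w x * conjRpow r (w x) ∂μ‖ₑ = ∫⁻ x in s, ‖w x‖ₑ ^ r ∂μ := by
  have henorm (x : α) : ‖w x‖ₑ ^ r = ENNReal.ofReal (‖w x‖ ^ r) := by
    rw [← ENNReal.ofReal_rpow_of_nonneg (norm_nonneg _) hr.le, ofReal_norm]
  simp only [mul_conjRpow hr, henorm] at hfin ⊢
  rw [integral_complex_ofReal, ← ofReal_norm, Complex.norm_real,
    Real.norm_of_nonneg (integral_nonneg fun x => by positivity),
    integral_eq_lintegral_of_nonneg_ae (.of_forall fun x => by positivity)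
      (hw.norm.aemeasurable.pow_const r).aestronglyMeasurable.restrict, ENNReal.ofReal_toReal hfin]

theorem eLpNorm'_restrict_le_of_forall_contDiff {r r' : ℝ} (hr : r.HolderConjugate r') {w : E → ℂ}
    (hwm : Measurable w) (hw : LocallyIntegrable w μ) {M : ℝ≥0∞} (hM : M ≠ ⊤)
    (H : ∀ g : E → ℂ, ContDiff ℝ ∞ g → HasCompactSupport g →
      ‖∫ x, w x * g x ∂μ‖ₑ ≤ M * eLpNorm' g r' μ) (b R : ℝ) :
    eLpNorm' w r (μ.restrict {x | ‖x‖ ≤ R ∧ ‖w x‖ ≤ b}) ≤ M := by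
  set s : Set E := {x | ‖x‖ ≤ R ∧ ‖w x‖ ≤ b}
  have hs : MeasurableSet s :=
    (measurableSet_le measurable_norm measurable_const).inter
      (measurableSet_le hwm.norm measurable_const)
  have hfin : ∫⁻ x in s, ‖w x‖ₑ ^ r ∂μ ≠ ⊤ := by
    have hsfin : μ s < ⊤ := (measure_mono fun x hx => mem_closedBall_zero_iff.2 hx.1).trans_lt
      (measure_closedBall_lt_top (x := (0 : E)) (r := R))
    refine ne_top_of_le_ne_top (ENNReal.mul_ne_top (a := ENNReal.ofReal b ^ r) ?_ hsfin.ne)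
      ((setLIntegral_mono' hs fun x hx => ?_).trans_eq (setLIntegral_const s _))
    · exact ENNReal.rpow_ne_top_of_nonneg hr.nonneg ENNReal.ofReal_ne_top
    · exact ENNReal.rpow_le_rpow ((ofReal_norm (w x)).ge.trans (ENNReal.ofReal_le_ofReal hx.2))
        hr.nonneg
  have hmul (x : E) : w x * s.indicator (conjRpow r ∘ w) x =
      s.indicator (fun x => w x * conjRpow r (w x)) x := by
    by_cases hx : x ∈ s <;> simp [hx]
  have hnorm : ∫⁻ x, ‖s.indicator (conjRpow r ∘ w) x‖ₑ ^ r' ∂μ = ∫⁻ x in s, ‖w x‖ₑ ^ r ∂μ := by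
    rw [← lintegral_indicator hs]
    refine lintegral_congr fun x => ?_
    by_cases hx : x ∈ s
    · simp only [Set.indicator_of_mem hx, Function.comp_apply, enorm_conjRpow_rpow hr]
    · simp only [Set.indicator_of_notMem hx, enorm_zero, ENNReal.zero_rpow_of_pos hr.symm.pos]
  have hbound : ∫⁻ x in s, ‖w x‖ₑ ^ r ∂μ ≤ M * (∫⁻ x in s, ‖w x‖ₑ ^ r ∂μ) ^ (1 / r') := by
    have h := enorm_integral_mul_le_of_forall_contDiff hr.symm.pos hw hM H (b := |b| ^ (r - 1))
      (R := R) (((measurable_conjRpow r).comp hwm).indicator hs).aestronglyMeasurable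
      (fun x => ?_) (fun x hx => Set.indicator_of_notMem (fun h => hx ?_) _)
    · rwa [eLpNorm', hnorm, integral_congr_ae (.of_forall hmul), integral_indicator hs,
        enorm_setIntegral_mul_conjRpow hr.pos hw.aestronglyMeasurable hfin] at h
    · by_cases hx : x ∈ s
      · rw [Set.indicator_of_mem hx, Function.comp_apply, norm_conjRpow hr.lt]
        exact Real.rpow_le_rpow (norm_nonneg _) (hx.2.trans (le_abs_self b)) hr.sub_one_pos.le
      · rw [Set.indicator_of_notMem hx, norm_zero]
        positivity
    · exact mem_closedBall_zero_iff.2 h.1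
  exact rpow_one_div_le_of_le_mul_rpow hr hfin hbound

theorem eLpNorm'_le_of_forall_contDiff {r r' : ℝ} (hr : r.HolderConjugate r') {w : E → ℂ}
    (hw : LocallyIntegrable w μ) {M : ℝ≥0∞}
    (H : ∀ g : E → ℂ, ContDiff ℝ ∞ g → HasCompactSupport g →
      ‖∫ x, w x * g x ∂μ‖ₑ ≤ M * eLpNorm' g r' μ) : eLpNorm' w r μ ≤ M := by
  rcases eq_or_ne M ⊤ with rfl | hM
  · exact le_top
  set v := hw.aestronglyMeasurable.mk w
  have hwv : w =ᵐ[μ] v := hw.aestronglyMeasurable.ae_eq_mk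
  have hvm : Measurable v := hw.aestronglyMeasurable.stronglyMeasurable_mk.measurable
  have hHv (g : E → ℂ) (hg : ContDiff ℝ ∞ g) (hgs : HasCompactSupport g) :
      ‖∫ x, v x * g x ∂μ‖ₑ ≤ M * eLpNorm' g r' μ :=
    integral_congr_ae (hwv.mul (EventuallyEq.refl _ g)) ▸ H g hg hgs
  have htrunc (N : ℕ) := eLpNorm'_restrict_le_of_forall_contDiff hr hvm (hw.congr hwv) hM hHv N N
  have hunion : (⋃ N : ℕ, {x : E | ‖x‖ ≤ N ∧ ‖v x‖ ≤ N}) = Set.univ := by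
    refine Set.eq_univ_of_forall fun x => Set.mem_iUnion.2 ?_
    obtain ⟨N, hN⟩ := exists_nat_ge (max ‖x‖ ‖v x‖)
    exact ⟨N, (le_max_left _ _).trans hN, (le_max_right _ _).trans hN⟩
  have hmono : Monotone fun N : ℕ => {x : E | ‖x‖ ≤ N ∧ ‖v x‖ ≤ N} := fun N N' h x hx =>
    have hNN' : (N : ℝ) ≤ N' := Nat.cast_le.2 h
    ⟨hx.1.trans hNN', hx.2.trans hNN'⟩
  rw [eLpNorm'_congr_ae hwv, eLpNorm', ← setLIntegral_univ, ← hunion,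
    setLIntegral_iUnion_of_directed _ hmono.directed_le, one_div, ENNReal.rpow_inv_le_iff hr.pos]
  refine iSup_le fun N => (ENNReal.rpow_inv_le_iff hr.pos).1 ?_
  simpa only [eLpNorm', one_div] using htrunc N

end TestFunctions

/-! ### Real interpolation between `L¹ → L^∞` and `L² → L²` -/

section Interpolation

theorem rpow_mul_lintegral_enorm_le_of_truncation {α F : Type*} [MeasurableSpace α]
    {μ : Measure α} [NormedAddCommGroup F] {f f₁ : α → F} {s θ : ℝ} (hs : 0 < s) (hθ : 1 ≤ θ)
    (hf₁ : ∀ x, ‖f₁ x‖ ≤ ‖f x‖ ∧ (‖f x‖ ≤ s → f₁ x = 0)) :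
    ENNReal.ofReal (s ^ (θ - 1)) * ∫⁻ x, ‖f₁ x‖ₑ ∂μ ≤ ∫⁻ x, ‖f x‖ₑ ^ θ ∂μ := by
  rw [← lintegral_const_mul' _ _ ENNReal.ofReal_ne_top]
  refine lintegral_mono fun x => ?_
  rcases le_or_gt ‖f x‖ s with hx | hx
  · rw [(hf₁ x).2 hx, enorm_zero, mul_zero]
    exact zero_le
  · have hfx : 0 < ‖f x‖ := hs.trans hx
    rw [← ofReal_norm, ← ofReal_norm, ENNReal.ofReal_rpow_of_pos hfx,
      ← ENNReal.ofReal_mul (by positivity)]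
    refine ENNReal.ofReal_le_ofReal ?_
    calc _ ≤ ‖f x‖ ^ (θ - 1) * ‖f x‖ :=
          mul_le_mul (Real.rpow_le_rpow hs.le hx.le (sub_nonneg.2 hθ)) (hf₁ x).1 (norm_nonneg _)
            (by positivity)
      _ = ‖f x‖ ^ θ := by rw [← Real.rpow_add_one hfx.ne', sub_add_cancel]

theorem lintegral_rpow_le_of_measure_lt_le {α β : Type*} [MeasurableSpace α] [MeasurableSpace β]
    {μ : Measure α} {ν : Measure β} [SFinite μ] [SFinite ν] {g : β → ℝ≥0∞} {w h : α → ℝ≥0∞}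
    (hg : Measurable g) (hw : Measurable w) (hh : Measurable h) {r : ℝ} (hr : 2 < r)
    (hdist : ∀ a : ℝ, 0 < a → ν {x | ENNReal.ofReal a < g x} ≤
      ENNReal.ofReal (a ^ (-2 : ℝ)) * ∫⁻ y in {y | ENNReal.ofReal a < h y}, w y ∂μ) :
    ∫⁻ x, g x ^ r ∂ν ≤
      ENNReal.ofReal r / ENNReal.ofReal (r - 2) * ∫⁻ y, w y * h y ^ (r - 2) ∂μ := by
  have hr2 : ENNReal.ofReal (r - 2) ≠ 0 := by simpa using hr
  rw [lintegral_rpow_eq_lintegral_measure_lt hg (by linarith)]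
  calc _ ≤ ENNReal.ofReal r * ∫⁻ a in Set.Ioi 0, ENNReal.ofReal (a ^ (r - 2 - 1)) *
        ∫⁻ y in {y | ENNReal.ofReal a < h y}, w y ∂μ := by
        refine mul_le_mul_right (setLIntegral_mono' measurableSet_Ioi fun a ha => ?_) _
        refine (mul_le_mul_right (hdist a ha) _).trans_eq ?_
        rw [← mul_assoc, ← ENNReal.ofReal_mul (Real.rpow_nonneg (Set.mem_Ioi.1 ha).le _),
          ← Real.rpow_add ha]
        ring_nf
    _ = ENNReal.ofReal r * ∫⁻ y, w y * h y ^ (r - 2) / ENNReal.ofReal (r - 2) ∂μ := by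
        simp only [mul_div_assoc, ← setLIntegral_ofReal_lt_rpow (sub_pos.2 hr)]
        rw [lintegral_mul_setLIntegral_lt hh hw ENNReal.measurable_ofReal (by fun_prop)]
    _ = _ := by
        simp only [div_eq_mul_inv]
        rw [lintegral_mul_const' _ _ (ENNReal.inv_ne_top.2 hr2), mul_right_comm, mul_assoc]

theorem sub_one_mul_sub_one {r θ : ℝ} (hr : r.HolderConjugate θ) : (r - 1) * (θ - 1) = 1 := by
  linear_combination hr.mul_eq_add

theorem sub_one_mul_sub_two {r θ : ℝ} (hr : r.HolderConjugate θ) :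
    (θ - 1) * (r - 2) = 2 - θ := by
  linear_combination hr.mul_eq_add

theorem rpow_two_mul_mul_two_div_rpow_rpow {r θ : ℝ} (hr2 : 2 < r)
    (hr : r.HolderConjugate θ) (m : ℝ≥0∞) {x : ℝ≥0∞} (hx : x ≠ ⊤) :
    x ^ (2 : ℝ) * (m * (2 / x) ^ (θ - 1)) ^ (r - 2) = 2 ^ (2 - θ) * m ^ (r - 2) * x ^ θ := by
  have hθ2 : 0 < 2 - θ :=
    sub_one_mul_sub_two hr ▸ mul_pos hr.symm.sub_one_pos (sub_pos.2 hr2)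
  rw [ENNReal.mul_rpow_of_nonneg _ _ (sub_pos.2 hr2).le, ← ENNReal.rpow_mul,
    sub_one_mul_sub_two hr, mul_left_comm, mul_comm (2 ^ (2 - θ)), mul_assoc]
  congr 1
  rcases eq_or_ne x 0 with rfl | h0
  · rw [ENNReal.zero_rpow_of_pos two_pos, ENNReal.zero_rpow_of_pos hr.symm.pos, zero_mul, mul_zero]
  · rw [ENNReal.div_rpow_of_nonneg _ _ hθ2.le, ENNReal.div_eq_inv_mul, ← mul_assoc,
      ← ENNReal.rpow_neg, ← ENNReal.rpow_add _ _ h0 hx, mul_comm]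
    congr 2
    ring

theorem setOf_norm_lt_subset {α F : Type*} [NormedAddCommGroup F] {r θ : ℝ}
    (hr : r.HolderConjugate θ) {m a : ℝ} (hm : 0 < m) (ha : 0 < a) (f : α → F) :
    {y | ‖f y‖ < 2 * (m / a) ^ (r - 1)} ⊆
      {y | ENNReal.ofReal a < ENNReal.ofReal m * (2 / ‖f y‖ₑ) ^ (θ - 1)} := fun y hy => by
  rw [Set.mem_ofPred_eq] at hy ⊢
  rcases (norm_nonneg (f y)).eq_or_lt' with h0 | h0
  · rw [norm_eq_zero.1 h0, enorm_zero, ENNReal.div_zero two_ne_zero,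
      ENNReal.top_rpow_of_pos hr.symm.sub_one_pos, ENNReal.mul_top (by simpa using hm)]
    exact ENNReal.ofReal_lt_top
  · have hlt : (‖f y‖ / 2) ^ (θ - 1) < m / a := by
      rw [← div_lt_iff₀' two_pos] at hy
      have := Real.rpow_lt_rpow (by positivity) hy hr.symm.sub_one_pos
      rwa [← Real.rpow_mul (by positivity), sub_one_mul_sub_one hr, Real.rpow_one] at this
    rw [← ofReal_norm, ← ENNReal.ofReal_ofNat, ← ENNReal.ofReal_div_of_pos h0,
      ENNReal.ofReal_rpow_of_pos (by positivity), ← ENNReal.ofReal_mul hm.le,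
      ENNReal.ofReal_lt_ofReal_iff (by positivity), ← inv_div, Real.inv_rpow (by positivity),
      ← div_eq_mul_inv, lt_div_iff₀' (by positivity)]
    exact (lt_div_iff₀ ha).1 hlt

variable {E F β : Type*} [NormedAddCommGroup E] [NormedSpace ℝ E] [ProperSpace E]
  [NormedAddCommGroup F] [InnerProductSpace ℝ F]

theorem isCompact_setOf_le_norm (f : 𝓢(E, F)) {s : ℝ} (hs : 0 < s) :
    IsCompact {x | s ≤ ‖f x‖} := by
  have hclosed : IsClosed {x | s ≤ ‖f x‖} := isClosed_le continuous_const f.continuous.norm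
  obtain ⟨K, hK, hKs⟩ := mem_cocompact.1
    (f.tendsto_cocompact.norm.eventually (gt_mem_nhds (norm_zero.trans_lt hs)))
  refine hK.of_isClosed_subset hclosed fun x hx => ?_
  by_contra hxK
  exact not_lt_of_ge (Set.mem_ofPred_eq.mp hx) (hKs hxK)

theorem exists_schwartzMap_truncation (f : 𝓢(E, F)) {s : ℝ} (hs : 0 < s) :
    ∃ f₁ f₂ : 𝓢(E, F), f = f₁ + f₂ ∧ (∀ x, ‖f₁ x‖ ≤ ‖f x‖ ∧ (‖f x‖ ≤ s → f₁ x = 0)) ∧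
      ∀ x, ‖f₂ x‖ ≤ ‖f x‖ ∧ (2 * s ≤ ‖f x‖ → f₂ x = 0) := by
  let χ (x : E) : ℝ := Real.smoothTransition ((‖f x‖ ^ 2 / s ^ 2 - 1) / 3)
  have hχ : ContDiff ℝ ∞ χ := Real.smoothTransition.contDiff.comp
    (((((f.smooth ⊤).norm_sq ℝ).div_const _).sub contDiff_const).div_const _)
  have hχ0 (x : E) (hx : ‖f x‖ ≤ s) : χ x = 0 := by
    refine Real.smoothTransition.zero_of_nonpos (div_nonpos_of_nonpos_of_nonneg ?_ (by norm_num))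
    rw [sub_nonpos, div_le_one (by positivity)]
    gcongr
  have hχ1 (x : E) (hx : 2 * s ≤ ‖f x‖) : χ x = 1 := by
    refine Real.smoothTransition.one_of_one_le ?_
    rw [le_div_iff₀ (by norm_num), le_sub_iff_add_le, le_div_iff₀ (by positivity)]
    calc _ = (2 * s) ^ 2 := by ring
      _ ≤ ‖f x‖ ^ 2 := by gcongr
  have hnonneg (x : E) : 0 ≤ χ x := Real.smoothTransition.nonneg _
  have hle (x : E) : χ x ≤ 1 := Real.smoothTransition.le_one _
  have hsupp : HasCompactSupport fun x => χ x • f x :=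
    HasCompactSupport.intro (isCompact_setOf_le_norm f hs) fun x hx => by
      rw [hχ0 x (not_le.1 hx).le, zero_smul]
  have hmul (x : E) (c : ℝ) (h0 : 0 ≤ c) (h1 : c ≤ 1) : ‖c • f x‖ ≤ ‖f x‖ := by
    rw [norm_smul, Real.norm_of_nonneg h0]
    exact mul_le_of_le_one_left (norm_nonneg _) h1
  let f₁ : 𝓢(E, F) := hsupp.toSchwartzMap (hχ.smul (f.smooth ⊤))
  have hf₁ (x : E) : f₁ x = χ x • f x := rfl
  have hf₂ (x : E) : (f - f₁) x = (1 - χ x) • f x := by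
    rw [sub_apply, hf₁, sub_smul, one_smul]
  refine ⟨f₁, f - f₁, (add_sub_cancel _ _).symm, fun x => ⟨?_, fun hx => ?_⟩,
    fun x => ⟨?_, fun hx => ?_⟩⟩
  · exact hmul x _ (hnonneg x) (hle x)
  · rw [hf₁, hχ0 x hx, zero_smul]
  · exact hf₂ x ▸ hmul x _ (sub_nonneg.2 (hle x)) (sub_le_self _ (hnonneg x))
  · rw [hf₂, hχ1 x hx, sub_self, zero_smul]

variable [MeasurableSpace E] [OpensMeasurableSpace E] {μ : Measure E}
  [MeasurableSpace β] {ν : Measure β} {T : 𝓢(E, F) → β → ℝ≥0∞} {M : ℝ}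

theorem measure_lt_half_le_of_truncation (hadd : ∀ f g x, T (f + g) x ≤ T f x + T g x)
    (hmeas : ∀ f, Measurable (T f))
    (h1 : ∀ f x, T f x ≤ ENNReal.ofReal M * ∫⁻ y, ‖f y‖ₑ ∂μ)
    (h2 : ∀ f, ∫⁻ x, T f x ^ (2 : ℝ) ∂ν ≤ ∫⁻ y, ‖f y‖ₑ ^ (2 : ℝ) ∂μ)
    {θ : ℝ} (hθ : 1 ≤ θ) (f : 𝓢(E, F)) {a s : ℝ} (ha : 0 < a) (hs : 0 < s)
    (hsa : ENNReal.ofReal M * ∫⁻ y, ‖f y‖ₑ ^ θ ∂μ ≤ ENNReal.ofReal (a * s ^ (θ - 1))) :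
    ν {x | ENNReal.ofReal a < T f x / 2} ≤ ENNReal.ofReal (a ^ (-2 : ℝ)) *
      ∫⁻ y in {y | ‖f y‖ < 2 * s}, ‖f y‖ₑ ^ (2 : ℝ) ∂μ := by
  obtain ⟨f₁, f₂, hf, hf₁, hf₂⟩ := exists_schwartzMap_truncation f hs
  have hT₁ (x : β) : T f₁ x ≤ ENNReal.ofReal a := by
    have hpos : ENNReal.ofReal (s ^ (θ - 1)) ≠ 0 := by simpa using Real.rpow_pos_of_pos hs _
    refine (h1 f₁ x).trans
      ((ENNReal.mul_le_mul_iff_right hpos ENNReal.ofReal_ne_top).1 ?_)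
    rw [← ENNReal.ofReal_mul (by positivity), mul_left_comm, mul_comm _ a]
    refine le_trans ?_ hsa
    gcongr
    exact rpow_mul_lintegral_enorm_le_of_truncation hs hθ hf₁
  have hT₂ : ∫⁻ x, T f₂ x ^ (2 : ℝ) ∂ν ≤ ∫⁻ y in {y | ‖f y‖ < 2 * s}, ‖f y‖ₑ ^ (2 : ℝ) ∂μ := by
    refine (h2 f₂).trans ?_
    rw [← lintegral_indicator (measurableSet_lt f.continuous.norm.measurable measurable_const)]
    refine lintegral_mono fun y => ?_
    rcases lt_or_ge ‖f y‖ (2 * s) with hy | hy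
    · rw [Set.indicator_of_mem (s := {y | ‖f y‖ < 2 * s}) hy]
      exact ENNReal.rpow_le_rpow (enorm_le_iff_norm_le.2 (hf₂ y).1) zero_le_two
    · rw [(hf₂ y).2 hy, enorm_zero, ENNReal.zero_rpow_of_pos two_pos]
      exact zero_le
  have hsub : {x | ENNReal.ofReal a < T f x / 2} ⊆
      {x | ENNReal.ofReal (a ^ (2 : ℝ)) ≤ T f₂ x ^ (2 : ℝ)} := fun x hx => by
    rw [Set.mem_ofPred_eq] at hx ⊢
    rw [← ENNReal.ofReal_rpow_of_pos ha, ENNReal.rpow_le_rpow_iff two_pos]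
    by_contra! hlt
    refine hx.not_ge (ENNReal.div_le_of_le_mul ?_)
    calc T f x ≤ T f₁ x + T f₂ x := hf ▸ hadd f₁ f₂ x
      _ ≤ ENNReal.ofReal a * 2 := by
          rw [mul_two]
          exact add_le_add (hT₁ x) hlt.le
  refine (measure_mono hsub).trans ((meas_ge_le_lintegral_div
    ((hmeas f₂).pow_const _).aemeasurable (ENNReal.ofReal_pos.2 (Real.rpow_pos_of_pos ha _)).ne'
    ENNReal.ofReal_ne_top).trans ?_)
  rw [ENNReal.div_eq_inv_mul, ← ENNReal.ofReal_inv_of_pos (Real.rpow_pos_of_pos ha _),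
    ← Real.rpow_neg ha.le]
  gcongr

variable [SFinite μ] [SFinite ν]

theorem lintegral_half_rpow_le_of_sublinear (hadd : ∀ f g x, T (f + g) x ≤ T f x + T g x)
    (hmeas : ∀ f, Measurable (T f))
    (h1 : ∀ f x, T f x ≤ ENNReal.ofReal M * ∫⁻ y, ‖f y‖ₑ ∂μ)
    (h2 : ∀ f, ∫⁻ x, T f x ^ (2 : ℝ) ∂ν ≤ ∫⁻ y, ‖f y‖ₑ ^ (2 : ℝ) ∂μ)
    {r θ : ℝ} (hr2 : 2 < r) (hr : r.HolderConjugate θ) (f : 𝓢(E, F)) {m : ℝ} (hm : 0 < m)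
    (hm' : ENNReal.ofReal M * ∫⁻ y, ‖f y‖ₑ ^ θ ∂μ ≤ ENNReal.ofReal m) :
    ∫⁻ x, (T f x / 2) ^ r ∂ν ≤ ENNReal.ofReal r / ENNReal.ofReal (r - 2) * 2 ^ (2 - θ) *
      ENNReal.ofReal m ^ (r - 2) * ∫⁻ y, ‖f y‖ₑ ^ θ ∂μ := by
  let h (y : E) : ℝ≥0∞ := ENNReal.ofReal m * (2 / ‖f y‖ₑ) ^ (θ - 1)
  have hdist (a : ℝ) (ha : 0 < a) : ν {x | ENNReal.ofReal a < T f x / 2} ≤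
      ENNReal.ofReal (a ^ (-2 : ℝ)) *
        ∫⁻ y in {y | ENNReal.ofReal a < h y}, ‖f y‖ₑ ^ (2 : ℝ) ∂μ := by
    refine (measure_lt_half_le_of_truncation hadd hmeas h1 h2 hr.symm.lt.le f ha
      (Real.rpow_pos_of_pos (div_pos hm ha) (r - 1)) ?_).trans ?_
    · rwa [← Real.rpow_mul (by positivity), sub_one_mul_sub_one hr, Real.rpow_one,
        mul_div_cancel₀ _ ha.ne']
    · gcongr
      exact fun hy => setOf_norm_lt_subset hr hm ha f hy
  have hhm : Measurable h := by
    have := f.continuous.enorm.measurable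
    fun_prop
  refine (lintegral_rpow_le_of_measure_lt_le ((hmeas f).div_const 2)
    (f.continuous.enorm.measurable.pow_const _) hhm hr2 hdist).trans_eq ?_
  simp only [h, rpow_two_mul_mul_two_div_rpow_rpow hr2 hr _ enorm_ne_top]
  rw [lintegral_const_mul _ (f.continuous.enorm.measurable.pow_const _), ← mul_assoc, ← mul_assoc]

theorem lintegral_rpow_le_of_sublinear (hadd : ∀ f g x, T (f + g) x ≤ T f x + T g x)
    (hmeas : ∀ f, Measurable (T f)) (hM : 0 < M)
    (h1 : ∀ f x, T f x ≤ ENNReal.ofReal M * ∫⁻ y, ‖f y‖ₑ ∂μ)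
    (h2 : ∀ f, ∫⁻ x, T f x ^ (2 : ℝ) ∂ν ≤ ∫⁻ y, ‖f y‖ₑ ^ (2 : ℝ) ∂μ)
    {r θ : ℝ} (hr2 : 2 < r) (hr : r.HolderConjugate θ) (f : 𝓢(E, F)) :
    ∫⁻ x, (T f x / 2) ^ r ∂ν ≤ ENNReal.ofReal r / ENNReal.ofReal (r - 2) * 2 ^ (2 - θ) *
      ENNReal.ofReal M ^ (r - 2) * (∫⁻ y, ‖f y‖ₑ ^ θ ∂μ) ^ (r - 1) := by
  set P := ∫⁻ y, ‖f y‖ₑ ^ θ ∂μ with hP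
  rcases eq_or_ne P 0 with h0 | h0
  · refine (lintegral_half_rpow_le_of_sublinear hadd hmeas h1 h2 hr2 hr f one_pos ?_).trans ?_
    · rw [← hP, h0, mul_zero]
      exact zero_le
    · rw [← hP, h0, mul_zero]
      exact zero_le
  rcases eq_or_ne P ⊤ with htop | htop
  · have hne : ENNReal.ofReal r / ENNReal.ofReal (r - 2) * 2 ^ (2 - θ) *
        ENNReal.ofReal M ^ (r - 2) ≠ 0 :=
      mul_ne_zero (mul_ne_zero (ENNReal.div_pos (ENNReal.ofReal_pos.2 hr.pos).ne'
        ENNReal.ofReal_ne_top).ne' (ENNReal.rpow_pos two_pos ENNReal.ofNat_ne_top).ne')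
        (ENNReal.rpow_pos (ENNReal.ofReal_pos.2 hM) ENNReal.ofReal_ne_top).ne'
    rw [htop, ENNReal.top_rpow_of_pos hr.sub_one_pos, ENNReal.mul_top hne]
    exact le_top
  · have hm : ENNReal.ofReal (M * P.toReal) = ENNReal.ofReal M * P := by
      rw [ENNReal.ofReal_mul hM.le, ENNReal.ofReal_toReal htop]
    refine (lintegral_half_rpow_le_of_sublinear hadd hmeas h1 h2 hr2 hr f
      (mul_pos hM (ENNReal.toReal_pos h0 htop)) hm.ge).trans_eq ?_
    have hpow : P ^ (r - 2) * P ^ (1 : ℝ) = P ^ (r - 1) := by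
      rw [← ENNReal.rpow_add _ _ h0 htop]
      ring_nf
    rw [ENNReal.rpow_one] at hpow
    rw [hm, ENNReal.mul_rpow_of_nonneg _ _ (sub_pos.2 hr2).le, ← mul_assoc, mul_assoc _ _ P, hpow]

theorem exists_eLpNorm'_le_of_sublinear {r θ : ℝ} (hr2 : 2 < r) (hr : r.HolderConjugate θ) :
    ∃ C : ℝ≥0∞, C ≠ ⊤ ∧ ∀ (T : 𝓢(E, F) → β → ℝ≥0∞) (M : ℝ), 0 < M →
      (∀ f g x, T (f + g) x ≤ T f x + T g x) → (∀ f, Measurable (T f)) →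
      (∀ f x, T f x ≤ ENNReal.ofReal M * ∫⁻ y, ‖f y‖ₑ ∂μ) →
      (∀ f, ∫⁻ x, T f x ^ (2 : ℝ) ∂ν ≤ ∫⁻ y, ‖f y‖ₑ ^ (2 : ℝ) ∂μ) →
      ∀ f, eLpNorm' (T f) r ν ≤ C * ENNReal.ofReal M ^ (1 - 2 / r) * eLpNorm' f θ μ := by
  have hr0 : 0 ≤ 1 / r := one_div_nonneg.2 hr.nonneg
  have hr2' : ENNReal.ofReal (r - 2) ≠ 0 := by simpa using hr2
  refine ⟨2 * (ENNReal.ofReal r / ENNReal.ofReal (r - 2) * 2 ^ (2 - θ)) ^ (1 / r), by finiteness,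
    fun T M hM hadd hmeas h1 h2 f => ?_⟩
  have hhalf : eLpNorm' (T f) r ν ≤ 2 * (∫⁻ x, (T f x / 2) ^ r ∂ν) ^ (1 / r) := by
    have hmul : ∫⁻ x, T f x ^ r ∂ν = 2 ^ r * ∫⁻ x, (T f x / 2) ^ r ∂ν := by
      rw [← lintegral_const_mul _ (((hmeas f).div_const 2).pow_const r)]
      refine lintegral_congr fun x => ?_
      rw [← ENNReal.mul_rpow_of_nonneg _ _ hr.nonneg,
        ENNReal.mul_div_cancel two_ne_zero ENNReal.ofNat_ne_top]
    rw [eLpNorm'_eq_lintegral_enorm]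
    simp only [enorm_eq_self]
    rw [hmul, ENNReal.mul_rpow_of_nonneg _ _ hr0, ← ENNReal.rpow_mul, mul_one_div_cancel hr.ne_zero,
      ENNReal.rpow_one]
  refine hhalf.trans ?_
  rw [mul_assoc, mul_assoc, ← mul_assoc (_ ^ (1 / r))]
  gcongr
  refine (ENNReal.rpow_le_rpow (lintegral_rpow_le_of_sublinear hadd hmeas hM h1 h2 hr2 hr f)
    hr0).trans_eq ?_
  rw [ENNReal.mul_rpow_of_nonneg _ _ hr0, ENNReal.mul_rpow_of_nonneg _ _ hr0, eLpNorm',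
    ← ENNReal.rpow_mul, ← ENNReal.rpow_mul]
  congr 2
  · rw [sub_mul, mul_one_div_cancel hr.ne_zero, mul_one_div]
  · rw [mul_one_div, ← hr.div_conj_eq_sub_one, div_right_comm, div_self hr.ne_zero]

end Interpolation

/-! ### The dispersive estimate -/

section Duality

variable {V : Type*} [NormedAddCommGroup V] [InnerProductSpace ℝ V] [MeasurableSpace V]
  [BorelSpace V] [FiniteDimensional ℝ V]

theorem enorm_integral_mul_le {α : Type*} [MeasurableSpace α] {μ : Measure α} {r r' : ℝ}
    (hr : r.HolderConjugate r') {f g : α → ℂ} (hf : AEStronglyMeasurable f μ)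
    (hg : AEStronglyMeasurable g μ) :
    ‖∫ x, f x * g x ∂μ‖ₑ ≤ eLpNorm' f r μ * eLpNorm' g r' μ :=
  calc ‖∫ x, f x * g x ∂μ‖ₑ ≤ ∫⁻ x, ‖f x‖ₑ * ‖g x‖ₑ ∂μ := by
        simpa only [enorm_mul] using enorm_integral_le_lintegral_enorm fun x => f x * g x
    _ ≤ _ := ENNReal.lintegral_mul_le_Lp_mul_Lq μ hr hf.enorm hg.enorm

theorem fourierInv_eq_vectorFourier (w : V → ℂ) :
    𝓕⁻ w = VectorFourier.fourierIntegral Real.fourierChar volume (-innerₗ V) w := by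
  funext x
  simp [Real.fourierInv_eq, VectorFourier.fourierIntegral]

theorem continuous_fourierInv_of_integrable {w : V → ℂ} (hw : Integrable w) :
    Continuous (𝓕⁻ w) := by
  rw [fourierInv_eq_vectorFourier]
  exact VectorFourier.fourierIntegral_continuous Real.continuous_fourierChar
    continuous_inner.neg hw

theorem integral_fourierInv_mul_eq {v w : V → ℂ} (hv : Integrable v) (hw : Integrable w) :
    ∫ x, 𝓕⁻ v x * w x = ∫ ξ, v ξ * 𝓕⁻ w ξ := by
  have hflip : (-innerₗ V).flip = -innerₗ V := by
    ext x y
    simp [real_inner_comm]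
  simpa only [fourierInv_eq_vectorFourier, smul_eq_mul, hflip] using
    VectorFourier.integral_fourierIntegral_smul_eq_flip (L := -innerₗ V)
      Real.continuous_fourierChar continuous_inner.neg hv hw

theorem eLpNorm'_schwartz_ne_top {s : ℝ} (hs : 0 < s) (f : 𝓢(V, ℂ)) :
    eLpNorm' f s volume ≠ ⊤ := by
  have hf := (f.memLp (ENNReal.ofReal s) volume).eLpNorm_ne_top
  rwa [eLpNorm_eq_eLpNorm' (by simpa using hs) ENNReal.ofReal_ne_top,
    ENNReal.toReal_ofReal hs.le] at hf

theorem eLpNorm'_two_fourier (f : 𝓢(V, ℂ)) :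
    eLpNorm' (𝓕 f : 𝓢(V, ℂ)) 2 volume = eLpNorm' f 2 volume := by
  have h : ∀ g : 𝓢(V, ℂ), eLpNorm' g 2 volume = ‖g.toLp 2 volume‖ₑ := fun g => by
    rw [SchwartzMap.toLp, Lp.enorm_toLp, eLpNorm_eq_eLpNorm' two_ne_zero ENNReal.ofNat_ne_top,
      ENNReal.toReal_ofNat]
  rw [h, h, ← ofReal_norm, ← ofReal_norm, SchwartzMap.norm_fourier_toL2_eq]

theorem eLpNorm'_two_fourierInv (f : 𝓢(V, ℂ)) :
    eLpNorm' (𝓕⁻ f : 𝓢(V, ℂ)) 2 volume = eLpNorm' f 2 volume := by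
  rw [← eLpNorm'_two_fourier, FourierTransform.fourier_fourierInv_eq]

end Duality

/-- The symbol `ξ ↦ exp(-z (2π|ξ|)²)` of the complex heat semigroup `e^{zΔ}`, which contains the
Schrödinger group `e^{itΔ}` as its boundary values at `z = it`. -/
def gaussSymbol (z : ℂ) (ξ : Plane) : ℂ := Complex.exp (-z * ((2 * Real.pi * ‖ξ‖ : ℝ) : ℂ) ^ 2)

theorem freeSymbol_eq_gaussSymbol (t : ℝ) (ξ : Plane) :
    freeSymbol t ξ = gaussSymbol (t * Complex.I) ξ := by
  rw [freeSymbol, gaussSymbol]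
  congr 1
  push_cast
  ring

theorem gaussSymbol_eq_exp_neg_mul_sq (z : ℂ) (ξ : Plane) :
    gaussSymbol z ξ = Complex.exp (-(4 * Real.pi ^ 2 * z) * ‖ξ‖ ^ 2) := by
  rw [gaussSymbol]
  congr 1
  push_cast
  ring

theorem continuous_gaussSymbol : Continuous fun x : ℂ × Plane => gaussSymbol x.1 x.2 := by
  unfold gaussSymbol
  fun_prop

theorem continuous_gaussSymbol_apply (z : ℂ) : Continuous (gaussSymbol z) :=
  continuous_gaussSymbol.comp (by fun_prop : Continuous fun ξ : Plane => (z, ξ))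

theorem norm_gaussSymbol_le_one {z : ℂ} (hz : 0 ≤ z.re) (ξ : Plane) : ‖gaussSymbol z ξ‖ ≤ 1 := by
  rw [gaussSymbol, Complex.norm_exp, ← Complex.ofReal_pow, Complex.re_mul_ofReal, Complex.neg_re,
    Real.exp_le_one_iff, neg_mul, neg_nonpos]
  positivity

theorem re_four_mul_pi_sq_mul_pos {z : ℂ} (hz : 0 < z.re) :
    0 < (4 * Real.pi ^ 2 * z : ℂ).re := by
  have h : (4 * Real.pi ^ 2 * z : ℂ) = ((4 * Real.pi ^ 2 : ℝ) : ℂ) * z := by push_cast; rfl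
  rw [h, Complex.re_ofReal_mul]
  positivity

/-- The bilinear form `(f, g) ↦ ∫ (e^{zΔ} f) g dx`, written on the Fourier side, where it makes
sense for all `z` with `0 ≤ Re z`. -/
def gaussForm (z : ℂ) (f g : 𝓢(Plane, ℂ)) : ℂ := ∫ ξ, gaussSymbol z ξ * (𝓕 f ξ * 𝓕⁻ g ξ)

/-- The function `e^{zΔ} f`, for `0 < Re z`. -/
def gaussFlow (z : ℂ) (f : 𝓢(Plane, ℂ)) : Plane → ℂ := 𝓕⁻ fun ξ => gaussSymbol z ξ * 𝓕 f ξ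

theorem integrable_gaussSymbol_mul {z : ℂ} (hz : 0 ≤ z.re) {v : Plane → ℂ} (hv : Integrable v) :
    Integrable fun ξ => gaussSymbol z ξ * v ξ :=
  hv.bdd_mul (continuous_gaussSymbol_apply z).aestronglyMeasurable
    (ae_of_all _ (norm_gaussSymbol_le_one hz))

theorem continuous_gaussFlow {z : ℂ} (hz : 0 ≤ z.re) (f : 𝓢(Plane, ℂ)) :
    Continuous (gaussFlow z f) :=
  continuous_fourierInv_of_integrable (integrable_gaussSymbol_mul hz (𝓕 f).integrable)

theorem gaussFlow_add {z : ℂ} (hz : 0 ≤ z.re) (f g : 𝓢(Plane, ℂ)) (x : Plane) :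
    gaussFlow z (f + g) x = gaussFlow z f x + gaussFlow z g x := by
  have h : ∀ h : 𝓢(Plane, ℂ), Integrable fun ξ =>
      Real.fourierChar (inner ℝ ξ x) • (gaussSymbol z ξ * 𝓕 h ξ) := fun h => by
    simpa using (Real.fourierIntegral_convergent_iff (-x)).2
      (integrable_gaussSymbol_mul hz (𝓕 h).integrable)
  simp only [gaussFlow, Real.fourierInv_eq, FourierTransform.fourier_add, add_apply,
    mul_add, smul_add]
  exact integral_add (h f) (h g)

theorem integral_gaussFlow_mul {z : ℂ} (hz : 0 ≤ z.re) (f g : 𝓢(Plane, ℂ)) :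
    ∫ x, gaussFlow z f x * g x = gaussForm z f g := by
  rw [gaussFlow, integral_fourierInv_mul_eq (integrable_gaussSymbol_mul hz (𝓕 f).integrable)
    g.integrable, gaussForm]
  simp only [mul_assoc, SchwartzMap.fourierInv_coe]

theorem gaussFlow_eq_integral {z : ℂ} (hz : 0 < z.re) (f : 𝓢(Plane, ℂ)) (x : Plane) :
    gaussFlow z f x =
      ∫ y, (4 * Real.pi * z)⁻¹ * Complex.exp (-‖x - y‖ ^ 2 / (4 * z)) * f y := by
  have hb := re_four_mul_pi_sq_mul_pos hz
  have hz0 : z ≠ 0 := fun h => by simp [h] at hz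
  have hpi : (Real.pi : ℂ) ≠ 0 := by exact_mod_cast Real.pi_ne_zero
  have hduality := VectorFourier.integral_fourierIntegral_smul_eq_flip (L := innerₗ Plane)
    Real.continuous_fourierChar continuous_inner
    (GaussianFourier.integrable_cexp_neg_mul_sq_norm_add hb (2 * Real.pi * Complex.I) x)
    (f.integrable (μ := volume))
  calc gaussFlow z f x
      = ∫ ξ, Complex.exp (-(4 * Real.pi ^ 2 * z) * ‖ξ‖ ^ 2 +
          2 * Real.pi * Complex.I * inner ℝ x ξ) * 𝓕 f ξ := by
        rw [gaussFlow, Real.fourierInv_eq']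
        refine integral_congr_ae (ae_of_all _ fun ξ => ?_)
        simp only [gaussSymbol_eq_exp_neg_mul_sq, smul_eq_mul, Complex.exp_add, real_inner_comm x]
        push_cast
        ring_nf
    _ = ∫ y, 𝓕 (fun ξ : Plane => Complex.exp (-(4 * Real.pi ^ 2 * z) * ‖ξ‖ ^ 2 +
          2 * Real.pi * Complex.I * inner ℝ x ξ)) y * f y := by
        simpa [SchwartzMap.fourier_coe] using! hduality.symm
    _ = _ := by
        refine integral_congr_ae (ae_of_all _ fun y => ?_)
        simp only [fourier_gaussian_innerProductSpace' hb, finrank_euclideanSpace,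
          Fintype.card_fin, Nat.cast_ofNat, div_self (two_ne_zero' ℂ), Complex.cpow_one]
        congr 3 <;> field_simp

theorem enorm_gaussFlow_le {z : ℂ} (hz : 0 < z.re) (f : 𝓢(Plane, ℂ)) (x : Plane) :
    ‖gaussFlow z f x‖ₑ ≤ ENNReal.ofReal ‖z‖⁻¹ * ∫⁻ y, ‖f y‖ₑ := by
  rw [gaussFlow_eq_integral hz, ← lintegral_const_mul' _ _ ENNReal.ofReal_ne_top]
  refine (enorm_integral_le_lintegral_enorm _).trans (lintegral_mono fun y => ?_)
  rw [enorm_mul]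
  gcongr
  refine (ofReal_norm _).ge.trans (ENNReal.ofReal_le_ofReal ?_)
  have hexp : ‖Complex.exp (-‖x - y‖ ^ 2 / (4 * z))‖ ≤ 1 := by
    have h : (-‖x - y‖ ^ 2 / (4 * z) : ℂ) = ((-(‖x - y‖ ^ 2 / 4) : ℝ) : ℂ) * z⁻¹ := by
      push_cast
      ring
    rw [Complex.norm_exp, Real.exp_le_one_iff, h, Complex.re_ofReal_mul, Complex.inv_re, neg_mul,
      neg_nonpos]
    have := Complex.normSq_nonneg z
    positivity
  have hconst : ‖(4 * Real.pi * z)⁻¹‖ ≤ ‖z‖⁻¹ := by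
    have hz0 : 0 < ‖z‖ := norm_pos_iff.2 fun h => by simp [h] at hz
    rw [norm_inv]
    refine inv_anti₀ hz0 ?_
    rw [norm_mul, norm_mul, Complex.norm_ofNat, Complex.norm_real,
      Real.norm_of_nonneg Real.pi_pos.le]
    exact le_mul_of_one_le_left hz0.le (by linarith [Real.pi_gt_three])
  rw [norm_mul]
  exact (mul_le_of_le_one_right (norm_nonneg _) hexp).trans hconst

theorem integrable_fourier_mul_fourierInv (f g : 𝓢(Plane, ℂ)) :
    Integrable fun ξ => 𝓕 f ξ * 𝓕⁻ g ξ :=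
  ((𝓕 f).memLp 2 volume).integrable_mul ((𝓕⁻ g).memLp 2 volume)

theorem enorm_gaussForm_le_mul_eLpNorm'_two {z : ℂ} (hz : 0 ≤ z.re) (f g : 𝓢(Plane, ℂ)) :
    ‖gaussForm z f g‖ₑ ≤ eLpNorm' f 2 volume * eLpNorm' g 2 volume := by
  simp only [gaussForm, ← mul_assoc]
  refine (enorm_integral_mul_le Real.HolderConjugate.two_two
    ((continuous_gaussSymbol_apply z).mul (𝓕 f).continuous).aestronglyMeasurable
    (𝓕⁻ g).continuous.aestronglyMeasurable).trans ?_
  rw [eLpNorm'_two_fourierInv, ← eLpNorm'_two_fourier f]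
  gcongr
  refine eLpNorm'_mono_ae two_pos.le (ae_of_all _ fun ξ => ?_)
  rw [Pi.mul_apply, norm_mul]
  exact mul_le_of_le_one_left (norm_nonneg _) (norm_gaussSymbol_le_one hz ξ)

theorem eLpNorm'_two_gaussFlow_le {z : ℂ} (hz : 0 ≤ z.re) (f : 𝓢(Plane, ℂ)) :
    eLpNorm' (gaussFlow z f) 2 volume ≤ eLpNorm' f 2 volume := by
  refine eLpNorm'_le_of_forall_contDiff Real.HolderConjugate.two_two
    (continuous_gaussFlow hz f).locallyIntegrable fun g hg hg' => ?_
  have h := enorm_gaussForm_le_mul_eLpNorm'_two hz f (hg'.toSchwartzMap hg)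
  rwa [← integral_gaussFlow_mul hz] at h

theorem exists_eLpNorm'_gaussFlow_le {r r' : ℝ} (hr2 : 2 < r) (hr : r.HolderConjugate r') :
    ∃ C : ℝ≥0∞, C ≠ ⊤ ∧ ∀ z : ℂ, 0 < z.re → ∀ f : 𝓢(Plane, ℂ),
      eLpNorm' (gaussFlow z f) r volume ≤
        C * ENNReal.ofReal (‖z‖ ^ (-(1 - 2 / r))) * eLpNorm' f r' volume := by
  obtain ⟨C, hC, h⟩ := exists_eLpNorm'_le_of_sublinear (E := Plane) (F := ℂ)
    (μ := volume) (ν := (volume : Measure Plane)) hr2 hr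
  refine ⟨C, hC, fun z hz f => ?_⟩
  have hz0 : 0 < ‖z‖ := norm_pos_iff.2 fun h => by simp [h] at hz
  have hl2 : ∀ f : 𝓢(Plane, ℂ),
      ∫⁻ x, ‖gaussFlow z f x‖ₑ ^ (2 : ℝ) ≤ ∫⁻ y, ‖f y‖ₑ ^ (2 : ℝ) := fun f =>
    (ENNReal.rpow_le_rpow_iff (by norm_num)).1 (eLpNorm'_two_gaussFlow_le hz.le f)
  have hmain := h (fun f x => ‖gaussFlow z f x‖ₑ) ‖z‖⁻¹ (inv_pos.2 hz0)
    (fun f g x => gaussFlow_add hz.le f g x ▸ enorm_add_le _ _)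
    (fun f => (continuous_gaussFlow hz.le f).enorm.measurable) (enorm_gaussFlow_le hz) hl2 f
  rwa [ENNReal.ofReal_rpow_of_pos (inv_pos.2 hz0), Real.inv_rpow hz0.le, ← Real.rpow_neg hz0.le,
    eLpNorm'_enorm] at hmain

theorem exists_enorm_gaussForm_le {r r' : ℝ} (hr2 : 2 < r) (hr : r.HolderConjugate r') :
    ∃ C : ℝ≥0∞, C ≠ ⊤ ∧ ∀ z : ℂ, 0 < z.re → ∀ f g : 𝓢(Plane, ℂ),
      ‖gaussForm z f g‖ₑ ≤ C * ENNReal.ofReal (‖z‖ ^ (-(1 - 2 / r))) *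
        (eLpNorm' f r' volume * eLpNorm' g r' volume) := by
  obtain ⟨C, hC, h⟩ := exists_eLpNorm'_gaussFlow_le hr2 hr
  refine ⟨C, hC, fun z hz f g => ?_⟩
  rw [← integral_gaussFlow_mul hz.le, ← mul_assoc]
  refine (enorm_integral_mul_le hr (continuous_gaussFlow hz.le f).aestronglyMeasurable
    g.continuous.aestronglyMeasurable).trans ?_
  gcongr
  exact h z hz f

theorem tendsto_gaussForm (f g : 𝓢(Plane, ℂ)) (t : ℝ) :
    Tendsto (fun l : ℝ => gaussForm (l + t * Complex.I) f g) (𝓝[>] 0)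
      (𝓝 (gaussForm (t * Complex.I) f g)) := by
  refine tendsto_integral_filter_of_dominated_convergence (fun ξ => ‖𝓕 f ξ * 𝓕⁻ g ξ‖) ?_ ?_
    (integrable_fourier_mul_fourierInv f g).norm ?_
  · exact Eventually.of_forall fun l => ((continuous_gaussSymbol_apply _).mul
      ((𝓕 f).continuous.mul (𝓕⁻ g).continuous)).aestronglyMeasurable
  · filter_upwards [self_mem_nhdsWithin] with l hl
    refine ae_of_all _ fun ξ => ?_
    rw [norm_mul]
    exact mul_le_of_le_one_left (norm_nonneg _)
      (norm_gaussSymbol_le_one (by simpa using (Set.mem_Ioi.1 hl).le) ξ)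
  · refine ae_of_all _ fun ξ => Tendsto.mul_const _ (Tendsto.mono_left ?_ nhdsWithin_le_nhds)
    have hcont : Continuous fun l : ℝ => gaussSymbol (l + t * Complex.I) ξ := by
      unfold gaussSymbol
      fun_prop
    simpa using hcont.tendsto 0

theorem integral_freeProp_mul (t : ℝ) (ψ g : 𝓢(Plane, ℂ)) :
    ∫ x, freeProp t ψ x * g x = gaussForm (t * Complex.I) ψ g := by
  simp only [freeProp, SchwartzMap.fourierMultiplierCLM_apply,
    SchwartzMap.integral_fourierInv_mul_eq, gaussForm, smul_eq_mul, mul_assoc,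
    SchwartzMap.smulLeftCLM_apply_apply (hasTemperateGrowth_freeSymbol t),
    freeSymbol_eq_gaussSymbol]

theorem exists_eLpNorm'_freeProp_le {r r' : ℝ} (hr2 : 2 < r) (hr : r.HolderConjugate r') :
    ∃ C : ℝ≥0∞, C ≠ ⊤ ∧ ∀ t : ℝ, t ≠ 0 → ∀ ψ : 𝓢(Plane, ℂ),
      eLpNorm' (freeProp t ψ) r volume ≤ C * rieszKer (1 - 2 / r) t * eLpNorm' ψ r' volume := by
  obtain ⟨C, hC, h⟩ := exists_enorm_gaussForm_le hr2 hr
  refine ⟨C, hC, fun t ht ψ => eLpNorm'_le_of_forall_contDiff hr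
    (freeProp t ψ).continuous.locallyIntegrable fun g hg hg' => ?_⟩
  set G := hg'.toSchwartzMap hg
  have hnorm : Tendsto (fun l : ℝ => ‖(l + t * Complex.I : ℂ)‖) (𝓝[>] 0) (𝓝 |t|) := by
    have hcont : Continuous fun l : ℝ => ‖(l + t * Complex.I : ℂ)‖ := by fun_prop
    simpa using (hcont.tendsto 0).mono_left nhdsWithin_le_nhds
  have hbound := ENNReal.Tendsto.mul_const (b := eLpNorm' ψ r' volume * eLpNorm' G r' volume)
    (ENNReal.Tendsto.const_mul (ENNReal.tendsto_ofReal
      (hnorm.rpow_const (p := -(1 - 2 / r)) (Or.inl (abs_ne_zero.2 ht)))) (Or.inr hC))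
    (Or.inr (ENNReal.mul_ne_top
      (eLpNorm'_schwartz_ne_top hr.symm.pos ψ) (eLpNorm'_schwartz_ne_top hr.symm.pos G)))
  have hlim : ‖gaussForm (t * Complex.I) ψ G‖ₑ ≤ C * rieszKer (1 - 2 / r) t *
      (eLpNorm' ψ r' volume * eLpNorm' G r' volume) := by
    refine le_of_tendsto_of_tendsto (tendsto_gaussForm ψ G t).enorm hbound ?_
    filter_upwards [self_mem_nhdsWithin] with l hl
    exact h _ (by simpa using hl) ψ G
  rwa [← integral_freeProp_mul, ← mul_assoc] at hlim

/-! ### Sobolev data and their free evolution -/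

/-- The symbol `1 + (2π|ξ|)²` of `1 - Δ`. -/
def besselSymbol (ξ : Plane) : ℝ := 1 + (2 * Real.pi * ‖ξ‖) ^ 2

theorem one_le_besselSymbol (ξ : Plane) : 1 ≤ besselSymbol ξ :=
  le_add_of_nonneg_right (sq_nonneg _)

theorem besselSymbol_pos (ξ : Plane) : 0 < besselSymbol ξ :=
  zero_lt_one.trans_le (one_le_besselSymbol ξ)

theorem continuous_besselSymbol : Continuous besselSymbol := by
  unfold besselSymbol
  fun_prop

theorem inv_sqrt_besselSymbol_le_one (ξ : Plane) : (√(besselSymbol ξ))⁻¹ ≤ 1 :=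
  inv_le_one_of_one_le₀ (Real.one_le_sqrt.2 (one_le_besselSymbol ξ))

/-- The bilinear form `(f, g) ↦ ∫ ((1 - Δ)⁻¹ e^{itΔ} f) g dx`, written on the Fourier side. -/
def besselForm (t : ℝ) (f g : 𝓢(Plane, ℂ)) : ℂ :=
  ∫ ξ, ((besselSymbol ξ)⁻¹ : ℝ) * (freeSymbol t ξ * (𝓕 f ξ * 𝓕⁻ g ξ))

theorem integral_exp_mul_gaussSymbol (t : ℝ) (ξ : Plane) :
    ∫ l in Set.Ioi (0 : ℝ), (Real.exp (-l) : ℂ) * gaussSymbol (l + t * Complex.I) ξ =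
      ((besselSymbol ξ)⁻¹ : ℝ) * freeSymbol t ξ := by
  have hexp : ∀ l : ℝ, (Real.exp (-l) : ℂ) * gaussSymbol (l + t * Complex.I) ξ =
      Complex.exp (-(besselSymbol ξ : ℂ) * l) * freeSymbol t ξ := fun l => by
    rw [freeSymbol_eq_gaussSymbol, gaussSymbol, gaussSymbol, Complex.ofReal_exp, ← Complex.exp_add,
      ← Complex.exp_add, besselSymbol]
    congr 1
    push_cast
    ring
  simp_rw [hexp]
  rw [integral_mul_const, integral_exp_mul_complex_Ioi (by simpa using besselSymbol_pos ξ)]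
  simp

theorem integrable_exp_neg_mul_gaussSymbol_mul (t : ℝ) {v : Plane → ℂ} (hv : Integrable v) :
    Integrable (fun x : Plane × ℝ =>
      (Real.exp (-x.2) : ℂ) * (gaussSymbol (x.2 + t * Complex.I) x.1 * v x.1))
      (volume.prod (volume.restrict (Set.Ioi 0))) := by
  have hexp : Integrable (fun l : ℝ => (Real.exp (-l) : ℂ)) (volume.restrict (Set.Ioi 0)) :=
    (integrableOn_exp_neg_Ioi 0).ofReal
  have hsymbol : Continuous fun x : Plane × ℝ => gaussSymbol (x.2 + t * Complex.I) x.1 :=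
    continuous_gaussSymbol.comp (by fun_prop : Continuous fun x : Plane × ℝ =>
      ((x.2 + t * Complex.I : ℂ), x.1))
  have hpos : ∀ᵐ x : Plane × ℝ ∂(volume.prod (volume.restrict (Set.Ioi 0))),
      x.2 ∈ Set.Ioi (0 : ℝ) :=
    Measure.quasiMeasurePreserving_snd.ae (ae_restrict_mem measurableSet_Ioi)
  refine ((hv.mul_prod hexp).bdd_mul (c := 1) hsymbol.aestronglyMeasurable ?_).congr
    (ae_of_all _ fun x => by ring)
  filter_upwards [hpos] with x hx
  exact norm_gaussSymbol_le_one (by simpa using (Set.mem_Ioi.1 hx).le) _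

-- `(1 + |2πξ|²)⁻¹ = ∫₀^∞ e^{-l} e^{-l|2πξ|²} dl`: the resolvent is an average of heat flows.
theorem besselForm_eq_integral (t : ℝ) (f g : 𝓢(Plane, ℂ)) :
    besselForm t f g =
      ∫ l in Set.Ioi (0 : ℝ), (Real.exp (-l) : ℂ) * gaussForm (l + t * Complex.I) f g := by
  have hresolvent : besselForm t f g = ∫ ξ, ∫ l in Set.Ioi (0 : ℝ), (Real.exp (-l) : ℂ) *
      (gaussSymbol (l + t * Complex.I) ξ * (𝓕 f ξ * 𝓕⁻ g ξ)) := by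
    refine integral_congr_ae (ae_of_all _ fun ξ => ?_)
    simp only [← mul_assoc, ← integral_exp_mul_gaussSymbol]
    simp only [integral_mul_const]
  have hint := integrable_exp_neg_mul_gaussSymbol_mul t (integrable_fourier_mul_fourierInv f g)
  have hswap := integral_integral_swap (f := fun (ξ : Plane) (l : ℝ) => (Real.exp (-l) : ℂ) *
    (gaussSymbol (l + t * Complex.I) ξ * (𝓕 f ξ * 𝓕⁻ g ξ))) hint
  rw [hresolvent, hswap]
  simp only [integral_const_mul, gaussForm]

theorem rpow_neg_norm_add_mul_I_le {l t s γ : ℝ} (hl : 0 < l) (hs0 : 0 ≤ s) (hs : s ≤ γ)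
    (ht : t ≠ 0 ∨ s = 0) :
    ‖(l + t * Complex.I : ℂ)‖ ^ (-γ) ≤ l ^ (-(γ - s)) * |t| ^ (-s) := by
  have hzl : l ≤ ‖(l + t * Complex.I : ℂ)‖ := by
    simpa using (le_abs_self _).trans (Complex.abs_re_le_norm (l + t * Complex.I : ℂ))
  have hzt : |t| ≤ ‖(l + t * Complex.I : ℂ)‖ := by
    simpa using Complex.abs_im_le_norm (l + t * Complex.I : ℂ)
  have hz0 : 0 < ‖(l + t * Complex.I : ℂ)‖ := hl.trans_le hzl
  rw [show -γ = -(γ - s) + -s by ring, Real.rpow_add hz0]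
  refine mul_le_mul (Real.rpow_le_rpow_of_nonpos hl hzl (by linarith)) ?_ (by positivity)
    (by positivity)
  rcases ht with ht | rfl
  · exact Real.rpow_le_rpow_of_nonpos (abs_pos.2 ht) hzt (by linarith)
  · simp

theorem lintegral_exp_neg_mul_rpow_ne_top {δ : ℝ} (hδ : δ < 1) :
    ∫⁻ l in Set.Ioi (0 : ℝ), ENNReal.ofReal (Real.exp (-l) * l ^ (-δ)) ≠ ⊤ := by
  have h := Real.GammaIntegral_convergent (s := 1 - δ) (by linarith)
  rw [show 1 - δ - 1 = -δ by ring] at h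
  exact (hasFiniteIntegral_iff_ofReal (by
    filter_upwards [ae_restrict_mem measurableSet_Ioi] with l hl
    have : (0 : ℝ) < l := hl
    positivity)).1 h.2 |>.ne

theorem exists_enorm_besselForm_le {r r' : ℝ} (hr2 : 2 < r) (hr : r.HolderConjugate r') {s : ℝ}
    (hs0 : 0 ≤ s) (hs : s ≤ 1 - 2 / r) :
    ∃ κ : ℝ≥0∞, κ ≠ ⊤ ∧ ∀ t : ℝ, (t ≠ 0 ∨ s = 0) → ∀ f g : 𝓢(Plane, ℂ),
      ‖besselForm t f g‖ₑ ≤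
        κ * rieszKer s t * (eLpNorm' f r' volume * eLpNorm' g r' volume) := by
  obtain ⟨C, hC, h⟩ := exists_enorm_gaussForm_le hr2 hr
  set γ := 1 - 2 / r
  have hγ1 : γ < 1 := sub_lt_self 1 (div_pos two_pos hr.pos)
  have hgamma := lintegral_exp_neg_mul_rpow_ne_top (δ := γ - s) (by linarith)
  refine ⟨C * ∫⁻ l in Set.Ioi (0 : ℝ), ENNReal.ofReal (Real.exp (-l) * l ^ (-(γ - s))),
    ENNReal.mul_ne_top hC hgamma, fun t ht f g => ?_⟩
  set N := eLpNorm' f r' volume * eLpNorm' g r' volume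
  calc ‖besselForm t f g‖ₑ
      ≤ ∫⁻ l in Set.Ioi (0 : ℝ),
          ENNReal.ofReal (Real.exp (-l)) * ‖gaussForm (l + t * Complex.I) f g‖ₑ := by
        rw [besselForm_eq_integral]
        refine (enorm_integral_le_lintegral_enorm _).trans_eq (lintegral_congr fun l => ?_)
        rw [enorm_mul, ← ofReal_norm, Complex.norm_real, Real.norm_of_nonneg (Real.exp_pos _).le]
    _ ≤ ∫⁻ l in Set.Ioi (0 : ℝ),
          ENNReal.ofReal (Real.exp (-l) * l ^ (-(γ - s))) * (C * rieszKer s t * N) := by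
        refine setLIntegral_mono' measurableSet_Ioi fun l hl => ?_
        have hl0 : (0 : ℝ) < l := hl
        calc ENNReal.ofReal (Real.exp (-l)) * ‖gaussForm (l + t * Complex.I) f g‖ₑ
            ≤ ENNReal.ofReal (Real.exp (-l)) *
                (C * ENNReal.ofReal (l ^ (-(γ - s)) * |t| ^ (-s)) * N) := by
              grw [h _ (by simpa using hl0) f g, rpow_neg_norm_add_mul_I_le hl0 hs0 hs ht]
          _ = _ := by
              rw [ENNReal.ofReal_mul (by positivity), ENNReal.ofReal_mul (by positivity), rieszKer]
              ring
    _ = _ := by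
        rw [lintegral_mul_const _ (by fun_prop)]
        ring

/-- The Fourier transform of `(1 - Δ)^{-1/2} e^{-itΔ} ψ̄`. Its `L²` pairing with
`(1 - Δ)^{1/2} f`, on the Fourier side, is `∫ f e^{itΔ} ψ dx`. -/
def dualSymbol (ψ : 𝓢(Plane, ℂ)) (t : ℝ) (ξ : Plane) : ℂ :=
  ((√(besselSymbol ξ))⁻¹ : ℝ) * (starRingEnd ℂ) (freeSymbol t ξ * 𝓕⁻ ψ ξ)

theorem norm_freeSymbol (t : ℝ) (ξ : Plane) : ‖freeSymbol t ξ‖ = 1 :=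
  Complex.norm_exp_ofReal_mul_I _

theorem continuous_freeSymbol : Continuous fun x : ℝ × Plane => freeSymbol x.1 x.2 := by
  unfold freeSymbol
  fun_prop

theorem norm_dualSymbol_sub_le (ψ φ : 𝓢(Plane, ℂ)) (t : ℝ) (ξ : Plane) :
    ‖dualSymbol ψ t ξ - dualSymbol φ t ξ‖ ≤ ‖𝓕⁻ ψ ξ - 𝓕⁻ φ ξ‖ := by
  rw [dualSymbol, dualSymbol, ← mul_sub, ← map_sub, ← mul_sub, norm_mul, RCLike.norm_conj,
    norm_mul, norm_freeSymbol, one_mul, Complex.norm_real, Real.norm_of_nonneg (by positivity)]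
  exact mul_le_of_le_one_left (norm_nonneg _) (inv_sqrt_besselSymbol_le_one ξ)

theorem dualSymbol_zero (t : ℝ) (ξ : Plane) : dualSymbol 0 t ξ = 0 := by
  simp [dualSymbol, FourierTransform.fourierInv_zero]

theorem norm_dualSymbol_le (ψ : 𝓢(Plane, ℂ)) (t : ℝ) (ξ : Plane) :
    ‖dualSymbol ψ t ξ‖ ≤ ‖𝓕⁻ ψ ξ‖ := by
  simpa [dualSymbol_zero, FourierTransform.fourierInv_zero] using norm_dualSymbol_sub_le ψ 0 t ξ

theorem continuous_dualSymbol (ψ : 𝓢(Plane, ℂ)) :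
    Continuous fun x : ℝ × Plane => dualSymbol ψ x.1 x.2 := by
  have hbessel : Continuous fun x : ℝ × Plane => (√(besselSymbol x.2))⁻¹ :=
    (continuous_besselSymbol.comp continuous_snd).sqrt.inv₀
      fun x => (Real.sqrt_pos.2 (besselSymbol_pos _)).ne'
  exact (Complex.continuous_ofReal.comp hbessel).mul (Complex.continuous_conj.comp
    (continuous_freeSymbol.mul ((𝓕⁻ ψ).continuous.comp continuous_snd)))

theorem memLp_dualSymbol (ψ : 𝓢(Plane, ℂ)) (t : ℝ) : MemLp (dualSymbol ψ t) 2 volume :=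
  ((𝓕⁻ ψ).memLp 2 volume).mono
    ((continuous_dualSymbol ψ).comp (Continuous.prodMk_right t)).aestronglyMeasurable
    (ae_of_all _ fun ξ => norm_dualSymbol_le ψ t ξ)

/-- `dualSymbol ψ t` as an element of `L²`. -/
def dualVec (ψ : 𝓢(Plane, ℂ)) (t : ℝ) : Lp ℂ 2 (volume : Measure Plane) :=
  (memLp_dualSymbol ψ t).toLp _

theorem norm_dualVec_sub_le (ψ φ : 𝓢(Plane, ℂ)) (t : ℝ) :
    ‖dualVec ψ t - dualVec φ t‖ ≤ ‖(𝓕⁻ ψ).toLp 2 volume - (𝓕⁻ φ).toLp 2 volume‖ := by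
  refine Lp.norm_le_norm_of_ae_le ?_
  filter_upwards [Lp.coeFn_sub (dualVec ψ t) (dualVec φ t),
    Lp.coeFn_sub ((𝓕⁻ ψ).toLp 2 volume) ((𝓕⁻ φ).toLp 2 volume),
    (memLp_dualSymbol ψ t).coeFn_toLp, (memLp_dualSymbol φ t).coeFn_toLp,
    (𝓕⁻ ψ).coeFn_toLp 2, (𝓕⁻ φ).coeFn_toLp 2] with ξ hdual hschwartz hψ hφ hψ' hφ'
  rw [hdual, hschwartz, Pi.sub_apply, Pi.sub_apply, hψ', hφ', dualVec, dualVec, hψ, hφ]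
  exact norm_dualSymbol_sub_le ψ φ t ξ

theorem norm_dualVec_le (ψ : 𝓢(Plane, ℂ)) (t : ℝ) :
    ‖dualVec ψ t‖ ≤ ‖(𝓕⁻ ψ).toLp 2 volume‖ := by
  refine Lp.norm_le_norm_of_ae_le ?_
  filter_upwards [(memLp_dualSymbol ψ t).coeFn_toLp, (𝓕⁻ ψ).coeFn_toLp 2] with ξ hdual hψ
  rw [dualVec, hdual, hψ]
  exact norm_dualSymbol_le ψ t ξ

theorem continuous_dualVec (ψ : 𝓢(Plane, ℂ)) : Continuous (dualVec ψ) := by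
  refine continuous_iff_seqContinuous.2 fun u t hu => ?_
  unfold dualVec
  rw [Function.comp_def, Lp.tendsto_Lp_iff_tendsto_eLpNorm'' _ (fun n => memLp_dualSymbol ψ (u n)) _
    (memLp_dualSymbol ψ t)]
  simp only [eLpNorm_eq_eLpNorm' two_ne_zero ENNReal.ofNat_ne_top, ENNReal.toReal_ofNat]
  rw [← eLpNorm'_zero (α := Plane) (ε := ℂ) (μ := volume) two_pos]
  have hfin : ∫⁻ ξ, ‖(2 : ℂ) * 𝓕⁻ ψ ξ‖ₑ ^ (2 : ℝ) ≠ ⊤ := by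
    simpa only [ENNReal.toReal_ofNat] using (lintegral_rpow_enorm_lt_top_of_eLpNorm_lt_top
      two_ne_zero ENNReal.ofNat_ne_top (((𝓕⁻ ψ).memLp 2 volume).const_mul 2).2).ne
  have hbound : ∀ n ξ, ‖dualSymbol ψ (u n) ξ - dualSymbol ψ t ξ‖ ≤ ‖(2 : ℂ) * 𝓕⁻ ψ ξ‖ := by
    intro n ξ
    rw [norm_mul, Complex.norm_ofNat, two_mul]
    exact (norm_sub_le _ _).trans
      (add_le_add (norm_dualSymbol_le ψ (u n) ξ) (norm_dualSymbol_le ψ t ξ))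
  have hlim : ∀ ξ, Tendsto (fun n => dualSymbol ψ (u n) ξ - dualSymbol ψ t ξ) atTop (𝓝 0) := by
    intro ξ
    have hcont : Continuous fun t => dualSymbol ψ t ξ := by
      have := continuous_dualSymbol ψ
      fun_prop
    have hsub : Tendsto (fun n => dualSymbol ψ (u n) ξ - dualSymbol ψ t ξ) atTop
        (𝓝 (dualSymbol ψ t ξ - dualSymbol ψ t ξ)) :=
      Tendsto.sub_const (hcont.continuousAt.tendsto.comp hu) _
    rwa [sub_self] at hsub
  have := tendsto_eLpNorm'_of_dominated (f := fun _ => (0 : ℂ))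
    (g := fun n ξ => dualSymbol ψ (u n) ξ - dualSymbol ψ t ξ) two_pos
    (fun ξ => ‖(2 : ℂ) * 𝓕⁻ ψ ξ‖ₑ)
    (fun n => ((memLp_dualSymbol ψ (u n)).sub (memLp_dualSymbol ψ t)).1)
    (fun n => ae_of_all _ fun ξ => enorm_le_iff_norm_le.2 (hbound n ξ)) hfin (ae_of_all _ hlim)
  exact this

/-- The complex conjugate of a Schwartz function. -/
def conjSchwartz (φ : 𝓢(Plane, ℂ)) : 𝓢(Plane, ℂ) :=
  φ.postcompCLM (Complex.conjCLE : ℂ →L[ℝ] ℂ)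

theorem conjSchwartz_apply (φ : 𝓢(Plane, ℂ)) (x : Plane) :
    conjSchwartz φ x = (starRingEnd ℂ) (φ x) := rfl

theorem eLpNorm'_conjSchwartz (φ : 𝓢(Plane, ℂ)) (s : ℝ) :
    eLpNorm' (conjSchwartz φ) s volume = eLpNorm' φ s volume :=
  eLpNorm'_congr_norm_ae (ae_of_all _ fun x => by rw [conjSchwartz_apply, RCLike.norm_conj])

theorem fourier_conjSchwartz (φ : 𝓢(Plane, ℂ)) (ξ : Plane) :
    𝓕 (conjSchwartz φ) ξ = (starRingEnd ℂ) (𝓕⁻ φ ξ) := by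
  rw [SchwartzMap.fourier_coe, SchwartzMap.fourierInv_coe, Real.fourier_eq', Real.fourierInv_eq',
    ← integral_conj]
  refine integral_congr_ae (ae_of_all _ fun x => ?_)
  simp only [smul_eq_mul, map_mul, ← Complex.exp_conj, conjSchwartz_apply, Complex.conj_I,
    Complex.conj_ofReal]
  congr 2
  push_cast
  ring

theorem freeSymbol_sub (s t : ℝ) (ξ : Plane) :
    freeSymbol (s - t) ξ = freeSymbol s ξ * (starRingEnd ℂ) (freeSymbol t ξ) := by
  simp only [freeSymbol]
  rw [← Complex.exp_conj, ← Complex.exp_add, map_mul, Complex.conj_I, Complex.conj_ofReal]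
  congr 1
  push_cast
  ring

theorem inner_dualVec_dualVec (ψ φ : 𝓢(Plane, ℂ)) (s t : ℝ) :
    inner ℂ (dualVec ψ s) (dualVec φ t) = besselForm (s - t) (conjSchwartz φ) ψ := by
  rw [L2.inner_def, besselForm]
  refine integral_congr_ae ?_
  filter_upwards [(memLp_dualSymbol ψ s).coeFn_toLp, (memLp_dualSymbol φ t).coeFn_toLp]
    with ξ hψ hφ
  have hsqrt : ((besselSymbol ξ)⁻¹ : ℝ) = (√(besselSymbol ξ))⁻¹ * (√(besselSymbol ξ))⁻¹ := by
    rw [← mul_inv, Real.mul_self_sqrt (besselSymbol_pos ξ).le]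
  rw [dualVec, dualVec, hψ, hφ, fourier_conjSchwartz, dualSymbol, dualSymbol, RCLike.inner_apply,
    freeSymbol_sub, hsqrt]
  simp only [map_mul, Complex.conj_conj, Complex.conj_ofReal]
  push_cast
  ring

theorem exists_enorm_inner_dualVec_le {r r' : ℝ} (hr2 : 2 < r) (hr : r.HolderConjugate r') {σ : ℝ}
    (hσ0 : 0 ≤ σ) (hσ : σ ≤ 1 - 2 / r) :
    ∃ κ : ℝ≥0∞, κ ≠ ⊤ ∧ ∀ (ψ φ : 𝓢(Plane, ℂ)) (s t : ℝ), (s ≠ t ∨ σ = 0) →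
      ‖inner ℂ (dualVec ψ s) (dualVec φ t)‖ₑ ≤
        κ * rieszKer σ (s - t) * (eLpNorm' φ r' volume * eLpNorm' ψ r' volume) := by
  obtain ⟨κ, hκ, h⟩ := exists_enorm_besselForm_le hr2 hr hσ0 hσ
  refine ⟨κ, hκ, fun ψ φ s t hst => ?_⟩
  rw [inner_dualVec_dualVec, ← eLpNorm'_conjSchwartz φ]
  exact h (s - t) (hst.imp_left sub_ne_zero.2) _ ψ

theorem memLp_of_normH1_lt_top {f : Plane → ℂ} (hf : normH1 f < ⊤) : MemLp f 2 volume := by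
  by_contra h
  simp [normH1, h] at hf

theorem fourierInv_freeProp (t : ℝ) (ψ : 𝓢(Plane, ℂ)) (ξ : Plane) :
    𝓕⁻ (freeProp t ψ) ξ = freeSymbol t ξ * 𝓕⁻ ψ ξ := by
  have hneg (h : 𝓢(Plane, ℂ)) : 𝓕⁻ h ξ = 𝓕 h (-ξ) := by
    rw [SchwartzMap.fourierInv_coe, SchwartzMap.fourier_coe, Real.fourierInv_eq_fourier_neg]
  rw [hneg, hneg, freeProp, SchwartzMap.fourierMultiplierCLM_apply,
    FourierTransform.fourier_fourierInv_eq,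
    SchwartzMap.smulLeftCLM_apply_apply (hasTemperateGrowth_freeSymbol t), smul_eq_mul]
  simp [freeSymbol]

theorem freeProp_zero (ψ : 𝓢(Plane, ℂ)) : freeProp 0 ψ = ψ := by
  have h : (𝓕⁻ (freeProp 0 ψ) : 𝓢(Plane, ℂ)) = 𝓕⁻ ψ := by
    ext ξ
    simp [fourierInv_freeProp, freeSymbol]
  exact (FourierTransform.fourierCLE ℂ 𝓢(Plane, ℂ)).symm.injective h

theorem integral_mul_eq_integral_fourier_mul {f : Plane → ℂ} (hf : MemLp f 2 volume)
    (ψ : 𝓢(Plane, ℂ)) :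
    ∫ x, f x * ψ x = ∫ ξ, (𝓕 (hf.toLp f) : Lp ℂ 2 volume) ξ * 𝓕⁻ ψ ξ := by
  have h := congrArg (fun T => T (𝓕⁻ ψ)) (Lp.fourier_toTemperedDistribution_eq (hf.toLp f))
  simp only [TemperedDistribution.fourier_apply, FourierTransform.fourier_fourierInv_eq,
    Lp.toTemperedDistribution_apply, smul_eq_mul] at h
  simp_rw [mul_comm _ (𝓕⁻ ψ _), ← h]
  refine integral_congr_ae ?_
  filter_upwards [hf.coeFn_toLp] with x hx
  rw [hx, mul_comm]

theorem exists_integral_mul_freeProp_eq_inner {f : Plane → ℂ} (hf : normH1 f < ⊤) :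
    ∃ W : Lp ℂ 2 (volume : Measure Plane), ‖W‖ₑ = normH1 f ∧
      ∀ (ψ : 𝓢(Plane, ℂ)) (t : ℝ), ∫ x, f x * freeProp t ψ x = inner ℂ (dualVec ψ t) W := by
  have hf2 := memLp_of_normH1_lt_top hf
  set F : Lp ℂ 2 (volume : Measure Plane) := 𝓕 (hf2.toLp f)
  have hnorm : normH1 f = eLpNorm (fun ξ => √(besselSymbol ξ) • F ξ) 2 volume := dif_pos hf2
  have hw : MemLp (fun ξ => √(besselSymbol ξ) • F ξ) 2 volume :=
    ⟨continuous_besselSymbol.sqrt.aestronglyMeasurable.smul (Lp.aestronglyMeasurable F),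
      hnorm ▸ hf⟩
  refine ⟨hw.toLp _, by rw [Lp.enorm_def, eLpNorm_congr_ae hw.coeFn_toLp, hnorm], fun ψ t => ?_⟩
  have hfourier : ∫ x, f x * freeProp t ψ x = ∫ ξ, F ξ * 𝓕⁻ (freeProp t ψ) ξ :=
    integral_mul_eq_integral_fourier_mul hf2 _
  rw [hfourier, L2.inner_def]
  refine integral_congr_ae ?_
  filter_upwards [(memLp_dualSymbol ψ t).coeFn_toLp, hw.coeFn_toLp] with ξ hdual hweight
  have hsqrt : (√(besselSymbol ξ) : ℂ) ≠ 0 := by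
    exact_mod_cast (Real.sqrt_pos.2 (besselSymbol_pos ξ)).ne'
  rw [dualVec, hdual, hweight, dualSymbol, RCLike.inner_apply, map_mul, Complex.conj_conj,
    Complex.conj_ofReal, fourierInv_freeProp, Complex.real_smul, Complex.ofReal_inv]
  field_simp

theorem exists_eLpNorm'_le_normH1 {r r' : ℝ} (hr2 : 2 < r) (hr : r.HolderConjugate r') :
    ∃ C : ℝ≥0∞, C ≠ ⊤ ∧ ∀ f : Plane → ℂ, normH1 f < ⊤ → eLpNorm' f r volume ≤ C * normH1 f := by
  obtain ⟨κ, hκ, h⟩ := exists_enorm_inner_dualVec_le hr2 hr le_rfl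
    (sub_nonneg.2 ((div_le_one hr.pos).2 hr2.le))
  refine ⟨κ ^ (1 / 2 : ℝ), by finiteness, fun f hf => ?_⟩
  obtain ⟨W, hW, hWf⟩ := exists_integral_mul_freeProp_eq_inner hf
  refine eLpNorm'_le_of_forall_contDiff hr
    ((memLp_of_normH1_lt_top hf).locallyIntegrable one_le_two) fun g hg hg' => ?_
  set G := hg'.toSchwartzMap hg
  have hsq : ‖dualVec G 0‖ₑ ^ (2 : ℝ) ≤ (κ ^ (1 / 2 : ℝ) * eLpNorm' G r' volume) ^ (2 : ℝ) := by
    have hG := h G G 0 0 (Or.inr rfl)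
    rw [inner_self_eq_norm_sq_to_K, ← ofReal_norm, norm_pow, RCLike.norm_ofReal, abs_norm,
      ENNReal.ofReal_pow (norm_nonneg _), ofReal_norm] at hG
    rw [ENNReal.mul_rpow_of_nonneg _ _ two_pos.le, ← ENNReal.rpow_mul]
    simpa [rieszKer, ENNReal.rpow_two, sq (eLpNorm' G r' volume)] using hG
  change ‖∫ x, f x * G x‖ₑ ≤ _ * eLpNorm' G r' volume
  calc ‖∫ x, f x * G x‖ₑ = ‖inner ℂ (dualVec G 0) W‖ₑ := by rw [← hWf, freeProp_zero]
    _ ≤ ‖dualVec G 0‖ₑ * ‖W‖ₑ := enorm_inner_le _ _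
    _ ≤ κ ^ (1 / 2 : ℝ) * eLpNorm' G r' volume * normH1 f := by
        rw [hW]
        gcongr
        exact (ENNReal.rpow_le_rpow_iff two_pos).1 hsq
    _ = _ := by ring

theorem exists_seq_mem_forall_mem_closure {X Y : Type*} [TopologicalSpace Y]
    [SecondCountableTopology Y] (F : X → Y) {S : Set X} (hS : S.Nonempty) :
    ∃ φ : ℕ → X, (∀ n, φ n ∈ S) ∧ ∀ x ∈ S, F x ∈ closure (Set.range (F ∘ φ)) := by
  have : Nonempty (F '' S) := (hS.image F).to_subtype
  choose φ hφS hφ using fun n => (TopologicalSpace.denseSeq (F '' S) n).2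
  refine ⟨φ, hφS, fun x hx => ?_⟩
  have hclosure := map_mem_closure continuous_subtype_val
    (TopologicalSpace.denseRange_denseSeq (F '' S) ⟨F x, x, hx, rfl⟩) (t := Set.range (F ∘ φ))
      (Set.mapsTo_range_iff.2 fun n => ⟨n, hφ n⟩)
  exact hclosure

theorem le_mul_eLpNorm'_of_forall_eLpNorm'_le_one {s : ℝ} (hs : 0 < s) {c : ℝ≥0∞}
    {N : 𝓢(Plane, ℂ) → ℝ≥0∞} (hN : ∀ (a : ℂ) ψ, N (a • ψ) = ‖a‖ₑ * N ψ)
    (hc : ∀ ψ : 𝓢(Plane, ℂ), eLpNorm' ψ s volume ≤ 1 → N ψ ≤ c) (ψ : 𝓢(Plane, ℂ)) :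
    N ψ ≤ c * eLpNorm' ψ s volume := by
  have hfin := eLpNorm'_schwartz_ne_top hs ψ
  rcases eq_or_ne (eLpNorm' ψ s volume) 0 with h0 | h0
  · have hae := (eLpNorm'_eq_zero_iff hs ψ.continuous.aestronglyMeasurable).1 h0
    have hψ : ψ = (0 : ℂ) • (0 : 𝓢(Plane, ℂ)) := by
      ext x
      simpa using congrFun (Measure.eq_of_ae_eq hae ψ.continuous continuous_zero) x
    rw [hψ, hN, enorm_zero, zero_mul]
    exact zero_le
  set a : ℂ := ((eLpNorm' ψ s volume).toReal : ℂ)⁻¹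
  have ha : ‖a‖ₑ = (eLpNorm' ψ s volume)⁻¹ := by
    rw [← ofReal_norm, norm_inv, Complex.norm_real, Real.norm_of_nonneg ENNReal.toReal_nonneg,
      ENNReal.ofReal_inv_of_pos (ENNReal.toReal_pos h0 hfin), ENNReal.ofReal_toReal hfin]
  have hscaled := hc (a • ψ) (by
    change eLpNorm' (a • (ψ : Plane → ℂ)) s volume ≤ 1
    rw [eLpNorm'_const_smul a hs, ha, ENNReal.inv_mul_cancel h0 hfin])
  rw [hN, ha, ENNReal.inv_mul_le_iff h0 hfin] at hscaled
  rwa [mul_comm]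

theorem exists_free_evolution_majorant {q r r' : ℝ} (hq : 2 < q) (hr2 : 2 < r)
    (hr : r.HolderConjugate r') (hqr : 2 / q ≤ 1 - 2 / r) :
    ∃ C : ℝ≥0∞, C ≠ ⊤ ∧ ∀ f : Plane → ℂ, normH1 f < ⊤ → ∃ h : ℝ → ℝ≥0∞, Measurable h ∧
      eLpNorm' h q volume ≤ C * normH1 f ∧
      ∀ (t : ℝ) (ψ : 𝓢(Plane, ℂ)),
        ‖∫ x, f x * freeProp t ψ x‖ₑ ≤ h t * eLpNorm' ψ r' volume := by
  obtain ⟨κ, hκ, hinner⟩ := exists_enorm_inner_dualVec_le hr2 hr (by positivity) hqr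
  obtain ⟨D, hD, hmax⟩ :=
    exists_eLpNorm'_iSup_inner_le (H := Lp ℂ 2 (volume : Measure Plane)) hq hκ
  have : Fact ((2 : ℝ≥0∞) ≠ ⊤) := ⟨ENNReal.ofNat_ne_top⟩
  obtain ⟨φ, hφ, hdense⟩ := exists_seq_mem_forall_mem_closure
    (fun ψ : 𝓢(Plane, ℂ) => (𝓕⁻ ψ).toLp 2 volume) (S := {ψ | eLpNorm' ψ r' volume ≤ 1})
    ⟨0, (eLpNorm'_zero hr.symm.pos).trans_le zero_le⟩
  refine ⟨D, hD, fun f hf => ?_⟩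
  obtain ⟨W, hW, hWf⟩ := exists_integral_mul_freeProp_eq_inner hf
  set h : ℝ → ℝ≥0∞ := fun t => ⨆ n, ‖inner ℂ (dualVec (φ n) t) W‖ₑ
  have hunit (t : ℝ) (ψ : 𝓢(Plane, ℂ)) (hψ : eLpNorm' ψ r' volume ≤ 1) :
      ‖inner ℂ (dualVec ψ t) W‖ₑ ≤ h t := by
    obtain ⟨x, hx, hlim⟩ := mem_closure_iff_seq_limit.1 (hdense ψ hψ)
    choose k hk using hx
    have hdual : Tendsto (fun j => dualVec (φ (k j)) t) atTop (𝓝 (dualVec ψ t)) := by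
      rw [tendsto_iff_norm_sub_tendsto_zero] at hlim ⊢
      refine squeeze_zero (fun _ => norm_nonneg _) (fun j => ?_) hlim
      rw [← hk]
      exact norm_dualVec_sub_le _ _ _
    exact le_of_tendsto (hdual.inner tendsto_const_nhds).enorm
      (.of_forall fun j => le_iSup (fun n => ‖inner ℂ (dualVec (φ n) t) W‖ₑ) (k j))
  refine ⟨h, Measurable.iSup fun n =>
    ((continuous_dualVec (φ n)).inner continuous_const).measurable.enorm, ?_, fun t => ?_⟩
  · rw [← hW]
    refine hmax (fun n => ‖(𝓕⁻ (φ n)).toLp 2 volume‖) (fun n => dualVec (φ n))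
      (fun n => (continuous_dualVec (φ n)).stronglyMeasurable) (fun n t => norm_dualVec_le _ _)
      (fun n m s t hst => (hinner (φ n) (φ m) s t (Or.inl hst)).trans ?_) W
    exact mul_le_of_le_one_right' (mul_le_one' (hφ m) (hφ n))
  · refine le_mul_eLpNorm'_of_forall_eLpNorm'_le_one hr.symm.pos (fun a ψ => ?_)
      fun ψ hψ => (hWf ψ t).symm ▸ hunit t ψ hψ
    rw [map_smul, ← enorm_mul, ← integral_const_mul]
    simp only [smul_apply, smul_eq_mul, mul_left_comm]

/-! ### The nonlinearity -/

theorem rpow_sub_rpow_mul_le {p x y : ℝ} (hp : 0 < p) (hy : 0 ≤ y) (hxy : y ≤ x) :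
    (x ^ p - y ^ p) * y ≤ p * x ^ p * (x - y) := by
  rcases hy.eq_or_lt with rfl | hy0
  · have : 0 ≤ x ^ p := Real.rpow_nonneg hxy p
    simp only [mul_zero, sub_zero]
    positivity
  have hx0 : 0 < x := hy0.trans_le hxy
  have bernoulli := one_add_mul_self_le_rpow_one_add (s := y / x - 1) (p := p + 1)
    (by linarith [div_nonneg hy hx0.le]) (by linarith)
  rw [add_sub_cancel, Real.div_rpow hy hx0.le, le_div_iff₀ (by positivity),
    Real.rpow_add_one hx0.ne', Real.rpow_add_one hy0.ne'] at bernoulli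
  have hclear : (1 + (p + 1) * (y / x - 1)) * (x ^ p * x) = x ^ p * (x + (p + 1) * (y - x)) := by
    field_simp
  linarith

section PowerNonlinearity

variable {E : Type*} [NormedAddCommGroup E] [NormedSpace ℝ E] {p : ℝ}

theorem norm_rpow_smul_sub_le_of_norm_le (hp : 0 < p) {z w : E} (h : ‖w‖ ≤ ‖z‖) :
    ‖‖z‖ ^ p • z - ‖w‖ ^ p • w‖ ≤ (p + 1) * (‖z‖ ^ p * ‖z - w‖) := by
  have hz : 0 ≤ ‖z‖ ^ p := by positivity
  have hzw : 0 ≤ ‖z‖ ^ p - ‖w‖ ^ p :=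
    sub_nonneg.2 (Real.rpow_le_rpow (norm_nonneg _) h hp.le)
  calc ‖‖z‖ ^ p • z - ‖w‖ ^ p • w‖
      = ‖‖z‖ ^ p • (z - w) + (‖z‖ ^ p - ‖w‖ ^ p) • w‖ := by congr 1; module
    _ ≤ ‖z‖ ^ p * ‖z - w‖ + (‖z‖ ^ p - ‖w‖ ^ p) * ‖w‖ := by
        refine (norm_add_le _ _).trans_eq ?_
        rw [norm_smul, norm_smul, Real.norm_of_nonneg hz, Real.norm_of_nonneg hzw]
    _ ≤ ‖z‖ ^ p * ‖z - w‖ + p * ‖z‖ ^ p * (‖z‖ - ‖w‖) :=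
        add_le_add_right (rpow_sub_rpow_mul_le hp (norm_nonneg w) h) _
    _ ≤ ‖z‖ ^ p * ‖z - w‖ + p * ‖z‖ ^ p * ‖z - w‖ := by
        gcongr
        exact norm_sub_norm_le z w
    _ = _ := by ring

theorem norm_rpow_smul_sub_le (hp : 0 < p) (z w : E) :
    ‖‖z‖ ^ p • z - ‖w‖ ^ p • w‖ ≤ (p + 1) * ((‖w‖ + ‖z - w‖) ^ p * ‖z - w‖) := by
  rcases le_total ‖w‖ ‖z‖ with h | h
  · refine (norm_rpow_smul_sub_le_of_norm_le hp h).trans ?_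
    gcongr
    exact norm_le_norm_add_norm_sub' z w
  · rw [norm_sub_rev, norm_sub_rev z w]
    refine (norm_rpow_smul_sub_le_of_norm_le hp h).trans ?_
    gcongr
    exact le_add_of_nonneg_right (norm_nonneg _)

variable {Ω F : Type*} [MeasurableSpace Ω] {μ : Measure Ω} [NormedAddCommGroup F]

theorem eLpNorm_norm_rpow_smul_le {r : ℝ} (hp : 0 < p) (hr : 0 < r) {k : Ω → F} {w : Ω → E}
    (hk : AEStronglyMeasurable k μ) (hw : AEStronglyMeasurable w μ) :
    eLpNorm (fun x => ‖k x‖ ^ p • w x) (ENNReal.ofReal (r / (p + 1))) μ ≤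
      eLpNorm k (ENNReal.ofReal r) μ ^ p * eLpNorm w (ENNReal.ofReal r) μ := by
  have hT : (ENNReal.ofReal (r / p)).HolderTriple (ENNReal.ofReal r)
      (ENNReal.ofReal (r / (p + 1))) := by
    constructor
    rw [← ENNReal.ofReal_inv_of_pos (by positivity), ← ENNReal.ofReal_inv_of_pos (by positivity),
      ← ENNReal.ofReal_inv_of_pos (by positivity), ← ENNReal.ofReal_add (by positivity)
        (by positivity)]
    congr 1
    field_simp
  have hkp : AEStronglyMeasurable (fun x => ‖k x‖ ^ p) μ :=
    (Real.continuous_rpow_const hp.le).comp_aestronglyMeasurable hk.norm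
  refine (eLpNorm_smul_le_mul_eLpNorm hw hkp (hpqr := hT)).trans_eq ?_
  rw [eLpNorm_norm_rpow k hp, ← ENNReal.ofReal_mul (by positivity), div_mul_cancel₀ _ hp.ne']

theorem eLpNorm_weighted_power_sub_le {r : ℝ} {ρ β : ℝ≥0∞} (hp : 0 < p) (hr : 1 ≤ r)
    (hρ : ρ.HolderTriple (ENNReal.ofReal (r / (p + 1))) β) {a : Ω → ℝ} {f g : Ω → E}
    (ha : AEStronglyMeasurable a μ) (hf : AEStronglyMeasurable f μ)
    (hg : AEStronglyMeasurable g μ) :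
    eLpNorm (fun x => a x • ‖f x‖ ^ p • f x - a x • ‖g x‖ ^ p • g x) β μ ≤
      ENNReal.ofReal (p + 1) * (eLpNorm a ρ μ *
        ((eLpNorm g (ENNReal.ofReal r) μ + eLpNorm (f - g) (ENNReal.ofReal r) μ) ^ p *
          eLpNorm (f - g) (ENNReal.ofReal r) μ)) := by
  have hw : AEStronglyMeasurable (f - g) μ := hf.sub hg
  set k : Ω → ℝ := fun x => ‖g x‖ + ‖(f - g) x‖
  have hkm : AEStronglyMeasurable k μ := hg.norm.add hw.norm
  have hk : eLpNorm k (ENNReal.ofReal r) μ ≤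
      eLpNorm g (ENNReal.ofReal r) μ + eLpNorm (f - g) (ENNReal.ofReal r) μ := by
    rw [← eLpNorm_norm g, ← eLpNorm_norm (f - g)]
    exact eLpNorm_add_le hg.norm hw.norm (ENNReal.one_le_ofReal.2 hr)
  have hd : AEStronglyMeasurable (fun x => ‖k x‖ ^ p • (f - g) x) μ :=
    ((Real.continuous_rpow_const hp.le).comp_aestronglyMeasurable hkm.norm).smul hw
  have hpointwise : ∀ x, ‖a x • ‖f x‖ ^ p • f x - a x • ‖g x‖ ^ p • g x‖ ≤
      (p + 1) * ‖a x • ‖k x‖ ^ p • (f - g) x‖ := by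
    intro x
    have hkx : 0 ≤ k x := by positivity
    rw [← smul_sub, norm_smul, norm_smul, norm_smul, Real.norm_of_nonneg hkx,
      Real.norm_of_nonneg (Real.rpow_nonneg hkx p), mul_left_comm]
    exact mul_le_mul_of_nonneg_left (norm_rpow_smul_sub_le hp (f x) (g x)) (norm_nonneg _)
  refine (eLpNorm_le_mul_eLpNorm_of_ae_le_mul (.of_forall hpointwise) β).trans ?_
  gcongr
  refine (eLpNorm_smul_le_mul_eLpNorm hd ha (hpqr := hρ)).trans ?_
  gcongr
  refine (eLpNorm_norm_rpow_smul_le hp (by linarith) hkm hw).trans ?_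
  gcongr

end PowerNonlinearity

/-! ### Duhamel solutions -/

theorem locallyIntegrable_of_integrable_mul_schwartz {w : Plane → ℂ}
    (h : ∀ ψ : 𝓢(Plane, ℂ), Integrable fun x => w x * ψ x) : LocallyIntegrable w := by
  intro x
  let b : ContDiffBump x := ⟨1, 2, one_pos, one_lt_two⟩
  have hb : ContDiff ℝ ∞ fun y => ((b y : ℝ) : ℂ) := Complex.ofRealCLM.contDiff.comp b.contDiff
  have hsupp : HasCompactSupport fun y => ((b y : ℝ) : ℂ) :=
    b.hasCompactSupport.comp_left (g := Complex.ofReal) Complex.ofReal_zero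
  refine ⟨Metric.closedBall x 1, Metric.closedBall_mem_nhds x one_pos, ?_⟩
  refine (h (hsupp.toSchwartzMap hb)).integrableOn.congr_fun (fun y hy => ?_)
    Metric.isClosed_closedBall.measurableSet
  simp only [HasCompactSupport.toSchwartzMap_toFun]
  rw [b.one_of_mem_closedBall hy, Complex.ofReal_one, mul_one]

theorem eLpNorm'_le_of_forall_schwartz {r r' : ℝ} (hr : r.HolderConjugate r') {w : Plane → ℂ}
    {M : ℝ≥0∞} (hw : ∀ ψ : 𝓢(Plane, ℂ), Integrable fun x => w x * ψ x)
    (H : ∀ ψ : 𝓢(Plane, ℂ), ‖∫ x, w x * ψ x‖ₑ ≤ M * eLpNorm' ψ r' volume) :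
    eLpNorm' w r volume ≤ M :=
  eLpNorm'_le_of_forall_contDiff hr (locallyIntegrable_of_integrable_mul_schwartz hw)
    fun _ hg hsupp => H (hsupp.toSchwartzMap hg)

theorem IsDuhamelSolution.mono {I J : Set ℝ} (hIJ : I ⊆ J) {t₀ : ℝ} {v G : ℝ → Plane → ℂ}
    (h : IsDuhamelSolution J t₀ v G) : IsDuhamelSolution I t₀ v G :=
  ae_restrict_of_ae_restrict_of_subset hIJ h

theorem intervalIntegral_integral_sub {α : Type*} [MeasurableSpace α] {μ : Measure α} [SFinite μ]
    {t₀ t : ℝ} {f g : ℝ → α → ℂ}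
    (hf : Integrable (fun z : ℝ × α => f z.1 z.2) ((volume.restrict (Set.uIoc t₀ t)).prod μ))
    (hg : Integrable (fun z : ℝ × α => g z.1 z.2) ((volume.restrict (Set.uIoc t₀ t)).prod μ)) :
    ∫ s in t₀..t, ∫ x, (f s x - g s x) ∂μ =
      (∫ s in t₀..t, ∫ x, f s x ∂μ) - ∫ s in t₀..t, ∫ x, g s x ∂μ := by
  rw [← intervalIntegral.integral_sub (intervalIntegrable_iff.2 hf.integral_prod_left)
    (intervalIntegrable_iff.2 hg.integral_prod_left)]
  refine intervalIntegral.integral_congr_ae_restrict ?_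
  filter_upwards [hf.prod_right_ae, hg.prod_right_ae] with s hfs hgs using integral_sub hfs hgs

theorem volume_restrict_prod_univ (S : Set ℝ) :
    (volume : Measure (ℝ × Plane)).restrict (S ×ˢ Set.univ) = (volume.restrict S).prod volume := by
  rw [Measure.volume_eq_prod, ← Measure.prod_restrict, Measure.restrict_univ]

theorem IsDuhamelSolution.sub {I : Set ℝ} {t₀ : ℝ} {u v G K : ℝ → Plane → ℂ}
    (hu : IsDuhamelSolution I t₀ u G) (hv : IsDuhamelSolution I t₀ v K) :
    IsDuhamelSolution I t₀ (fun t x => u t x - v t x) (fun t x => G t x - K t x) := by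
  filter_upwards [hu, hv] with t hut hvt ψ
  obtain ⟨hut_int, hu₀_int, hG_int, hu_eq⟩ := hut ψ
  obtain ⟨hvt_int, hv₀_int, hK_int, hv_eq⟩ := hvt ψ
  simp only [sub_mul]
  refine ⟨hut_int.sub hvt_int, hu₀_int.sub hv₀_int, hG_int.sub hK_int, ?_⟩
  rw [IntegrableOn, volume_restrict_prod_univ] at hG_int hK_int
  have hforcing := intervalIntegral_integral_sub (f := fun s x => G s x * freeProp (t - s) ψ x)
    (g := fun s x => K s x * freeProp (t - s) ψ x) hG_int hK_int
  rw [hforcing, integral_sub hut_int hvt_int, integral_sub hu₀_int hv₀_int, hu_eq, hv_eq]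
  ring

theorem exists_eLpNorm'_le_of_isDuhamelSolution {r r' : ℝ} (hr2 : 2 < r)
    (hr : r.HolderConjugate r') :
    ∃ κ : NNReal, ∀ (I : Set ℝ) (t₀ : ℝ) (w G : ℝ → Plane → ℂ) (h : ℝ → ℝ≥0∞), I.OrdConnected →
      t₀ ∈ I → IsDuhamelSolution I t₀ w G →
      (∀ᵐ s ∂volume.restrict I, AEStronglyMeasurable (G s) volume) →
      (∀ t (ψ : 𝓢(Plane, ℂ)), ‖∫ x, w t₀ x * freeProp t ψ x‖ₑ ≤ h t * eLpNorm' ψ r' volume) →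
      ∀ᵐ t ∂volume.restrict I, eLpNorm' (w t) r volume ≤ h (t - t₀) +
        κ * ∫⁻ s in Set.uIoc t₀ t, rieszKer (1 - 2 / r) (t - s) * eLpNorm' (G s) r' volume := by
  obtain ⟨κ, hκ, hdisp⟩ := exists_eLpNorm'_freeProp_le hr2 hr
  lift κ to NNReal using hκ
  refine ⟨κ, fun I t₀ w G h hI ht₀ hw hG hh => ?_⟩
  filter_upwards [hw, ae_restrict_mem hI.measurableSet] with t ht htI
  refine eLpNorm'_le_of_forall_schwartz hr (fun ψ => (ht ψ).1) fun ψ => ?_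
  set N := eLpNorm' ψ r' volume
  have hN : N ≠ ⊤ := eLpNorm'_schwartz_ne_top hr.symm.pos ψ
  have hsub : Set.uIoc t₀ t ⊆ I := Set.uIoc_subset_uIcc.trans (hI.uIcc_subset ht₀ htI)
  have hslice : ∀ᵐ s ∂volume.restrict (Set.uIoc t₀ t),
      ‖∫ x, G s x * freeProp (t - s) ψ x‖ₑ ≤
        κ * (rieszKer (1 - 2 / r) (t - s) * eLpNorm' (G s) r' volume) * N := by
    filter_upwards [ae_restrict_of_ae_restrict_of_subset hsub hG,
      ae_restrict_of_ae (Measure.ae_ne volume t)] with s hs hst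
    calc _ ≤ eLpNorm' (G s) r' volume * eLpNorm' (freeProp (t - s) ψ) r volume :=
          enorm_integral_mul_le hr.symm hs (freeProp (t - s) ψ).continuous.aestronglyMeasurable
      _ ≤ eLpNorm' (G s) r' volume * (κ * rieszKer (1 - 2 / r) (t - s) * N) := by
          gcongr
          exact hdisp (t - s) (sub_ne_zero.2 hst.symm) ψ
      _ = _ := by ring
  rw [(ht ψ).2.2.2, add_mul]
  refine enorm_sub_le.trans (add_le_add (hh _ ψ) ?_)
  calc ‖Complex.I * ∫ s in t₀..t, ∫ x, G s x * freeProp (t - s) ψ x‖ₑ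
      = ‖∫ s in t₀..t, ∫ x, G s x * freeProp (t - s) ψ x‖ₑ := by
        rw [enorm_mul, ← ofReal_norm Complex.I, Complex.norm_I, ENNReal.ofReal_one, one_mul]
    _ = ‖∫ s in Set.uIoc t₀ t, ∫ x, G s x * freeProp (t - s) ψ x‖ₑ := by
        rw [← ofReal_norm, intervalIntegral.norm_intervalIntegral_eq, ofReal_norm]
    _ ≤ ∫⁻ s in Set.uIoc t₀ t,
          κ * (rieszKer (1 - 2 / r) (t - s) * eLpNorm' (G s) r' volume) * N :=
        (enorm_integral_le_lintegral_enorm _).trans (lintegral_mono_ae hslice)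
    _ = _ := by rw [lintegral_mul_const' _ _ hN, lintegral_const_mul' _ _ ENNReal.coe_ne_top]

theorem exists_majorant_of_isDuhamelSolution {q r r' : ℝ} (hq : 2 < q) (hr2 : 2 < r)
    (hr : r.HolderConjugate r') (hqr : 2 / q ≤ 1 - 2 / r) :
    ∃ κ B : NNReal, ∀ (I : Set ℝ) (t₀ : ℝ) (w G : ℝ → Plane → ℂ), I.OrdConnected → t₀ ∈ I →
      IsDuhamelSolution I t₀ w G →
      (∀ᵐ s ∂volume.restrict I, AEStronglyMeasurable (G s) volume) → normH1 (w t₀) < ⊤ →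
      ∃ h : ℝ → ℝ≥0∞, Measurable h ∧
        eLpNorm' h q (volume.restrict I) ≤ B * normH1 (w t₀) ∧
        ∀ᵐ t ∂volume.restrict I, eLpNorm' (w t) r volume ≤ h t +
          κ * ∫⁻ s in Set.uIoc t₀ t, rieszKer (1 - 2 / r) (t - s) * eLpNorm' (G s) r' volume := by
  obtain ⟨κ, hκ⟩ := exists_eLpNorm'_le_of_isDuhamelSolution hr2 hr
  obtain ⟨B, hB, hfree⟩ := exists_free_evolution_majorant hq hr2 hr hqr
  lift B to NNReal using hB
  refine ⟨κ, B, fun I t₀ w G hI ht₀ hw hG hw₀ => ?_⟩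
  obtain ⟨h, hm, hle, hh⟩ := hfree (w t₀) hw₀
  refine ⟨fun t => h (t - t₀), by fun_prop, ?_, hκ I t₀ w G h hI ht₀ hw hG hh⟩
  calc eLpNorm' (fun t => h (t - t₀)) q (volume.restrict I)
      ≤ eLpNorm' (fun t => h (t - t₀)) q volume :=
        eLpNorm'_mono_measure _ Measure.restrict_le_self (by linarith)
    _ = eLpNorm' h q volume := by
        simp only [eLpNorm'_eq_lintegral_enorm]
        rw [lintegral_sub_right_eq_self (fun t => ‖h t‖ₑ ^ q) t₀]
    _ ≤ _ := hle

/-! ### Space-time norms -/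

theorem eLpNorm_ofReal_eq_eLpNorm' {α ε : Type*} [MeasurableSpace α] [TopologicalSpace ε]
    [ContinuousENorm ε] {μ : Measure α} {k : ℝ} (hk : 0 < k) (f : α → ε) :
    eLpNorm f (ENNReal.ofReal k) μ = eLpNorm' f k μ := by
  rw [eLpNorm_eq_eLpNorm' (by simpa using hk) ENNReal.ofReal_ne_top, ENNReal.toReal_ofReal hk.le]

theorem mixedNorm_eq_eLpNorm' {m k : ℝ} (hm : 0 < m) (hk : 0 < k) (I : Set ℝ)
    (v : ℝ → Plane → ℂ) :
    mixedNorm m k I v = eLpNorm' (fun t => eLpNorm' (v t) k volume) m (volume.restrict I) := by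
  simp only [mixedNorm, eLpNorm_ofReal_eq_eLpNorm' hm, eLpNorm_ofReal_eq_eLpNorm' hk]

theorem aemeasurable_eLpNorm'_slice {α β F : Type*} [MeasurableSpace α] [MeasurableSpace β]
    [NormedAddCommGroup F] {μ : Measure α} {ν : Measure β} [SFinite ν] (k : ℝ) {v : α → β → F}
    (hv : AEStronglyMeasurable (fun z : α × β => v z.1 z.2) (μ.prod ν)) :
    AEMeasurable (fun t => eLpNorm' (v t) k ν) μ := by
  simp only [eLpNorm'_eq_lintegral_enorm]
  exact (AEMeasurable.lintegral_prod_right' (f := fun z : α × β => ‖v z.1 z.2‖ₑ ^ k)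
    (hv.enorm.pow_const _)).pow_const _

theorem normH1_congr_ae {f g : Plane → ℂ} (h : f =ᵐ[volume] g) : normH1 f = normH1 g := by
  unfold normH1
  by_cases hf : MemLp f 2 volume
  · have hg := hf.ae_eq h
    rw [dif_pos hf, dif_pos hg, (MemLp.toLp_eq_toLp_iff hf hg).2 h]
  · rw [dif_neg hf, dif_neg fun hg => hf (hg.ae_eq h.symm)]

theorem exists_eLpNorm'_le_on_compact {r r' : ℝ} (hr2 : 2 < r) (hr : r.HolderConjugate r')
    {u : ℝ → Plane → ℂ} (hu : ∀ t, normH1 (u t) < ⊤)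
    (hc : ∀ t, Tendsto (fun s => normH1 (fun x => u s x - u t x)) (𝓝 t) (𝓝 0))
    {K : Set ℝ} (hK : IsCompact K) :
    ∃ M : NNReal, ∀ s ∈ K, eLpNorm' (u s) r volume ≤ M := by
  obtain ⟨C, hC, hsobolev⟩ := exists_eLpNorm'_le_normH1 hr2 hr
  refine hK.induction_on (p := fun S => ∃ M : NNReal, ∀ s ∈ S, eLpNorm' (u s) r volume ≤ M)
    ⟨0, by simp⟩ ?_ ?_ ?_
  · rintro S T hST ⟨M, hM⟩
    exact ⟨M, fun s hs => hM s (hST hs)⟩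
  · rintro S T ⟨M, hM⟩ ⟨N, hN⟩
    refine ⟨M + N, fun s hs => ?_⟩
    push_cast
    exact hs.elim (fun h => (hM s h).trans le_self_add) fun h => (hN s h).trans le_add_self
  · intro t _
    have hnear : ∀ᶠ s in 𝓝 t, normH1 (fun x => u s x - u t x) < 1 :=
      (hc t).eventually_lt_const zero_lt_one
    have hbound : C * 1 + C * normH1 (u t) ≠ ⊤ :=
      ENNReal.add_ne_top.2 ⟨by simpa using hC, ENNReal.mul_ne_top hC (hu t).ne⟩
    refine ⟨_, mem_nhdsWithin_of_mem_nhds hnear, (C * 1 + C * normH1 (u t)).toNNReal, ?_⟩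
    intro s (hs : normH1 (fun x => u s x - u t x) < 1)
    rw [ENNReal.coe_toNNReal hbound]
    have hms := (memLp_of_normH1_lt_top (hu s)).aestronglyMeasurable
    have hmt := (memLp_of_normH1_lt_top (hu t)).aestronglyMeasurable
    calc eLpNorm' (u s) r volume = eLpNorm' ((fun x => u s x - u t x) + u t) r volume := by
          congr 1
          exact (sub_add_cancel (u s) (u t)).symm
      _ ≤ eLpNorm' (fun x => u s x - u t x) r volume + eLpNorm' (u t) r volume :=
          eLpNorm'_add_le (hms.sub hmt) hmt hr.lt.le
      _ ≤ C * normH1 (fun x => u s x - u t x) + C * normH1 (u t) :=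
          add_le_add (hsobolev _ (hs.trans ENNReal.one_lt_top)) (hsobolev _ (hu t))
      _ ≤ C * 1 + C * normH1 (u t) := by gcongr

/-! ### The exponents -/

section Exponents

variable {p : ℝ}

theorem two_lt_rExp (hp : 0 < p) : 2 < rExp p := by
  unfold rExp
  split_ifs with h
  · linarith
  · rw [lt_div_iff₀ hp]
    linarith

theorem add_one_lt_qExp (hp : 0 < p) : p + 1 < qExp p := by
  unfold qExp
  split_ifs with h
  · nlinarith
  · linarith

theorem two_lt_qExp (hp : 0 < p) : 2 < qExp p := by
  unfold qExp
  split_ifs with h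
  · nlinarith
  · linarith

theorem holderConjugate_rExp_betaExp (hp : 0 < p) : (rExp p).HolderConjugate (betaExp p) := by
  rw [Real.holderConjugate_iff]
  refine ⟨by linarith [two_lt_rExp hp], ?_⟩
  unfold rExp betaExp
  split_ifs with h <;> field_simp <;> ring

theorem alphaExp_eq_qExp_div (p : ℝ) : alphaExp p = qExp p / (p + 1) := by
  unfold alphaExp qExp
  split_ifs with h
  · rw [div_div]
    congr 1
    ring
  · rfl

theorem div_qExp_eq_two_div_rExp (hp : 0 < p) : p / qExp p = 2 / rExp p := by
  unfold rExp qExp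
  split_ifs with h <;> field_simp
  ring

theorem two_div_qExp_le (hp : 0 < p) : 2 / qExp p ≤ 1 - 2 / rExp p := by
  rw [← div_qExp_eq_two_div_rExp hp, le_sub_iff_add_le, ← add_div,
    div_le_one (by linarith [two_lt_qExp hp])]
  unfold qExp
  split_ifs with h
  · nlinarith
  · linarith

theorem one_div_qExp_add_one (hp : 0 < p) :
    1 / qExp p + 1 = (p + 1) / qExp p + (1 - 2 / rExp p) := by
  rw [← div_qExp_eq_two_div_rExp hp]
  ring

theorem holderTriple_rhoExp (hp : 0 < p) : (rhoExp p).HolderTriple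
    (ENNReal.ofReal (rExp p / (p + 1))) (ENNReal.ofReal (betaExp p)) := by
  constructor
  unfold rhoExp rExp betaExp
  split_ifs with h
  · simp
  · have hp4 : 0 < 4 - p := by linarith
    rw [← ENNReal.ofReal_inv_of_pos (by positivity), ← ENNReal.ofReal_inv_of_pos (by positivity),
      ← ENNReal.ofReal_inv_of_pos (by positivity), ← ENNReal.ofReal_add (by positivity)
        (by positivity)]
    congr 1
    field_simp
    ring

end Exponents

/-! ### Comparison of an exact and an approximate solution -/

section Comparison

variable {p : ℝ} {a : Plane → ℝ} {I : Set ℝ} {t₀ : ℝ} {u v e : ℝ → Plane → ℂ} {u₀ : Plane → ℂ}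

theorem normX_eq_eLpNorm' (hp : 0 < p) (I : Set ℝ) (v : ℝ → Plane → ℂ) :
    normX p I v =
      eLpNorm' (fun t => eLpNorm' (v t) (rExp p) volume) (qExp p) (volume.restrict I) :=
  mixedNorm_eq_eLpNorm' (by linarith [two_lt_qExp hp]) (by linarith [two_lt_rExp hp]) I v

theorem normY_eq_eLpNorm' (hp : 0 < p) (I : Set ℝ) (v : ℝ → Plane → ℂ) :
    normY p I v = eLpNorm' (fun t => eLpNorm' (v t) (betaExp p) volume) (qExp p / (p + 1))
      (volume.restrict I) := by
  have hq : 0 < qExp p := by linarith [two_lt_qExp hp]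
  rw [normY, alphaExp_eq_qExp_div,
    mixedNorm_eq_eLpNorm' (by positivity) (holderConjugate_rExp_betaExp hp).symm.pos]

theorem aestronglyMeasurable_nonlin (hp : 0 < p) (ha : AEStronglyMeasurable a volume)
    {μ : Measure ℝ} (hv : AEStronglyMeasurable (fun z : ℝ × Plane => v z.1 z.2) (μ.prod volume)) :
    AEStronglyMeasurable (fun z : ℝ × Plane => nonlin p a v z.1 z.2) (μ.prod volume) := by
  have hpow : AEStronglyMeasurable (fun z : ℝ × Plane => ‖v z.1 z.2‖ ^ p) (μ.prod volume) :=
    (Real.continuous_rpow_const hp.le).comp_aestronglyMeasurable hv.norm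
  exact ((Complex.continuous_ofReal.comp_aestronglyMeasurable ha.comp_snd).mul
    (Complex.continuous_ofReal.comp_aestronglyMeasurable hpow)).mul hv

theorem eLpNorm'_nonlin_sub_le (hp : 0 < p) (ha : AEStronglyMeasurable a volume) {A : NNReal}
    (haA : eLpNorm a (rhoExp p) volume ≤ A) {t : ℝ} (hu : AEStronglyMeasurable (u t) volume)
    (hv : AEStronglyMeasurable (v t) volume) :
    eLpNorm' (fun x => nonlin p a u t x - nonlin p a v t x) (betaExp p) volume ≤
      ((p + 1).toNNReal * A : NNReal) * ((eLpNorm' (v t) (rExp p) volume +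
        eLpNorm' (fun x => u t x - v t x) (rExp p) volume) ^ p *
          eLpNorm' (fun x => u t x - v t x) (rExp p) volume) := by
  have hr := (holderConjugate_rExp_betaExp hp).lt
  have h := eLpNorm_weighted_power_sub_le hp hr.le (holderTriple_rhoExp hp) ha hu hv
  simp only [eLpNorm_ofReal_eq_eLpNorm' (zero_lt_one.trans hr),
    eLpNorm_ofReal_eq_eLpNorm' (holderConjugate_rExp_betaExp hp).symm.pos,
    Complex.real_smul, ← mul_assoc] at h
  refine h.trans ?_
  rw [ENNReal.coe_mul, ← mul_assoc]
  gcongr <;> rfl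

theorem IsGlobalSolution.aestronglyMeasurable_restrict (hu : IsGlobalSolution p a t₀ u₀ u)
    (I : Set ℝ) :
    AEStronglyMeasurable (fun z : ℝ × Plane => u z.1 z.2) ((volume.restrict I).prod volume) :=
  hu.measurable.mono_ac
    (Measure.absolutelyContinuous_restrict.prod Measure.AbsolutelyContinuous.rfl)

theorem eLpNorm'_restrict_ne_top_of_le {α : Type*} [MeasurableSpace α] {μ : Measure α} {q : ℝ}
    (hq : 0 < q) {S : Set α} (hS : MeasurableSet S) (hμ : μ S ≠ ⊤) {f : α → ℝ≥0∞} {M : NNReal}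
    (hf : ∀ t ∈ S, f t ≤ M) : eLpNorm' f q (μ.restrict S) ≠ ⊤ := by
  refine ne_top_of_le_ne_top ?_ (eLpNorm'_mono_enorm_ae (g := fun _ => (M : ℝ≥0∞)) hq.le
    (ae_restrict_of_forall_mem hS hf))
  rw [eLpNorm'_const _ hq, Measure.restrict_apply_univ, enorm_eq_self]
  finiteness

theorem eLpNorm'_sub_le {α F : Type*} [MeasurableSpace α] [NormedAddCommGroup F] {μ : Measure α}
    {q : ℝ} {f g : α → F} (hf : AEStronglyMeasurable f μ) (hg : AEStronglyMeasurable g μ)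
    (hq : 1 ≤ q) : eLpNorm' (f - g) q μ ≤ eLpNorm' f q μ + eLpNorm' g q μ := by
  rw [sub_eq_add_neg, ← eLpNorm'_neg g]
  exact eLpNorm'_add_le hf hg.neg hq

theorem eLpNorm'_slice_sub_window_ne_top (hp : 0 < p) (hu : IsGlobalSolution p a t₀ u₀ u)
    (hv : IsApproxSolution p a I t₀ v e) (hX : normX p I v ≠ ⊤) (hI : MeasurableSet I) (τ : ℝ) :
    eLpNorm' (fun t => eLpNorm' (fun x => u t x - v t x) (rExp p) volume) (qExp p)
      (volume.restrict (Metric.closedBall t₀ τ ∩ I)) ≠ ⊤ := by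
  have hq := two_lt_qExp hp
  have hr := holderConjugate_rExp_betaExp hp
  set J := Metric.closedBall t₀ τ ∩ I
  have hJI : J ⊆ I := Set.inter_subset_right
  have hum := hu.aestronglyMeasurable_restrict I
  have hu_fin : eLpNorm' (fun t => eLpNorm' (u t) (rExp p) volume) (qExp p)
      (volume.restrict J) ≠ ⊤ := by
    obtain ⟨M, hM⟩ := exists_eLpNorm'_le_on_compact (two_lt_rExp hp) hr hu.mem_H1
      hu.continuous_H1 (isCompact_closedBall t₀ τ)
    have hJ : volume J ≠ ⊤ :=
      measure_ne_top_of_subset Set.inter_subset_left measure_closedBall_lt_top.ne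
    exact eLpNorm'_restrict_ne_top_of_le (by linarith) (measurableSet_closedBall.inter hI) hJ
      fun t ht => hM t ht.1
  have hv_fin : eLpNorm' (fun t => eLpNorm' (v t) (rExp p) volume) (qExp p)
      (volume.restrict J) ≠ ⊤ := by
    rw [normX_eq_eLpNorm' hp] at hX
    exact ne_top_of_le_ne_top hX
      (eLpNorm'_mono_measure _ (Measure.restrict_mono hJI le_rfl) (by linarith))
  have htriangle : ∀ᵐ t ∂volume.restrict J, eLpNorm' (fun x => u t x - v t x) (rExp p) volume ≤
      eLpNorm' (u t) (rExp p) volume + eLpNorm' (v t) (rExp p) volume := by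
    refine ae_restrict_of_ae_restrict_of_subset hJI ?_
    filter_upwards [hum.prodMk_left, hv.measurable.prodMk_left] with t hut hvt
    exact eLpNorm'_sub_le hut hvt hr.lt.le
  refine ne_top_of_le_ne_top (ENNReal.add_ne_top.2 ⟨hu_fin, hv_fin⟩)
    ((eLpNorm'_mono_enorm_ae (by linarith) htriangle).trans (eLpNorm'_add_le
      ((aemeasurable_eLpNorm'_slice _ hum).mono_set hJI).aestronglyMeasurable
      ((aemeasurable_eLpNorm'_slice _ hv.measurable).mono_set hJI).aestronglyMeasurable
      (by linarith)))

theorem exists_majorant_slice_sub (hp : 0 < p) :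
    ∃ κ B : NNReal, ∀ (a : Plane → ℝ) (I : Set ℝ) (t₀ : ℝ) (u₀ : Plane → ℂ)
      (u v e : ℝ → Plane → ℂ), AEStronglyMeasurable a volume → I.OrdConnected → t₀ ∈ I →
      IsGlobalSolution p a t₀ u₀ u → IsApproxSolution p a I t₀ v e →
      normH1 (fun x => u₀ x - v t₀ x) < ⊤ →
      ∃ h : ℝ → ℝ≥0∞, Measurable h ∧
        eLpNorm' h (qExp p) (volume.restrict I) ≤ B * normH1 (fun x => u₀ x - v t₀ x) ∧
        ∀ᵐ t ∂volume.restrict I, eLpNorm' (fun x => u t x - v t x) (rExp p) volume ≤ h t +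
          κ * ∫⁻ s in Set.uIoc t₀ t, rieszKer (1 - 2 / rExp p) (t - s) *
            (eLpNorm' (fun x => nonlin p a u s x - nonlin p a v s x) (betaExp p) volume +
              eLpNorm' (e s) (betaExp p) volume) := by
  have hr := holderConjugate_rExp_betaExp hp
  obtain ⟨κ, B, H⟩ :=
    exists_majorant_of_isDuhamelSolution (two_lt_qExp hp) (two_lt_rExp hp) hr (two_div_qExp_le hp)
  refine ⟨κ, B, fun a I t₀ u₀ u v e ha hI ht₀ hu hv hdata => ?_⟩
  have hw₀ : normH1 (fun x => u t₀ x - v t₀ x) = normH1 (fun x => u₀ x - v t₀ x) :=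
    normH1_congr_ae (hu.initial.sub (.refl _ _))
  have hF := ((aestronglyMeasurable_nonlin hp ha (hu.aestronglyMeasurable_restrict I)).sub
    (aestronglyMeasurable_nonlin hp ha hv.measurable)).prodMk_left
  have he := hv.measurable_error.prodMk_left
  have hforcing : ∀ᵐ s ∂volume.restrict I, AEStronglyMeasurable
      (fun x => nonlin p a u s x - (nonlin p a v s x + e s x)) volume := by
    filter_upwards [hF, he] with s hFs hes
    simp only [← sub_sub]
    exact hFs.sub hes
  rw [← hw₀] at hdata ⊢
  obtain ⟨h, hm, hle, hbound⟩ := H I t₀ _ _ hI ht₀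
    ((hu.duhamel.mono (Set.subset_univ I)).sub hv.duhamel) hforcing hdata
  refine ⟨h, hm, hle, ?_⟩
  filter_upwards [hbound, ae_restrict_mem hI.measurableSet] with t ht htI
  refine ht.trans ?_
  gcongr _ + _ * ?_
  have hsub : Set.uIoc t₀ t ⊆ I := Set.uIoc_subset_uIcc.trans (hI.uIcc_subset ht₀ htI)
  refine lintegral_mono_ae (ae_restrict_of_ae_restrict_of_subset hsub ?_)
  filter_upwards [hF, he] with s hFs hes
  gcongr
  simpa only [Pi.sub_def, sub_sub] using eLpNorm'_sub_le hFs hes hr.symm.lt.le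

end Comparison

end

end StabilityNLS

open StabilityNLS in
theorem mainTheorem7_general (p : ℝ) (hp : 0 < p) (A L : NNReal) :
    ∃ ε₁ > (0 : ℝ), ∃ C > (0 : ℝ),
      ∀ a : Plane → ℝ, AEStronglyMeasurable a volume → eLpNorm a (rhoExp p) volume ≤ A →
      ∀ (I : Set ℝ) (t₀ : ℝ), I.OrdConnected → t₀ ∈ I →
      ∀ (u₀ : Plane → ℂ) (v e : ℝ → Plane → ℂ), IsApproxSolution p a I t₀ v e →
        normX p I v ≤ L →
      ∀ ε : ℝ, ε ≤ ε₁ →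
        normH1 (fun x => u₀ x - v t₀ x) + normY p I e < ENNReal.ofReal ε →
      ∀ u : ℝ → Plane → ℂ, IsGlobalSolution p a t₀ u₀ u →
        normX p I (fun t x => u t x - v t x) +
            normY p I (fun t x => nonlin p a u t x - nonlin p a v t x) ≤
          ENNReal.ofReal (C * ε) := by
  have hr := two_lt_rExp hp
  obtain ⟨κ, B, hmajorant⟩ := exists_majorant_slice_sub hp
  obtain ⟨ε₁, hε₁, C, hstable⟩ := exists_scalar_stability hp (add_one_lt_qExp hp)
    (γ := 1 - 2 / rExp p) (by rw [sub_pos, div_lt_one (by linarith)]; exact hr)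
    (by rw [sub_lt_self_iff]; positivity) (one_div_qExp_add_one hp) κ ((p + 1).toNNReal * A) L B
  refine ⟨ε₁, hε₁, C + 1, by positivity, ?_⟩
  intro a ha haA I t₀ hI ht₀ u₀ v e hv hvL ε hε hsmall u hu
  have hdata := le_self_add.trans_lt hsmall
  have herr := (le_add_self.trans_lt hsmall).le
  obtain ⟨h, hm, hh, hduhamel⟩ := hmajorant a I t₀ u₀ u v e ha hI ht₀ hu hv (hdata.trans_le le_top)
  have hum := hu.aestronglyMeasurable_restrict I
  have hslice := aemeasurable_eLpNorm'_slice (rExp p) hv.measurable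
  have hfin := eLpNorm'_slice_sub_window_ne_top hp hu hv (hvL.trans_lt ENNReal.coe_lt_top).ne
    hI.measurableSet
  rw [normX_eq_eLpNorm' hp] at hvL ⊢
  rw [normY_eq_eLpNorm' hp] at herr ⊢
  refine (hstable I t₀ _ _ _ _ h (ENNReal.ofReal ε) hI ht₀
    (aemeasurable_eLpNorm'_slice _ (hum.sub hv.measurable)) hslice
    (aemeasurable_eLpNorm'_slice _ ((aestronglyMeasurable_nonlin hp ha hum).sub
      (aestronglyMeasurable_nonlin hp ha hv.measurable)))
    (aemeasurable_eLpNorm'_slice _ hv.measurable_error) hm.aemeasurable hduhamel ?_ hfin hvL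
    (hh.trans (by gcongr)) herr ?_).trans ?_
  · filter_upwards [hum.prodMk_left, hv.measurable.prodMk_left] with t hut hvt
    exact eLpNorm'_nonlin_sub_le hp ha haA hut hvt
  · exact (ENNReal.ofReal_le_ofReal hε).trans_eq ENNReal.ofReal_coe_nnreal
  · rw [ENNReal.ofReal_mul (by positivity)]
    gcongr
    exact ENNReal.ofReal_coe_nnreal.ge.trans (ENNReal.ofReal_le_ofReal (by linarith))

open StabilityNLS in
theorem mainTheorem7 (p : ℝ) (hp : 0 < p) (A L : ℝ) (hA : 0 ≤ A) (hL : 0 < L) :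
    ∃ ε₁ > (0 : ℝ), ∃ C > (0 : ℝ),
      ∀ a : Plane → ℝ, Admissible p a →
        eLpNorm a (rhoExp p) volume ≤ ENNReal.ofReal A →
      ∀ (I : Set ℝ) (t₀ : ℝ), I.OrdConnected → t₀ ∈ I →
      ∀ u₀ : Plane → ℂ, normH1 u₀ < ⊤ →
      ∀ v e : ℝ → Plane → ℂ, IsApproxSolution p a I t₀ v e →
        normX p I v ≤ ENNReal.ofReal L →
      ∀ ε : ℝ, ε ≤ ε₁ →
        normH1 (fun x => u₀ x - v t₀ x) + normY p I e < ENNReal.ofReal ε →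
      ∀ u : ℝ → Plane → ℂ, IsGlobalSolution p a t₀ u₀ u →
        normX p I (fun t x => u t x - v t x) +
            normY p I (fun t x => nonlin p a u t x - nonlin p a v t x) ≤
          ENNReal.ofReal (C * ε) := by
  obtain ⟨ε₁, hε₁, C, hC, H⟩ := mainTheorem7_general p hp A.toNNReal L.toNNReal
  exact ⟨ε₁, hε₁, C, hC, fun a ha haA I t₀ hI ht₀ u₀ _ =>
    H a ha.continuous.aestronglyMeasurable haA I t₀ hI ht₀ u₀⟩
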